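/- Let $\mathbb T^3=\mathbb R^3/\mathbb Z^3$ with its Haar probability measure $\mu$ and the distance $d$ given by the maximum of the three coordinate distances in $\mathbb R/\mathbb Z$ (any equivalent choice, such as the flat Riemannian distance, gives the same notions below). For a homeomorphism $T$ of a compact metric space, call a point $x$ super-recurrent for $T$ if there are a real number $a>1$ and a strictly increasing sequence of integers $k_n\ge 0$ such that $d(T^{k_n}x,x)\le \exp(-k_n^{a})$ for all $n$. There exist $(\alpha,\alpha')\in\mathbb R^2$ and a strictly positive function $\phi\in C^\infty(\mathbb T^3)$ such that the flow $(T^t)_{t\in\mathbb R}$ on $\mathbb T^3$ generated by the vector field $\phi\cdot(\alpha,\alpha',1)$, that is, by $$\frac{dx}{dt}=\phi(x)\,(\alpha,\alpha',1)$$ (the reparametrization with velocity $\phi$ of the linear flow of vector $(\alpha,\alpha',1)$), has the following properties. Let $T=T^1$ be its time-one map and let $\mu_\phi$ be the probability measure whose density with respect to $\mu$ is $\phi^{-1}/\int_{\mathbb T^3}\phi^{-1}\,d\mu$. 1. $\mu_\phi$ is the unique invariant Borel probability measure of the flow, and the flow is mixing for $\mu_\phi$: $\lim_{t\to\infty}\mu_\phi(T^tA\cap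 B)=\mu_\phi(A)\mu_\phi(B)$ for all measurable $A,B\subset\mathbb T^3$. 2. $\mu$-almost every $x\in\mathbb T^3$ is super-recurrent for $T$. 3. For every Hölder continuous $V:\mathbb T^3\to\mathbb R$, for $\mu$-almost every $x\in\mathbb T^3$, the Schrödinger operator on $\ell^2(\mathbb Z)$ given by $$(H_{T,V,x}u)_n=u_{n+1}+u_{n-1}+V(T^nx)\,u_n$$ has purely continuous spectrum: it has no eigenvalues, and $H_{T,V,x}-z$ has dense range for every $z$ in its spectrum. -/

import Mathlib

open MeasureTheory Filter Topology
open scoped ContDiff NNReal ENNReal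

/-! ### Recurrence and mixing -/

/-- A point `x` is super-recurrent for the homeomorphism `T` if there are an exponent `a > 1` and
integers `k 0 < k 1 < ⋯` with `d (T ^ (k n) x) x ≤ exp (- (k n) ^ a)` for all `n`. -/
def IsSuperRecurrent {Ω : Type*} [MetricSpace Ω] (T : Ω ≃ₜ Ω) (x : Ω) : Prop :=
  ∃ a : ℝ, 1 < a ∧ ∃ k : ℕ → ℕ, StrictMono k ∧
    ∀ n : ℕ, dist ((T ^ k n) x) x ≤ Real.exp (-((k n : ℝ) ^ a))

/-- The measure `ν` is invariant under every map of the flow `Φ`. -/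
def FlowInvariant {Ω : Type*} [TopologicalSpace Ω] [MeasurableSpace Ω] (Φ : Flow ℝ Ω)
    (ν : Measure Ω) : Prop :=
  ∀ t : ℝ, MeasurePreserving (Φ t) ν ν

/-- `ν` is the unique invariant probability measure of the flow `Φ`. -/
def IsUniqueInvariantMeasure {Ω : Type*} [TopologicalSpace Ω] [MeasurableSpace Ω]
    (Φ : Flow ℝ Ω) (ν : Measure Ω) : Prop :=
  IsProbabilityMeasure ν ∧ FlowInvariant Φ ν ∧
    ∀ ν' : Measure Ω, IsProbabilityMeasure ν' → FlowInvariant Φ ν' → ν' = ν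

/-- The flow `Φ` preserves `ν` and is mixing for `ν`: `ν (Φ_t A ∩ B) → ν A * ν B` as `t → ∞`. -/
def IsMixingFlow {Ω : Type*} [TopologicalSpace Ω] [MeasurableSpace Ω] (Φ : Flow ℝ Ω)
    (ν : Measure Ω) : Prop :=
  FlowInvariant Φ ν ∧
    ∀ A B : Set Ω, MeasurableSet A → MeasurableSet B →
      Tendsto (fun t : ℝ => ν (Φ t '' A ∩ B)) atTop (𝓝 (ν A * ν B))

/-! ### Smooth time changes of linear flows on the torus -/

/-- The torus `ℝ^d / ℤ^d`, with the product (maximum) of the quotient distances on `ℝ / ℤ`.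
Its `volume` is the Haar probability measure. -/
abbrev Torus (d : ℕ) : Type := Fin d → UnitAddCircle

/-- The projection `ℝ^d → ℝ^d / ℤ^d`. -/
def Torus.proj {d : ℕ} (x : Fin d → ℝ) : Torus d := fun i => (x i : UnitAddCircle)

/-- A function on the torus is smooth if its lift to `ℝ^d` is `C^∞`. -/
def Torus.IsSmooth {d : ℕ} (φ : Torus d → ℝ) : Prop :=
  ContDiff ℝ ∞ (fun x : Fin d → ℝ => φ (Torus.proj x))

/-- `Φ` is the flow of the vector field `φ v` on the torus, i.e. the reparametrization with
velocity `φ` of the linear flow of vector `v`: each trajectory of `Φ` lifts to a solution in `ℝ^d`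
of `dγ / dt = φ (γ) v`. -/
def Torus.IsReparametrizedFlow {d : ℕ} (v : Fin d → ℝ) (φ : Torus d → ℝ)
    (Φ : Flow ℝ (Torus d)) : Prop :=
  ∀ x : Fin d → ℝ, ∃ γ : ℝ → Fin d → ℝ, γ 0 = x ∧
    (∀ t : ℝ, HasDerivAt γ (φ (Torus.proj (γ t)) • v) t) ∧
    ∀ t : ℝ, Φ t (Torus.proj x) = Torus.proj (γ t)

/-- The measure with density proportional to `1 / φ` with respect to the Haar measure, normalized
to have total mass one. -/
noncomputable def Torus.invMeasure {d : ℕ} (φ : Torus d → ℝ) : Measure (Torus d) :=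
  (∫⁻ x : Torus d, ENNReal.ofReal (φ x)⁻¹)⁻¹ •
    (volume : Measure (Torus d)).withDensity (fun x => ENNReal.ofReal (φ x)⁻¹)

/-! ### Schrödinger operators on `ℓ²(ℤ)` -/

theorem memlp_shift (m : ℤ) (u : lp (fun _ : ℤ => ℂ) 2) :
    Memℓp (fun n : ℤ => u (n + m)) 2 := by
  have h := (memℓp_gen_iff (p := 2) (by norm_num)).1 (lp.memℓp u)
  exact (memℓp_gen_iff (p := 2) (by norm_num)).2 ((Equiv.addRight m).summable_iff.2 h)

/-- The shift `(S_m u)_n = u_{n + m}` on `ℓ²(ℤ)`. -/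
noncomputable def shiftCLM (m : ℤ) : lp (fun _ : ℤ => ℂ) 2 →L[ℂ] lp (fun _ : ℤ => ℂ) 2 :=
  LinearMap.mkContinuous
    { toFun := fun u => ⟨fun n : ℤ => u (n + m), memlp_shift m u⟩
      map_add' := fun _ _ => rfl
      map_smul' := fun _ _ => rfl }
    1
    (fun u => by
      have h2 : (0 : ℝ) < (2 : ℝ≥0∞).toReal := by norm_num
      rw [one_mul, lp.norm_eq_tsum_rpow h2, lp.norm_eq_tsum_rpow h2]
      exact le_of_eq (congrArg (fun r : ℝ => r ^ (1 / (2 : ℝ≥0∞).toReal))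
        ((Equiv.addRight m).tsum_eq (fun n : ℤ => ‖u n‖ ^ (2 : ℝ≥0∞).toReal))))

/-- Multiplication by a bounded real sequence on `ℓ²(ℤ)`. -/
noncomputable def multCLM (W : ℤ → ℝ) (K : ℝ) (hK : 0 ≤ K) (hW : ∀ n, |W n| ≤ K) :
    lp (fun _ : ℤ => ℂ) 2 →L[ℂ] lp (fun _ : ℤ => ℂ) 2 :=
  lp.mapCLM (E := fun _ : ℤ => ℂ) (F := fun _ : ℤ => ℂ) 2
    (fun n => ((W n : ℝ) : ℂ) • ContinuousLinearMap.id ℂ ℂ) hK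
    (fun n => by simpa [norm_smul] using hW n)

/-- The Schrödinger operator `(H u)_n = u_{n+1} + u_{n-1} + V (T^n x) u_n` on `ℓ²(ℤ)`. -/
noncomputable def schrodinger {Ω : Type*} [TopologicalSpace Ω] [CompactSpace Ω] (T : Ω ≃ₜ Ω)
    (V : C(Ω, ℝ)) (x : Ω) : lp (fun _ : ℤ => ℂ) 2 →L[ℂ] lp (fun _ : ℤ => ℂ) 2 :=
  shiftCLM 1 + shiftCLM (-1) +
    multCLM (fun n : ℤ => V ((T ^ n) x)) ‖V‖ (norm_nonneg V) (fun _ => V.norm_coe_le_norm _)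

theorem schrodinger_apply {Ω : Type*} [TopologicalSpace Ω] [CompactSpace Ω] (T : Ω ≃ₜ Ω)
    (V : C(Ω, ℝ)) (x : Ω) (u : lp (fun _ : ℤ => ℂ) 2) (n : ℤ) :
    schrodinger T V x u n = u (n + 1) + u (n - 1) + (V ((T ^ n) x) : ℂ) * u n := by
  simp only [schrodinger, add_apply, lp.coeFn_add, Pi.add_apply]
  rfl

/-- A bounded operator has purely continuous spectrum if it has no eigenvalue and `A - z` has
dense range for each `z` in its spectrum (empty point and residual spectrum). -/
def HasPurelyContinuousSpectrum {E : Type*} [NormedAddCommGroup E] [NormedSpace ℂ E]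
    (A : E →L[ℂ] E) : Prop :=
  (∀ z : ℂ, ¬ Module.End.HasEigenvalue (A : E →ₗ[ℂ] E) z) ∧
    ∀ z ∈ spectrum ℂ A, DenseRange (A - algebraMap ℂ (E →L[ℂ] E) z)

/-!
The flow has velocity `φ = 1 / f`, where `f = 1 + ∑ i, exp (-(Q i) ^ 3) * F i ⟨m i, p⟩` is a time
change of a linear flow in a Liouville direction `v = (α, α', 1)`. Here `α` and `α'` are the sums of
the `1 / Q i` over the even and the odd `i`, the `Q i` divide each other and grow
super-exponentially, and `m i` is the resonant frequency, of size `Q i`, which comes from the `i`-th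
partial sum. Since
`⟨m i, v⟩` is about `Q i / Q (i + 2)`, the phase `⟨m i, p⟩` is almost constant along the flow up to
times far beyond `exp ((Q (i + 1)) ^ 4)`. The profiles `F i` are smooth and periodic, vanish on an
interval (the plateau) of length of order `1 / i`, and have a derivative that vanishes only on a set
whose measure tends to zero.

*Mixing.* The `φ e_m`, where the `e_m` are the characters, span a dense space of continuous
functions, so it is enough to show that the Haar integrals of `(φ e_m) ∘ Φ_t * e_l`, `m ≠ 0`, tend
to zero (`Torus.isMixingFlow_reparamFlow`). For `t` between `exp ((Q n) ^ 4)` and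
`exp ((Q (n + 1)) ^ 4)`, the derivative of the travel time in the direction `shearDir Q n`,
transverse to the flow, is dominated by the contribution of the `n`-th resonance,
`t * exp (-(Q n) ^ 3) * (F n)' ⟨m n, p⟩`: the lower resonances of the same parity have averaged out,
the phases of the other parity do not depend on this direction, and the higher resonances have tiny
amplitudes (`IsAdapted.abs_shear_sub_le`). Integrating by parts in this direction
(`Torus.norm_correlation_shear_le`) gives decay, except where `(F n)'` is close to zero; there the
smooth weight `(F n)' / ((F n)' ^ 2 + κ ^ 2)` replaces the inverse of `(F n)'`, at a cost which
tends to zero in mean. Two families are needed because the `n - 1`-st resonance may still be frozen at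
these times.

*Unique ergodicity.* For an invariant probability measure, differentiating the constant function
`t ↦ ∫ e_m ∘ Φ_t` shows that the `φ e_m`, `m ≠ 0`, have mean zero, which determines the measure
(`Torus.isUniqueInvariantMeasure_invMeasure`).

*Super-recurrence.* `Q n • v` is within `2 * Q n / Q (n + 1)` of the integer lattice, and the travel
time over this distance is `Q n` up to `exp (-(Q n) ^ 2)` provided that the only resonance of
significant amplitude whose phase does not return, the one of index `n - 1`, is on its plateau
(`IsAdapted.dist_reparamFlow_le_of_plateau`). The even resonant phases are pairwise independent for
Haar measure and the lengths of the plateaus have a divergent sum, so that almost every point is on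
infinitely many of them (`ae_frequently_mem_of_pairwise_indepFun`).

*Spectrum.* The maps of the flow are Lipschitz with constants growing linearly in time, so for a
Hölder potential super-recurrence gives the almost periods of Gordon's theorem
(`hasPurelyContinuousSpectrum_of_isSuperRecurrent`), which excludes eigenvalues. The operators are
self-adjoint, so their residual spectrum is empty.
-/

/-! ### Gordon's argument for Schrödinger operators -/

section Gordon

open scoped Matrix.Norms.Operator

/-- One-step transfer matrix of the equation `u (n+1) + u (n-1) + W n * u n = z * u n`, acting on
the vectors `(u n, u (n-1))`. -/
def transferStep (z : ℂ) (W : ℤ → ℝ) (n : ℤ) : Matrix (Fin 2) (Fin 2) ℂ :=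
  !![z - (W n : ℂ), -1; 1, 0]

/-- Transfer matrix over the `k` sites `n₀, …, n₀ + k - 1`. -/
def transferMatrix (z : ℂ) (W : ℤ → ℝ) (n₀ : ℤ) : ℕ → Matrix (Fin 2) (Fin 2) ℂ
  | 0 => 1
  | k + 1 => transferStep z W (n₀ + k) * transferMatrix z W n₀ k

theorem transferMatrix_det (z : ℂ) (W : ℤ → ℝ) (n₀ : ℤ) (k : ℕ) :
    (transferMatrix z W n₀ k).det = 1 := by
  induction k with
  | zero => simp [transferMatrix]
  | succ k ih =>
    rw [transferMatrix, Matrix.det_mul, ih, mul_one, transferStep, Matrix.det_fin_two_of]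
    ring

theorem transferMatrix_mulVec {z : ℂ} {W : ℤ → ℝ} {u : ℤ → ℂ}
    (hu : ∀ n, u (n + 1) + u (n - 1) + (W n : ℂ) * u n = z * u n) (n₀ : ℤ) (k : ℕ) :
    (transferMatrix z W n₀ k).mulVec ![u n₀, u (n₀ - 1)] = ![u (n₀ + k), u (n₀ + k - 1)] := by
  induction k with
  | zero => simp [transferMatrix]
  | succ k ih =>
    rw [transferMatrix, ← Matrix.mulVec_mulVec, ih, transferStep]
    have h := hu (n₀ + k)
    ext i
    fin_cases i
    · simp [Matrix.mulVec, dotProduct, Fin.sum_univ_two]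
      rw [← add_assoc]
      linear_combination -h
    · simp [Matrix.mulVec, dotProduct, Fin.sum_univ_two]
      congr 1
      ring

theorem norm_transferStep_le {z : ℂ} {W : ℤ → ℝ} {K : ℝ} (hW : ∀ n, |W n| ≤ K) (n : ℤ) :
    ‖transferStep z W n‖ ≤ ‖z‖ + K + 1 := by
  have hK : 0 ≤ K := (abs_nonneg _).trans (hW 0)
  have h1 : ‖z - (W n : ℂ)‖ ≤ ‖z‖ + K := by
    refine (norm_sub_le _ _).trans ?_
    have : ‖(W n : ℂ)‖ ≤ K := by simpa using hW n
    linarith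
  rw [Matrix.linfty_opNorm_def]
  have h2 : ∀ i ∈ (Finset.univ : Finset (Fin 2)),
      ∑ j : Fin 2, ‖transferStep z W n i j‖₊ ≤ Real.toNNReal (‖z‖ + K + 1) := by
    intro i _
    rw [← NNReal.coe_le_coe, Real.coe_toNNReal _ (by positivity)]
    fin_cases i
    · simp only [transferStep, Fin.sum_univ_two]
      push_cast
      simpa using h1
    · simp only [transferStep, Fin.sum_univ_two]
      push_cast
      simpa using by positivity
  have h3 := Finset.sup_le h2
  have h4 := NNReal.coe_le_coe.2 h3
  rwa [Real.coe_toNNReal _ (by positivity)] at h4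

theorem norm_transferStep_sub_le (z : ℂ) (W : ℤ → ℝ) (m n : ℤ) :
    ‖transferStep z W m - transferStep z W n‖ ≤ |W m - W n| := by
  rw [Matrix.linfty_opNorm_def]
  have h2 : ∀ i ∈ (Finset.univ : Finset (Fin 2)),
      ∑ j : Fin 2, ‖(transferStep z W m - transferStep z W n) i j‖₊
        ≤ Real.toNNReal |W m - W n| := by
    intro i _
    rw [← NNReal.coe_le_coe, Real.coe_toNNReal _ (abs_nonneg _)]
    fin_cases i
    · simp only [transferStep, Fin.sum_univ_two]
      push_cast
      simp only [Matrix.sub_apply]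
      simp
      rw [← Complex.ofReal_sub, Complex.norm_real, Real.norm_eq_abs, abs_sub_comm]
    · simp only [transferStep, Fin.sum_univ_two]
      push_cast
      simp
  have h3 := Finset.sup_le h2
  have h4 := NNReal.coe_le_coe.2 h3
  rwa [Real.coe_toNNReal _ (abs_nonneg _)] at h4

theorem norm_transferMatrix_le {z : ℂ} {W : ℤ → ℝ} {C : ℝ}
    (hC : ∀ n, ‖transferStep z W n‖ ≤ C) (n₀ : ℤ) (k : ℕ) :
    ‖transferMatrix z W n₀ k‖ ≤ C ^ k := by
  induction k with
  | zero => simp [transferMatrix]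
  | succ k ih =>
    rw [transferMatrix, pow_succ']
    exact (norm_mul_le _ _).trans
      (mul_le_mul (hC _) ih (norm_nonneg _) ((norm_nonneg _).trans (hC 0)))

theorem norm_transferMatrix_sub_le {z : ℂ} {W : ℤ → ℝ} {C δ : ℝ} (hC1 : 1 ≤ C)
    (hC : ∀ n, ‖transferStep z W n‖ ≤ C) (n₀ n₁ : ℤ) (k : ℕ)
    (hδ : ∀ j : ℕ, j < k → |W (n₀ + j) - W (n₁ + j)| ≤ δ) :
    ‖transferMatrix z W n₀ k - transferMatrix z W n₁ k‖ ≤ k * C ^ k * δ := by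
  induction k with
  | zero => simp [transferMatrix]
  | succ k ih =>
    have ih' := ih fun j hj => hδ j (hj.trans (Nat.lt_succ_self k))
    have hd := hδ k (Nat.lt_succ_self k)
    have hδ0 : 0 ≤ δ := (abs_nonneg _).trans hd
    have e : transferMatrix z W n₀ (k + 1) - transferMatrix z W n₁ (k + 1)
        = transferStep z W (n₀ + k) * (transferMatrix z W n₀ k - transferMatrix z W n₁ k)
          + (transferStep z W (n₀ + k) - transferStep z W (n₁ + k)) * transferMatrix z W n₁ k := by
      rw [transferMatrix, transferMatrix, mul_sub, sub_mul]
      abel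
    rw [e]
    have h1 : ‖transferStep z W (n₀ + k) *
        (transferMatrix z W n₀ k - transferMatrix z W n₁ k)‖ ≤ C * (k * C ^ k * δ) :=
      (norm_mul_le _ _).trans (mul_le_mul (hC _) ih' (norm_nonneg _) (by linarith))
    have h2 : ‖(transferStep z W (n₀ + k) - transferStep z W (n₁ + k)) *
        transferMatrix z W n₁ k‖ ≤ δ * C ^ k :=
      (norm_mul_le _ _).trans (mul_le_mul ((norm_transferStep_sub_le _ _ _ _).trans hd)
        (norm_transferMatrix_le hC _ _) (norm_nonneg _) hδ0)
    have h3 : C ^ k ≤ C ^ (k + 1) := pow_le_pow_right₀ hC1 (Nat.le_succ k)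
    refine (norm_add_le _ _).trans ((add_le_add h1 h2).trans ?_)
    have h4 : δ * C ^ k ≤ δ * C ^ (k + 1) := mul_le_mul_of_nonneg_left h3 hδ0
    push_cast
    rw [pow_succ] at *
    linarith

theorem matrix_two_cayley_hamilton (A : Matrix (Fin 2) (Fin 2) ℂ) (hA : A.det = 1)
    (x : Fin 2 → ℂ) : A.mulVec (A.mulVec x) - A.trace • A.mulVec x + x = 0 := by
  rw [Matrix.det_fin_two] at hA
  ext i
  fin_cases i
  · simp [Matrix.trace_fin_two]
    linear_combination (-x 0) * hA
  · simp [Matrix.trace_fin_two]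
    linear_combination (-x 1) * hA

/-- Gordon's three-block estimate: if the potential is almost `k`-periodic on `[-k, 2k)`, a
solution cannot be small at all of `-k`, `k`, `2k` unless it is small at `0`. By Cayley–Hamilton
`A² - tr A • A + 1 = 0` for the transfer matrix `A` over a period, which is used at `0` when
`|tr A| ≤ 1` and at `-k` when `|tr A| ≥ 1`. -/
theorem gordon_bound {z : ℂ} {W : ℤ → ℝ} {u : ℤ → ℂ}
    (hu : ∀ n, u (n + 1) + u (n - 1) + (W n : ℂ) * u n = z * u n) {C δ : ℝ} (hC1 : 1 ≤ C)
    (hC : ∀ n, ‖transferStep z W n‖ ≤ C) (k : ℕ) (hk : k * C ^ (2 * k) * δ ≤ 1)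
    (hδ : ∀ j : ℤ, -k ≤ j → j ≤ k → |W (j + k) - W j| ≤ δ) :
    ‖![u 0, u (0 - 1)]‖ ≤ 2 * ‖![u k, u (k - 1)]‖ + ‖![u (k + k), u (k + k - 1)]‖
      + 3 * ‖![u (-k), u (-k - 1)]‖ := by
  set A := transferMatrix z W 0 k with hA
  have hdet : A.det = 1 := transferMatrix_det z W 0 k
  have hA1 : ‖A‖ ≤ C ^ k := norm_transferMatrix_le hC 0 k
  have hδ0 : 0 ≤ δ := (abs_nonneg _).trans (hδ 0 (by simp) (by simp))
  have hCk : 1 ≤ C ^ k := one_le_pow₀ hC1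
  have hη : k * C ^ k * δ ≤ 1 := by
    refine le_trans ?_ hk
    have : C ^ k ≤ C ^ (2 * k) := pow_le_pow_right₀ hC1 (by omega)
    gcongr
  have hη2 : C ^ k * (k * C ^ k * δ) ≤ 1 := by
    refine le_of_eq_of_le ?_ hk
    rw [two_mul, pow_add]
    ring
  have e1 : A.mulVec ![u 0, u (0 - 1)] = ![u k, u (k - 1)] := by
    simpa using transferMatrix_mulVec hu 0 k
  have e2 := transferMatrix_mulVec hu (k : ℤ) k
  have e3 := transferMatrix_mulVec hu (-k : ℤ) k
  rw [neg_add_cancel] at e3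
  have d2 : ‖A - transferMatrix z W k k‖ ≤ k * C ^ k * δ := by
    apply norm_transferMatrix_sub_le hC1 hC
    intro j hj
    rw [abs_sub_comm, add_comm (k : ℤ), zero_add]
    exact hδ j (by omega) (by omega)
  have d3 : ‖A - transferMatrix z W (-k) k‖ ≤ k * C ^ k * δ := by
    apply norm_transferMatrix_sub_le hC1 hC
    intro j hj
    have := hδ (-k + j) (by omega) (by omega)
    rwa [show (-k + j + k : ℤ) = 0 + j by ring] at this
  set X0 := ![u 0, u (0 - 1)]
  set X1 := ![u k, u (k - 1)]
  set X2 := ![u (k + k), u (k + k - 1)]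
  set Y := ![u (-k), u (-k - 1)]
  have n1 := norm_nonneg X1
  have n2 := norm_nonneg X2
  have n3 := norm_nonneg Y
  rcases le_total ‖A.trace‖ 1 with ht | ht
  · have ch := matrix_two_cayley_hamilton A hdet X0
    rw [e1] at ch
    have e4 : (A - transferMatrix z W k k).mulVec X1 = A.mulVec X1 - X2 := by
      rw [Matrix.sub_mulVec, e2]
    have e5 : X0 = A.trace • X1 - X2 - (A - transferMatrix z W k k).mulVec X1 := by
      rw [e4, ← sub_eq_zero]
      rw [← ch]
      abel
    have b1 : ‖(A - transferMatrix z W k k).mulVec X1‖ ≤ 1 * ‖X1‖ :=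
      (Matrix.linfty_opNorm_mulVec _ _).trans
        (mul_le_mul_of_nonneg_right (d2.trans hη) n1)
    have b2 : ‖A.trace • X1‖ ≤ 1 * ‖X1‖ := by
      rw [norm_smul]
      exact mul_le_mul_of_nonneg_right ht n1
    rw [e5]
    have := norm_sub_le (A.trace • X1 - X2) ((A - transferMatrix z W k k).mulVec X1)
    have := norm_sub_le (A.trace • X1) X2
    linarith
  · have ch := matrix_two_cayley_hamilton A hdet Y
    set e := (A - transferMatrix z W (-k) k).mulVec Y with he
    have e4 : A.mulVec Y = X0 + e := by
      rw [he, Matrix.sub_mulVec, e3]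
      abel
    rw [e4, Matrix.mulVec_add, e1] at ch
    have be : ‖e‖ ≤ (k * C ^ k * δ) * ‖Y‖ :=
      (Matrix.linfty_opNorm_mulVec _ _).trans (mul_le_mul_of_nonneg_right d3 n3)
    have be1 : ‖e‖ ≤ 1 * ‖Y‖ := be.trans (mul_le_mul_of_nonneg_right hη n3)
    have bAe : ‖A.mulVec e‖ ≤ 1 * ‖Y‖ := by
      refine (Matrix.linfty_opNorm_mulVec _ _).trans ?_
      refine (mul_le_mul hA1 be (norm_nonneg _) (by positivity)).trans ?_
      rw [← mul_assoc]
      exact mul_le_mul_of_nonneg_right hη2 n3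
    have e5 : A.trace • (X0 + e) = X1 + A.mulVec e + Y := by
      rw [← sub_eq_zero, ← neg_eq_zero, ← ch]
      abel
    have b3 : ‖X0 + e‖ ≤ ‖X1 + A.mulVec e + Y‖ := by
      rw [← e5, norm_smul]
      exact le_mul_of_one_le_left (norm_nonneg _) ht
    have := norm_add_le (X1 + A.mulVec e) Y
    have := norm_add_le X1 (A.mulVec e)
    have b4 : ‖X0‖ ≤ ‖X0 + e‖ + ‖e‖ := by
      simpa using norm_sub_le (X0 + e) e
    linarith

/-- Gordon's theorem: an eigenfunction in `ℓ²` cannot exist when the potential has infinitely many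
almost periods `k` with super-exponentially small errors. -/
theorem eq_zero_of_gordon {z : ℂ} {W : ℤ → ℝ} {u : ℤ → ℂ} {K : ℝ} (hW : ∀ n, |W n| ≤ K)
    (hu : ∀ n, u (n + 1) + u (n - 1) + (W n : ℂ) * u n = z * u n)
    (h0 : Tendsto u cofinite (𝓝 0))
    (hG : ∀ C : ℝ, 1 ≤ C → ∃ᶠ k : ℕ in atTop, ∃ δ : ℝ, k * C ^ (2 * k) * δ ≤ 1 ∧
      ∀ j : ℤ, -k ≤ j → j ≤ k → |W (j + k) - W j| ≤ δ) : u = 0 := by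
  have hK : 0 ≤ K := (abs_nonneg _).trans (hW 0)
  have hC1 : 1 ≤ ‖z‖ + K + 1 := by
    have := norm_nonneg z
    linarith
  have hC : ∀ n, ‖transferStep z W n‖ ≤ ‖z‖ + K + 1 := norm_transferStep_le hW
  have hX : ∀ (g : ℕ → ℤ), Function.Injective g →
      Tendsto (fun k : ℕ => ‖![u (g k), u (g k - 1)]‖) atTop (𝓝 0) := by
    intro g hg
    rw [← tendsto_zero_iff_norm_tendsto_zero, tendsto_pi_nhds]
    intro i
    rw [← Nat.cofinite_eq_atTop]
    fin_cases i
    · exact h0.comp hg.tendsto_cofinite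
    · exact h0.comp ((sub_left_injective.comp hg).tendsto_cofinite)
  have t1 := hX (fun k => (k : ℤ)) Nat.cast_injective
  have t2 := hX (fun k => (k : ℤ) + k) (fun a b h => by simp only at h; omega)
  have t3 := hX (fun k => -(k : ℤ)) (fun a b h => by simp only at h; omega)
  have t : Tendsto (fun k : ℕ => 2 * ‖![u (k : ℤ), u ((k : ℤ) - 1)]‖ +
      ‖![u ((k : ℤ) + k), u ((k : ℤ) + k - 1)]‖ + 3 * ‖![u (-(k : ℤ)), u (-(k : ℤ) - 1)]‖)
      atTop (𝓝 0) := by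
    simpa using ((t1.const_mul 2).add t2).add (t3.const_mul 3)
  have hz : ‖![u 0, u (0 - 1)]‖ ≤ 0 := by
    refine le_of_forall_pos_lt_add fun ε hε => ?_
    obtain ⟨k, ⟨δ, hδ1, hδ2⟩, hk⟩ := ((hG _ hC1).and_eventually (t.eventually_lt_const hε)).exists
    rw [zero_add]
    exact (gordon_bound hu hC1 hC k hδ1 hδ2).trans_lt hk
  have hz' : ![u 0, u (0 - 1)] = 0 := norm_le_zero_iff.1 hz
  have hpos : ∀ k : ℕ, u k = 0 := by
    intro k
    have e := transferMatrix_mulVec hu 0 k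
    rw [hz', Matrix.mulVec_zero] at e
    simpa using (congrFun e 0).symm
  have hneg : ∀ k : ℕ, ![u (-k), u (-k - 1)] = 0 := by
    intro k
    have e := transferMatrix_mulVec hu (-k) k
    rw [neg_add_cancel, hz'] at e
    refine Matrix.eq_zero_of_mulVec_eq_zero ?_ e
    rw [transferMatrix_det]
    exact one_ne_zero
  ext n
  obtain ⟨k, rfl | rfl⟩ := n.eq_nat_or_neg
  · exact hpos k
  · simpa using congrFun (hneg k) 0

end Gordon

theorem tendsto_cofinite_lp (u : lp (fun _ : ℤ => ℂ) 2) :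
    Tendsto (fun n : ℤ => u n) cofinite (𝓝 0) := by
  have h := (memℓp_gen_iff (p := 2) (by norm_num)).1 (lp.memℓp u)
  have h2 := h.tendsto_cofinite_zero
  rw [tendsto_zero_iff_norm_tendsto_zero]
  have h3 := (Real.continuous_sqrt.tendsto _).comp h2
  simpa [Function.comp_def] using h3

/-- For a real potential, `H - z` has dense range as soon as `conj z` is not an eigenvalue. -/
theorem denseRange_schrodinger_sub {Ω : Type*} [TopologicalSpace Ω] [CompactSpace Ω] (T : Ω ≃ₜ Ω)
    (V : C(Ω, ℝ)) (x : Ω) (z : ℂ)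
    (h : ∀ u : lp (fun _ : ℤ => ℂ) 2,
      schrodinger T V x u = (starRingEnd ℂ z) • u → u = 0) :
    DenseRange (schrodinger T V x -
      algebraMap ℂ (lp (fun _ : ℤ => ℂ) 2 →L[ℂ] lp (fun _ : ℤ => ℂ) 2) z) := by
  set A := schrodinger T V x -
    algebraMap ℂ (lp (fun _ : ℤ => ℂ) 2 →L[ℂ] lp (fun _ : ℤ => ℂ) 2) z with hA
  have h1 : (LinearMap.range (A : lp (fun _ : ℤ => ℂ) 2 →ₗ[ℂ] lp (fun _ : ℤ => ℂ) 2))ᗮ = ⊥ := by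
    rw [Submodule.eq_bot_iff]
    intro y hy
    apply h
    ext n
    rw [schrodinger_apply]
    have h2 := (Submodule.mem_orthogonal' _ _).1 hy (A (lp.single 2 n 1)) ⟨_, rfl⟩
    have h3 : A (lp.single 2 n 1) = lp.single 2 (n - 1) 1 + lp.single 2 (n + 1) 1
        + ((V ((T ^ n) x) : ℂ) - z) • lp.single 2 n 1 := by
      ext m
      have e : (algebraMap ℂ (lp (fun _ : ℤ => ℂ) 2 →L[ℂ] lp (fun _ : ℤ => ℂ) 2) z)
          (lp.single 2 n 1) = z • lp.single 2 n (1 : ℂ) := by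
        rw [Algebra.algebraMap_eq_smul_one]
        rfl
      rw [hA, sub_apply, lp.coeFn_sub, Pi.sub_apply, schrodinger_apply, e]
      simp only [lp.coeFn_add, Pi.add_apply, lp.coeFn_smul, Pi.smul_apply, lp.single_apply,
        Pi.single_apply, smul_eq_mul]
      have i1 : (m + 1 = n) ↔ (m = n - 1) := by omega
      have i2 : (m - 1 = n) ↔ (m = n + 1) := by omega
      simp only [i1, i2]
      by_cases hm : m = n
      · subst hm
        simp
        ring
      · simp [hm]
    rw [h3, inner_add_right, inner_add_right, inner_smul_right, ← inner_conj_symm,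
      ← inner_conj_symm y (lp.single 2 (n + 1) 1), ← inner_conj_symm y (lp.single 2 n 1),
      lp.inner_single_left, lp.inner_single_left, lp.inner_single_left] at h2
    have h4 := congrArg (starRingEnd ℂ) h2
    simp at h4
    simp
    linear_combination h4
  have h2 := Submodule.topologicalClosure_eq_top_iff.2 h1
  rw [← Submodule.dense_iff_topologicalClosure_eq_top] at h2
  exact h2

/-- Super-recurrence with Hölder potentials and at most linearly growing Lipschitz constants gives
the hypothesis of Gordon's theorem. -/
theorem hasPurelyContinuousSpectrum_of_isSuperRecurrent {Ω : Type*} [MetricSpace Ω]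
    [CompactSpace Ω] (T : Ω ≃ₜ Ω) {B : ℝ} (hB : 0 ≤ B)
    (hT : ∀ (n : ℤ) (x y : Ω), dist ((T ^ n) x) ((T ^ n) y) ≤ (1 + B * |(n : ℝ)|) * dist x y)
    (V : C(Ω, ℝ)) {c r : ℝ≥0} (hr : 0 < r) (hV : HolderWith c r V) {x : Ω}
    (hx : IsSuperRecurrent T x) : HasPurelyContinuousSpectrum (schrodinger T V x) := by
  have key : ∀ (z : ℂ) (u : lp (fun _ : ℤ => ℂ) 2), schrodinger T V x u = z • u → u = 0 := by
    intro z u hu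
    obtain ⟨a, ha, k, hk, hrec⟩ := hx
    have hW : ∀ n : ℤ, |V ((T ^ n) x)| ≤ ‖V‖ := fun n => V.norm_coe_le_norm _
    have hfun : (fun n : ℤ => u n) = 0 := by
      refine eq_zero_of_gordon (z := z) (W := fun n : ℤ => V ((T ^ n) x)) hW ?_
        (tendsto_cofinite_lp u) ?_
      · intro n
        have := congrArg (fun w : lp (fun _ : ℤ => ℂ) 2 => w n) hu
        simp only [schrodinger_apply] at this
        simpa using this
      · intro C hC
        have hr' : (0 : ℝ) < r := by exact_mod_cast hr
        have hlim : Tendsto (fun n : ℕ => (c : ℝ) * Real.exp ((n : ℝ) *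
            ((1 + 2 * Real.log C + r * B) - r * (n : ℝ) ^ (a - 1)))) atTop (𝓝 (c * 0)) := by
          refine Tendsto.const_mul _ (Real.tendsto_exp_atBot.comp ?_)
          refine tendsto_natCast_atTop_atTop.atTop_mul_atBot₀ ?_
          refine tendsto_atBot_add_const_left _ _ (tendsto_neg_atTop_atBot.comp ?_)
          exact Tendsto.const_mul_atTop hr' ((tendsto_rpow_atTop (by linarith)).comp
            tendsto_natCast_atTop_atTop)
        rw [mul_zero] at hlim
        have hev := (hlim.eventually_le_const (show (0:ℝ) < 1 by norm_num)).and
          (eventually_gt_atTop 0)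
        have hfr : ∃ᶠ m : ℕ in atTop, m ∈ Set.range k := by
          rw [Nat.frequently_atTop_iff_infinite]
          exact Set.infinite_range_of_injective hk.injective
        refine (hfr.and_eventually hev).mono ?_
        rintro m ⟨⟨i, rfl⟩, h1, hm0⟩
        set m := k i with hm
        have hm0' : (0 : ℝ) < m := by exact_mod_cast hm0
        -- The Hölder bound for the potential along the orbits of `x` and of `T ^ m x`.
        refine ⟨c * ((1 + B * m) * Real.exp (-((m : ℝ) ^ a))) ^ (r : ℝ), ?_, ?_⟩
        · refine le_trans ?_ h1
          have e1 : (m : ℝ) ≤ Real.exp m := by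
            have := Real.add_one_le_exp (m : ℝ)
            linarith
          have e2 : C ^ (2 * m) = Real.exp (m * (2 * Real.log C)) := by
            rw [← Real.exp_log (by linarith : (0 : ℝ) < C), ← Real.exp_nat_mul, Real.log_exp]
            push_cast
            ring_nf
          have e3 : ((1 + B * m) * Real.exp (-((m : ℝ) ^ a))) ^ (r : ℝ)
              ≤ Real.exp (m * (r * B) - m * (r * (m : ℝ) ^ (a - 1))) := by
            have : (1 + B * m) ≤ Real.exp (B * m) := by
              have := Real.add_one_le_exp (B * m)
              linarith
            calc ((1 + B * m) * Real.exp (-((m : ℝ) ^ a))) ^ (r : ℝ)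
                ≤ (Real.exp (B * m) * Real.exp (-((m : ℝ) ^ a))) ^ (r : ℝ) := by gcongr
              _ = Real.exp (m * (r * B) - m * (r * (m : ℝ) ^ (a - 1))) := by
                rw [← Real.exp_add, ← Real.exp_mul, Real.rpow_sub_one hm0'.ne']
                congr 1
                field_simp
                ring
          calc (m : ℝ) * C ^ (2 * m) * (c * ((1 + B * m) * Real.exp (-((m : ℝ) ^ a))) ^ (r : ℝ))
              ≤ Real.exp m * C ^ (2 * m) * (c * Real.exp (m * (r * B) -
                  m * (r * (m : ℝ) ^ (a - 1)))) := by gcongr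
            _ = _ := by
              rw [e2, mul_left_comm, ← Real.exp_add, ← Real.exp_add]
              congr 2
              ring
        · intro j hj1 hj2
          have h2 := hV.dist_le ((T ^ (j + (m : ℤ))) x) ((T ^ j) x)
          rw [Real.dist_eq] at h2
          refine h2.trans ?_
          have h3 : dist ((T ^ (j + (m : ℤ))) x) ((T ^ j) x)
              ≤ (1 + B * m) * Real.exp (-((m : ℝ) ^ a)) := by
            rw [zpow_add, zpow_natCast]
            have h4 := hT j ((T ^ m) x) x
            refine h4.trans ?_
            have h5 : |(j : ℝ)| ≤ m := by
              rw [abs_le]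
              exact ⟨by exact_mod_cast hj1, by exact_mod_cast hj2⟩
            have := hrec i
            gcongr
          gcongr
    ext n
    exact congrFun hfun n
  refine ⟨fun z hz => ?_, fun z _ => denseRange_schrodinger_sub T V x z fun u hu => key _ u hu⟩
  obtain ⟨u, hu, hu0⟩ := hz.exists_hasEigenvector
  exact hu0 (key z u (Module.End.mem_eigenspace_iff.1 hu))

/-! ### Reparametrization of a linear flow -/

namespace Torus

variable {d : ℕ}

theorem proj_add (x y : Fin d → ℝ) : proj (x + y) = proj x + proj y := rfl

theorem proj_zero : proj (0 : Fin d → ℝ) = 0 := rfl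

theorem continuous_proj : Continuous (proj (d := d)) :=
  continuous_pi fun i => (AddCircle.continuous_mk' 1).comp (continuous_apply i)

theorem continuous_proj_smul (v : Fin d → ℝ) : Continuous fun u : ℝ => proj (u • v) :=
  continuous_proj.comp (continuous_id.smul continuous_const)

theorem dist_add_proj_le (p : Torus d) (x : Fin d → ℝ) : dist (p + proj x) p ≤ ‖x‖ := by
  refine (dist_pi_le_iff (norm_nonneg _)).2 fun i => ?_
  rw [dist_eq_norm, Pi.add_apply, add_sub_cancel_left]
  exact QuotientAddGroup.norm_mk_le_norm.trans (norm_le_pi_norm x i)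

/-- Two points of the torus differ by a vector whose norm is their distance. -/
theorem exists_proj_eq_add (p q : Torus d) :
    ∃ x : Fin d → ℝ, q = p + proj x ∧ ‖x‖ ≤ dist p q := by
  have h : ∀ i, ∃ y : ℝ, (y : UnitAddCircle) = q i - p i ∧ ‖y‖ ≤ dist p q := by
    intro i
    obtain ⟨y, hy⟩ := QuotientAddGroup.mk_surjective (q i - p i)
    have hy' : (y : UnitAddCircle) = q i - p i := hy
    refine ⟨y - round y, ?_, ?_⟩
    · rw [AddCircle.coe_sub, hy']
      have : ((round y : ℝ) : UnitAddCircle) = 0 := by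
        have := AddCircle.coe_zsmul (p := (1 : ℝ)) (n := round y) (x := 1)
        rw [AddCircle.coe_period] at this
        simp at this ⊢
      rw [this, sub_zero]
    · rw [Real.norm_eq_abs, ← UnitAddCircle.norm_eq, hy', ← dist_eq_norm, dist_comm]
      exact dist_le_pi_dist p q i
  choose y hy hy2 using h
  refine ⟨y, ?_, (pi_norm_le_iff_of_nonneg dist_nonneg).2 hy2⟩
  ext i
  simp [proj, hy]

/-- The time needed to go from `p` to `p + s v` along the trajectory, when the speed at `q` is
`1 / f q` times the speed of the linear flow of vector `v`. -/
noncomputable def travelTime (v : Fin d → ℝ) (f : Torus d → ℝ) (p : Torus d) (s : ℝ) : ℝ :=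
  ∫ u in (0 : ℝ)..s, f (p + proj (u • v))

variable (v : Fin d → ℝ) (f : C(Torus d, ℝ))

theorem continuous_along (p : Torus d) : Continuous fun u : ℝ => f (p + proj (u • v)) :=
  f.continuous.comp (continuous_const.add (continuous_proj_smul v))

theorem travelTime_zero (p : Torus d) : travelTime v f p 0 = 0 := by simp [travelTime]

theorem hasDerivAt_travelTime (p : Torus d) (s : ℝ) :
    HasDerivAt (travelTime v f p) (f (p + proj (s • v))) s :=
  (continuous_along v f p).integral_hasStrictDerivAt 0 s |>.hasDerivAt

theorem travelTime_sub (p : Torus d) (s s' : ℝ) :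
    travelTime v f p s' - travelTime v f p s = ∫ u in s..s', f (p + proj (u • v)) :=
  intervalIntegral.integral_interval_sub_left ((continuous_along v f p).intervalIntegrable _ _)
    ((continuous_along v f p).intervalIntegrable _ _)

theorem travelTime_add (p : Torus d) (s s' : ℝ) :
    travelTime v f p (s + s') = travelTime v f p s + travelTime v f (p + proj (s • v)) s' := by
  have h := travelTime_sub v f p s (s + s')
  have h2 : travelTime v f (p + proj (s • v)) s' = ∫ u in s..(s + s'), f (p + proj (u • v)) := by
    have := intervalIntegral.integral_comp_add_left (a := 0) (b := s')
      (fun u => f (p + proj (u • v))) s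
    rw [add_zero] at this
    rw [← this, travelTime]
    simp only [add_smul, proj_add, add_assoc]
  rw [h2, ← h]
  ring

theorem continuous_travelTime (s : ℝ) : Continuous fun p => travelTime v f p s := by
  refine intervalIntegral.continuous_parametric_intervalIntegral_of_continuous (s := fun _ => s)
    ?_ continuous_const
  exact f.continuous.comp (continuous_fst.add ((continuous_proj_smul v).comp continuous_snd))

variable {f}

theorem exists_pos_forall_le (hf : ∀ p, 0 < f p) : ∃ c > 0, ∀ p, c ≤ f p := by
  obtain ⟨p, hp⟩ := f.continuous.exists_forall_le_of_hasCompactSupport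
    (HasCompactSupport.of_compactSpace _)
  exact ⟨f p, hf p, hp⟩

variable {v}

theorem le_travelTime_sub {c : ℝ} (hc : ∀ p, c ≤ f p) (p : Torus d) {s s' : ℝ} (h : s ≤ s') :
    c * (s' - s) ≤ travelTime v f p s' - travelTime v f p s := by
  rw [travelTime_sub]
  have := intervalIntegral.integral_mono_on h (intervalIntegrable_const (c := c) (μ := volume))
    ((continuous_along v f p).intervalIntegrable _ _) fun u _ => hc _
  simpa [mul_comm] using this

theorem abs_le_travelTime_sub {c : ℝ} (hc : ∀ p, c ≤ f p) (p : Torus d) (s s' : ℝ) :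
    c * |s' - s| ≤ |travelTime v f p s' - travelTime v f p s| := by
  rcases le_total s s' with h | h
  · rw [abs_of_nonneg (sub_nonneg.2 h)]
    exact (le_travelTime_sub hc p h).trans (le_abs_self _)
  · rw [abs_sub_comm, abs_sub_comm (travelTime v f p s'), abs_of_nonneg (sub_nonneg.2 h)]
    exact (le_travelTime_sub hc p h).trans (le_abs_self _)

theorem travelTime_injective (hf : ∀ p, 0 < f p) (p : Torus d) :
    Function.Injective (travelTime v f p) := by
  obtain ⟨c, hc, hfc⟩ := exists_pos_forall_le hf
  intro s s' h
  have := abs_le_travelTime_sub (v := v) hfc p s s'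
  rw [h, sub_self, abs_zero] at this
  have h2 : |s' - s| = 0 := le_antisymm (by nlinarith [abs_nonneg (s' - s)]) (abs_nonneg _)
  linarith [abs_eq_zero.1 h2]

theorem travelTime_surjective (hf : ∀ p, 0 < f p) (p : Torus d) :
    Function.Surjective (travelTime v f p) := by
  obtain ⟨c, hc, hfc⟩ := exists_pos_forall_le hf
  have hcont : Continuous (travelTime v f p) :=
    continuous_iff_continuousAt.2 fun s => (hasDerivAt_travelTime v f p s).continuousAt
  refine hcont.surjective ?_ ?_
  · refine tendsto_atTop_mono' _ ?_ (tendsto_id.const_mul_atTop hc)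
    filter_upwards [eventually_ge_atTop 0] with s hs
    have := le_travelTime_sub (v := v) hfc p hs
    rw [travelTime_zero] at this
    simpa using this
  · refine tendsto_atBot_mono' _ ?_ (tendsto_id.const_mul_atBot hc)
    filter_upwards [eventually_le_atBot 0] with s hs
    have := le_travelTime_sub (v := v) hfc p hs
    rw [travelTime_zero] at this
    simp only [id]
    linarith

variable (v) (f) in
/-- The displacement, in units of `v`, after time `t` along the trajectory of `p`: the inverse
function of `travelTime v f p`. -/
noncomputable def displacement (t : ℝ) (p : Torus d) : ℝ :=
  Function.invFun (travelTime v f p) t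

theorem travelTime_displacement (hf : ∀ p, 0 < f p) (t : ℝ) (p : Torus d) :
    travelTime v f p (displacement v f t p) = t :=
  Function.invFun_eq (travelTime_surjective hf p t)

theorem displacement_unique (hf : ∀ p, 0 < f p) {t s : ℝ} {p : Torus d}
    (h : travelTime v f p s = t) : displacement v f t p = s :=
  travelTime_injective hf p ((travelTime_displacement hf t p).trans h.symm)

theorem displacement_add (hf : ∀ p, 0 < f p) (t t' : ℝ) (p : Torus d) :
    displacement v f (t + t') p = displacement v f t' p +
      displacement v f t (p + proj (displacement v f t' p • v)) := by
  apply displacement_unique hf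
  rw [travelTime_add, travelTime_displacement hf, travelTime_displacement hf, add_comm]

/-- Moving the starting point along the linear flow shifts the displacement. -/
theorem displacement_along (hf : ∀ p, 0 < f p) (t r : ℝ) (p : Torus d) :
    r + displacement v f t (p + proj (r • v)) =
      displacement v f (t + travelTime v f p r) p := by
  symm
  apply displacement_unique hf
  rw [travelTime_add, travelTime_displacement hf, add_comm]

theorem continuous_displacement (hf : ∀ p, 0 < f p) :
    Continuous fun x : ℝ × Torus d => displacement v f x.1 x.2 := by
  obtain ⟨c, hc, hfc⟩ := exists_pos_forall_le hf
  rw [continuous_iff_continuousAt]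
  rintro ⟨t₀, p₀⟩
  rw [ContinuousAt, tendsto_iff_dist_tendsto_zero]
  set s₀ := displacement v f t₀ p₀
  have h1 : Continuous fun x : ℝ × Torus d => c⁻¹ * |x.1 - travelTime v f x.2 s₀| := by
    have := (continuous_travelTime v f s₀).comp (continuous_snd (X := ℝ))
    exact continuous_const.mul (continuous_fst.sub this).abs
  have h2 := h1.tendsto (t₀, p₀)
  simp only [s₀, travelTime_displacement hf, sub_self, abs_zero, mul_zero] at h2
  refine squeeze_zero (fun _ => dist_nonneg) (fun x => ?_) h2
  have h3 := abs_le_travelTime_sub (v := v) hfc x.2 s₀ (displacement v f x.1 x.2)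
  rw [travelTime_displacement hf] at h3
  rw [Real.dist_eq, inv_mul_eq_div, le_div_iff₀ hc, mul_comm]
  exact h3

variable (v) in
/-- The reparametrization with velocity `1 / f` of the linear flow of vector `v`. -/
noncomputable def reparamFlow (hf : ∀ p, 0 < f p) : Flow ℝ (Torus d) where
  toFun t p := p + proj (displacement v f t p • v)
  cont' := continuous_snd.add ((continuous_proj_smul v).comp (continuous_displacement hf))
  map_add' t t' p := by
    rw [displacement_add hf, add_smul, proj_add, add_assoc]
  map_zero' p := by
    rw [displacement_unique hf (travelTime_zero v f p), zero_smul, proj_zero, add_zero]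

theorem reparamFlow_apply (hf : ∀ p, 0 < f p) (t : ℝ) (p : Torus d) :
    reparamFlow v hf t p = p + proj (displacement v f t p • v) := rfl

theorem hasDerivAt_displacement (hf : ∀ p, 0 < f p) (t : ℝ) (p : Torus d) :
    HasDerivAt (fun t => displacement v f t p) (f (reparamFlow v hf t p))⁻¹ t := by
  refine HasDerivAt.of_local_left_inverse (f := travelTime v f p) ?_
    (hasDerivAt_travelTime v f p _) (hf _).ne'
    (Eventually.of_forall fun t => travelTime_displacement hf t p)
  exact ((continuous_displacement hf).comp (continuous_id.prodMk continuous_const)).continuousAt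

theorem isReparametrizedFlow_reparamFlow (hf : ∀ p, 0 < f p) :
    IsReparametrizedFlow v (fun p => (f p)⁻¹) (reparamFlow v hf) := by
  intro x
  refine ⟨fun t => x + displacement v f t (proj x) • v, ?_, fun t => ?_, fun t => ?_⟩
  · simp only
    rw [displacement_unique hf (travelTime_zero v f _), zero_smul, add_zero]
  · exact ((hasDerivAt_displacement hf t (proj x)).smul_const v).const_add x
  · rw [reparamFlow_apply, proj_add]

theorem reparamFlow_along (hf : ∀ p, 0 < f p) (t r : ℝ) (p : Torus d) :
    reparamFlow v hf t (p + proj (r • v)) = reparamFlow v hf (t + travelTime v f p r) p := by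
  rw [reparamFlow_apply, reparamFlow_apply, ← displacement_along hf, add_smul, proj_add, add_assoc]

/-- The time-`t` map is Lipschitz, with a constant growing at most linearly in `t`. -/
theorem exists_dist_reparamFlow_le (hf : ∀ p, 0 < f p) {L : ℝ}
    (hL : ∀ p q, |f p - f q| ≤ L * dist p q) :
    ∃ B : ℝ, 0 ≤ B ∧ ∀ (t : ℝ) (p q : Torus d),
      dist (reparamFlow v hf t p) (reparamFlow v hf t q) ≤ (1 + B * |t|) * dist p q := by
  obtain ⟨c, hc, hfc⟩ := exists_pos_forall_le hf
  have key : ∀ (t : ℝ) (p q : Torus d), |displacement v f t p - displacement v f t q|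
      ≤ c⁻¹ * (c⁻¹ * |t| * (|L| * dist p q)) := by
    intro t p q
    have h1 := abs_le_travelTime_sub (v := v) hfc p (displacement v f t q) (displacement v f t p)
    rw [travelTime_displacement hf] at h1
    have h2 : |t - travelTime v f p (displacement v f t q)|
        ≤ (|L| * dist p q) * |displacement v f t q| := by
      nth_rw 1 [← travelTime_displacement (v := v) hf t q]
      rw [travelTime, travelTime, ← intervalIntegral.integral_sub
        ((continuous_along v f q).intervalIntegrable _ _)
        ((continuous_along v f p).intervalIntegrable _ _)]
      have := intervalIntegral.norm_integral_le_of_norm_le_const (a := 0)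
        (b := displacement v f t q) (C := |L| * dist p q)
        (f := fun u => f (q + proj (u • v)) - f (p + proj (u • v))) (fun u _ => ?_)
      · simpa using this
      · rw [Real.norm_eq_abs, abs_sub_comm]
        refine (hL _ _).trans ?_
        rw [dist_add_right]
        exact mul_le_mul_of_nonneg_right (le_abs_self _) dist_nonneg
    have h3 := abs_le_travelTime_sub (v := v) hfc q 0 (displacement v f t q)
    rw [travelTime_displacement hf, travelTime_zero, sub_zero, sub_zero] at h3
    have h4 : |displacement v f t q| ≤ c⁻¹ * |t| := by
      rw [inv_mul_eq_div, le_div_iff₀ hc, mul_comm]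
      exact h3
    rw [inv_mul_eq_div, le_div_iff₀ hc, mul_comm]
    refine h1.trans (h2.trans ?_)
    rw [mul_comm]
    gcongr
  refine ⟨c⁻¹ * (c⁻¹ * |L|) * ‖v‖, by positivity, fun t p q => ?_⟩
  set s := displacement v f t p with hs
  set s' := displacement v f t q with hs'
  have e : reparamFlow v hf t q + proj ((s - s') • v) = q + proj (s • v) := by
    rw [reparamFlow_apply, add_assoc, ← proj_add, ← add_smul, add_sub_cancel]
  have h1 : dist (reparamFlow v hf t p) (q + proj (s • v)) = dist p q := by
    rw [reparamFlow_apply, dist_add_right]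
  have h2 := dist_add_proj_le (reparamFlow v hf t q) ((s - s') • v)
  rw [e, norm_smul, Real.norm_eq_abs] at h2
  have h3 := dist_triangle (reparamFlow v hf t p) (q + proj (s • v)) (reparamFlow v hf t q)
  have h4 := mul_le_mul_of_nonneg_right (key t p q) (norm_nonneg v)
  calc _ ≤ dist p q + c⁻¹ * (c⁻¹ * |t| * (|L| * dist p q)) * ‖v‖ := by linarith
    _ = _ := by ring

end Torus

/-! ### Characters of the torus -/

instance : IsProbabilityMeasure (volume : Measure UnitAddCircle) :=
  ⟨UnitAddCircle.measure_univ⟩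

namespace Torus

open UnitAddTorus (mFourier)

variable {d : ℕ}

/-- The pairing of an integer frequency with a real direction. -/
def pairing (m : Fin d → ℤ) (w : Fin d → ℝ) : ℝ := ∑ i, (m i : ℝ) * w i

theorem pairing_smul (m : Fin d → ℤ) (r : ℝ) (w : Fin d → ℝ) :
    pairing m (r • w) = r * pairing m w := by
  simp only [pairing, Finset.mul_sum, Pi.smul_apply, smul_eq_mul]
  exact Finset.sum_congr rfl fun i _ => by ring

theorem pairing_add (m : Fin d → ℤ) (w w' : Fin d → ℝ) :
    pairing m (w + w') = pairing m w + pairing m w' := by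
  simp only [pairing, ← Finset.sum_add_distrib, Pi.add_apply, mul_add]

theorem mFourier_add_proj (m : Fin d → ℤ) (p : Torus d) (w : Fin d → ℝ) :
    mFourier m (p + proj w) =
      mFourier m p * Complex.exp (2 * Real.pi * Complex.I * (pairing m w : ℝ)) := by
  have h : ∀ i, fourier (m i) ((p + proj w) i) =
      fourier (m i) (p i) * Complex.exp (2 * Real.pi * Complex.I * ((m i : ℝ) * w i : ℝ)) := by
    intro i
    have e : fourier (m i) ((w i : UnitAddCircle)) =
        Complex.exp (2 * Real.pi * Complex.I * ((m i : ℝ) * w i : ℝ)) := by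
      rw [fourier_coe_apply]
      congr 1
      push_cast
      ring
    rw [← e, fourier_apply, fourier_apply, fourier_apply, Pi.add_apply, smul_add,
      AddCircle.toCircle_add]
    rfl
  change ∏ i, fourier (m i) ((p + proj w) i) = (∏ i, fourier (m i) (p i)) * _
  rw [Finset.prod_congr rfl fun i _ => h i, Finset.prod_mul_distrib, ← Complex.exp_sum,
    ← Finset.mul_sum, pairing]
  push_cast
  rfl

theorem hasDerivAt_mFourier_line (m : Fin d → ℤ) (p : Torus d) (w : Fin d → ℝ) (r : ℝ) :
    HasDerivAt (fun r : ℝ => mFourier m (p + proj (r • w)))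
      (2 * Real.pi * Complex.I * (pairing m w : ℝ) * mFourier m (p + proj (r • w))) r := by
  simp only [mFourier_add_proj, pairing_smul]
  have h1 : HasDerivAt (fun r : ℝ => ((r * pairing m w : ℝ) : ℂ)) (pairing m w : ℝ) r := by
    have := ((hasDerivAt_id r).mul_const (pairing m w)).ofReal_comp
    simpa using this
  have h2 := ((h1.const_mul (2 * Real.pi * Complex.I)).cexp).const_mul (mFourier m p)
  refine h2.congr_deriv ?_
  ring

theorem norm_mFourier_apply (m : Fin d → ℤ) (p : Torus d) : ‖mFourier m p‖ = 1 := by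
  change ‖∏ i, fourier (m i) (p i)‖ = 1
  rw [norm_prod]
  exact Finset.prod_eq_one fun i _ => by rw [fourier_apply]; exact Circle.norm_coe _

theorem _root_.ContinuousMap.integrable_of_compactSpace {X E : Type*} [TopologicalSpace X]
    [CompactSpace X] [MeasurableSpace X] [OpensMeasurableSpace X] [NormedAddCommGroup E]
    [SecondCountableTopologyEither X E] (μ : Measure X) [IsFiniteMeasure μ] (g : C(X, E)) :
    Integrable g μ := by
  have h := g.continuous.aestronglyMeasurable (μ := μ)
  exact Integrable.of_bound h ‖g‖ (ae_of_all _ fun x => g.norm_coe_le_norm x)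

/-- A derivative along `w` at every point of the torus is a derivative along each line. -/
theorem hasDerivAt_line_of_zero {E : Type*} [NormedAddCommGroup E] [NormedSpace ℝ E]
    {w : Fin d → ℝ} {F F' : Torus d → E}
    (h : ∀ p, HasDerivAt (fun r : ℝ => F (p + proj (r • w))) (F' p) 0) (p : Torus d) (r : ℝ) :
    HasDerivAt (fun r : ℝ => F (p + proj (r • w))) (F' (p + proj (r • w))) r := by
  have h1 := h (p + proj (r • w))
  have h1' : HasDerivAt (fun u : ℝ => F (p + proj (r • w) + proj (u • w)))
      (F' (p + proj (r • w))) (r - r) := by rwa [sub_self]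
  refine (h1'.comp_sub_const r r).congr_of_eventuallyEq (Eventually.of_forall fun u => ?_)
  simp only
  rw [add_assoc, ← proj_add, ← add_smul, add_sub_cancel]

/-- The integral over the torus of a derivative along a fixed direction vanishes. -/
theorem integral_eq_zero_of_hasDerivAt_line (w : Fin d → ℝ) {F F' : Torus d → ℂ}
    (hF : Continuous F) (hF' : Continuous F')
    (h : ∀ p, HasDerivAt (fun r : ℝ => F (p + proj (r • w))) (F' p) 0) : ∫ p, F' p = 0 := by
  let G : C(Torus d, ℂ) := ⟨F, hF⟩
  let G' : C(Torus d, ℂ) := ⟨F', hF'⟩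
  have h3 := hasDerivAt_integral_of_dominated_loc_of_deriv_le (μ := (volume : Measure (Torus d)))
    (F := fun r p => F (p + proj (r • w))) (F' := fun r p => F' (p + proj (r • w)))
    (x₀ := (0 : ℝ)) (s := Set.univ) (bound := fun _ => ‖G'‖) univ_mem
    (Eventually.of_forall fun r =>
      (by fun_prop : Continuous fun p => F (p + proj (r • w))).aestronglyMeasurable)
    (by
      simp only [zero_smul, proj_zero, add_zero]
      exact G.integrable_of_compactSpace _)
    (by fun_prop : Continuous fun p => F' (p + proj ((0 : ℝ) • w))).aestronglyMeasurable
    (ae_of_all _ fun p r _ => G'.norm_coe_le_norm _) (integrable_const _)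
    (ae_of_all _ fun p r _ => hasDerivAt_line_of_zero h p r)
  have h4 := h3.2
  simp only [integral_add_right_eq_self, zero_smul, proj_zero, add_zero] at h4
  exact h4.unique (hasDerivAt_const _ _)

theorem integral_mFourier {m : Fin d → ℤ} (hm : m ≠ 0) : ∫ p : Torus d, mFourier m p = 0 := by
  obtain ⟨i, hi⟩ := Function.ne_iff.1 hm
  have h := integral_eq_zero_of_hasDerivAt_line (Pi.single i 1) (F := mFourier m)
    (F' := fun p => 2 * Real.pi * Complex.I * (pairing m (Pi.single i 1) : ℝ) * mFourier m p)
    (mFourier m).continuous (continuous_const.mul (mFourier m).continuous) (fun p => by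
      simpa [proj_zero] using hasDerivAt_mFourier_line m p (Pi.single i 1) 0)
  rw [integral_const_mul] at h
  refine (mul_eq_zero.1 h).resolve_left ?_
  have : pairing m (Pi.single i 1) = m i := by
    simp [pairing, Pi.single_apply]
  rw [this]
  have h2 : ((m i : ℝ) : ℂ) ≠ 0 := by exact_mod_cast hi
  simp [Real.pi_ne_zero, Complex.I_ne_zero]
  exact_mod_cast hi

theorem norm_integral_sub_le (μ : Measure (Torus d)) [IsFiniteMeasure μ] (g g' : C(Torus d, ℂ)) :
    ‖∫ p, g p ∂μ - ∫ p, g' p ∂μ‖ ≤ ‖g - g'‖ * μ.real Set.univ := by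
  rw [← integral_sub (g.integrable_of_compactSpace μ) (g'.integrable_of_compactSpace μ)]
  exact norm_integral_le_of_norm_le_const (ae_of_all _ fun p => (g - g').norm_coe_le_norm p)

theorem continuous_integral (μ : Measure (Torus d)) [IsFiniteMeasure μ] :
    Continuous fun g : C(Torus d, ℂ) => ∫ p, g p ∂μ := by
  have : LipschitzWith (μ.real Set.univ).toNNReal fun g : C(Torus d, ℂ) => ∫ p, g p ∂μ := by
    refine LipschitzWith.of_dist_le_mul fun g g' => ?_
    rw [dist_eq_norm, dist_eq_norm, Real.coe_toNNReal _ measureReal_nonneg, mul_comm]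
    exact norm_integral_sub_le μ g g'
  exact this.continuous

/-- A closed subspace of the continuous functions that contains all characters is everything. -/
theorem eq_top_of_mFourier_mem {S : Submodule ℂ C(Torus d, ℂ)}
    (hS : IsClosed (S : Set C(Torus d, ℂ))) (h : ∀ m, mFourier m ∈ S) : S = ⊤ := by
  rw [← top_le_iff, ← UnitAddTorus.span_mFourier_closure_eq_top]
  refine Submodule.topologicalClosure_minimal _ (Submodule.span_le.2 ?_) hS
  rintro _ ⟨m, rfl⟩
  exact h m

/-- A finite measure on the torus is determined by its Fourier coefficients. -/
theorem measure_eq_of_integral_mFourier_eq {μ ν : Measure (Torus d)} [IsFiniteMeasure μ]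
    [IsFiniteMeasure ν] (h : ∀ m, ∫ p, mFourier m p ∂μ = ∫ p, mFourier m p ∂ν) : μ = ν := by
  let S : Submodule ℂ C(Torus d, ℂ) :=
    { carrier := {g | ∫ p, g p ∂μ = ∫ p, g p ∂ν}
      add_mem' := by
        intro g g' hg hg'
        simp only [Set.mem_ofPred_eq, ContinuousMap.add_apply] at *
        rw [integral_add (g.integrable_of_compactSpace μ) (g'.integrable_of_compactSpace μ),
          integral_add (g.integrable_of_compactSpace ν) (g'.integrable_of_compactSpace ν), hg, hg']
      zero_mem' := by simp
      smul_mem' := by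
        intro c g hg
        simp only [Set.mem_ofPred_eq, ContinuousMap.smul_apply] at *
        rw [integral_smul, integral_smul, hg] }
  have hS : S = ⊤ := eq_top_of_mFourier_mem
    (isClosed_eq (continuous_integral μ) (continuous_integral ν)) h
  refine ext_of_forall_integral_eq_of_IsFiniteMeasure fun g => ?_
  have hg : (⟨fun p => (g p : ℂ), Complex.continuous_ofReal.comp g.continuous⟩ :
      C(Torus d, ℂ)) ∈ S :=
    hS ▸ Submodule.mem_top
  have hg' : ∫ p, (g p : ℂ) ∂μ = ∫ p, (g p : ℂ) ∂ν := hg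
  rw [integral_complex_ofReal, integral_complex_ofReal] at hg'
  exact_mod_cast hg'

end Torus

/-! ### Invariant measures of the reparametrized flow -/

namespace Torus

open UnitAddTorus (mFourier)

variable {d : ℕ} {v : Fin d → ℝ} {f : C(Torus d, ℝ)}

theorem invMeasure_inv (f : C(Torus d, ℝ)) : invMeasure (fun p => (f p)⁻¹) =
    (∫⁻ x : Torus d, ENNReal.ofReal (f x))⁻¹ •
      (volume : Measure (Torus d)).withDensity (fun x => ENNReal.ofReal (f x)) := by
  simp only [invMeasure, inv_inv]

theorem measurable_ofReal (f : C(Torus d, ℝ)) : Measurable fun x => ENNReal.ofReal (f x) :=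
  f.continuous.measurable.ennreal_ofReal

theorem lintegral_ofReal_eq (hf : ∀ p, 0 < f p) :
    ∫⁻ x : Torus d, ENNReal.ofReal (f x) = ENNReal.ofReal (∫ x, f x) :=
  (ofReal_integral_eq_lintegral_ofReal (f.integrable_of_compactSpace _)
    (ae_of_all _ fun p => (hf p).le)).symm

theorem integral_pos (hf : ∀ p, 0 < f p) : 0 < ∫ x : Torus d, f x := by
  obtain ⟨c, hc, hfc⟩ := exists_pos_forall_le hf
  have := integral_mono (μ := (volume : Measure (Torus d))) (integrable_const c)
    (f.integrable_of_compactSpace _) hfc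
  simp only [integral_const, probReal_univ, one_smul] at this
  linarith

theorem isProbabilityMeasure_invMeasure (hf : ∀ p, 0 < f p) :
    IsProbabilityMeasure (invMeasure (fun p => (f p)⁻¹)) := by
  constructor
  rw [invMeasure_inv, Measure.smul_apply, withDensity_apply _ MeasurableSet.univ,
    Measure.restrict_univ, smul_eq_mul, lintegral_ofReal_eq hf]
  refine ENNReal.inv_mul_cancel ?_ ENNReal.ofReal_ne_top
  simpa using integral_pos hf

theorem integral_invMeasure (hf : ∀ p, 0 < f p) (g : Torus d → ℂ) :
    ∫ p, g p ∂(invMeasure (fun p => (f p)⁻¹)) = (∫ x, f x : ℝ)⁻¹ * ∫ p, (f p : ℂ) * g p := by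
  rw [invMeasure_inv, integral_smul_measure, lintegral_ofReal_eq hf,
    integral_withDensity_eq_integral_toReal_smul (measurable_ofReal f)
      (ae_of_all _ fun p => ENNReal.ofReal_lt_top), ENNReal.toReal_inv,
      ENNReal.toReal_ofReal (integral_pos hf).le]
  simp only [ENNReal.toReal_ofReal (hf _).le, Complex.real_smul]

theorem continuous_ofReal_inv (hf : ∀ p, 0 < f p) : Continuous fun p => ((f p)⁻¹ : ℂ) :=
  Continuous.inv₀ (Complex.continuous_ofReal.comp f.continuous) fun p =>
    Complex.ofReal_ne_zero.2 (hf p).ne'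

/-- If all the functions `φ e_m`, `m ≠ 0`, have zero mean for a probability measure, then that
measure is the normalized measure of density `1 / φ`: all nonconstant Fourier coefficients of the
measure of density `φ` vanish, so the latter is a multiple of Haar measure. -/
theorem eq_invMeasure_of_integral_eq_zero (hf : ∀ p, 0 < f p) {ν : Measure (Torus d)}
    [IsProbabilityMeasure ν]
    (h : ∀ m : Fin d → ℤ, m ≠ 0 → ∫ p, ((f p)⁻¹ : ℂ) * mFourier m p ∂ν = 0) :
    ν = invMeasure (fun p => (f p)⁻¹) := by
  have hmeas : Measurable fun p => ENNReal.ofReal (f p)⁻¹ :=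
    f.continuous.measurable.inv.ennreal_ofReal
  obtain ⟨c, hc, hfc⟩ := exists_pos_forall_le hf
  set ρ := ν.withDensity fun p => ENNReal.ofReal (f p)⁻¹ with hρ
  have hfin : IsFiniteMeasure ρ := by
    refine isFiniteMeasure_withDensity ?_
    refine ne_top_of_le_ne_top (b := ENNReal.ofReal c⁻¹) ENNReal.ofReal_ne_top ?_
    calc ∫⁻ p, ENNReal.ofReal (f p)⁻¹ ∂ν ≤ ∫⁻ p, ENNReal.ofReal c⁻¹ ∂ν := by
          refine lintegral_mono fun p => ENNReal.ofReal_le_ofReal ?_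
          exact inv_anti₀ hc (hfc p)
      _ = _ := by simp
  have hint : ∀ m : Fin d → ℤ, m ≠ 0 → ∫ p, mFourier m p ∂ρ = 0 := by
    intro m hm
    rw [hρ, integral_withDensity_eq_integral_toReal_smul hmeas
      (ae_of_all _ fun p => ENNReal.ofReal_lt_top), ← h m hm]
    simp only [ENNReal.toReal_ofReal (inv_pos.2 (hf _)).le, Complex.real_smul]
    push_cast
    rfl
  have hρ' : ρ = ρ Set.univ • (volume : Measure (Torus d)) := by
    have : IsFiniteMeasure (ρ Set.univ • (volume : Measure (Torus d))) :=
      Measure.smul_finite _ (measure_ne_top _ _)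
    apply measure_eq_of_integral_mFourier_eq
    intro m
    by_cases hm : m = 0
    · subst hm
      simp [UnitAddTorus.mFourier_zero, Measure.real]
    · rw [hint m hm, integral_smul_measure, integral_mFourier hm, smul_zero]
  have hν : ν = ρ Set.univ • (volume : Measure (Torus d)).withDensity
      fun p => ENNReal.ofReal (f p) := by
    rw [← withDensity_smul_measure, ← hρ', hρ]
    have := withDensity_inv_same (μ := ν) hmeas
      (ae_of_all _ fun p => by simpa using hf p) (ae_of_all _ fun p => ENNReal.ofReal_ne_top)
    nth_rw 1 [← this]
    congr 1
    ext p
    rw [ENNReal.ofReal_inv_of_pos (hf p), inv_inv]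
  have h1 : ν Set.univ = 1 := measure_univ
  generalize ρ Set.univ = a at hν
  rw [hν, Measure.smul_apply, withDensity_apply _ MeasurableSet.univ, Measure.restrict_univ,
    smul_eq_mul] at h1
  rw [invMeasure_inv, ← ENNReal.eq_inv_of_mul_eq_one_left h1]
  exact hν

/-- The characters are differentiable along the trajectories of the flow. -/
theorem hasDerivAt_mFourier_reparamFlow (hf : ∀ p, 0 < f p) (m : Fin d → ℤ) (p : Torus d)
    (t : ℝ) : HasDerivAt (fun t => mFourier m (reparamFlow v hf t p))
      (2 * Real.pi * Complex.I * (pairing m v : ℝ) *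
        (((f (reparamFlow v hf t p))⁻¹ : ℂ) * mFourier m (reparamFlow v hf t p))) t := by
  have h1 := hasDerivAt_mFourier_line m p v (displacement v f t p)
  have h2 := h1.scomp t (hasDerivAt_displacement hf t p)
  refine h2.congr_deriv ?_
  rw [Complex.real_smul, ← reparamFlow_apply hf]
  push_cast
  ring

/-- The flow preserves the measure of density `f`. -/
theorem map_reparamFlow_invMeasure (hf : ∀ p, 0 < f p)
    (hv : ∀ m : Fin d → ℤ, m ≠ 0 → pairing m v ≠ 0) (t : ℝ) :
    (invMeasure (fun p => (f p)⁻¹)).map (reparamFlow v hf t) = invMeasure (fun p => (f p)⁻¹) := by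
  have := isProbabilityMeasure_invMeasure hf
  have hc : Continuous (reparamFlow v hf t) := (reparamFlow v hf).continuous_toFun t
  have hm := hc.measurable
  have := Measure.isProbabilityMeasure_map (μ := invMeasure (fun p => (f p)⁻¹)) hm.aemeasurable
  refine eq_invMeasure_of_integral_eq_zero hf fun m hm0 => ?_
  have hfc := continuous_ofReal_inv hf
  have hg : Continuous fun p => ((f p)⁻¹ : ℂ) * mFourier m p := hfc.mul (mFourier m).continuous
  rw [integral_map hm.aemeasurable hg.aestronglyMeasurable, integral_invMeasure hf]
  have hz : (2 * Real.pi * Complex.I * (pairing m v : ℝ) : ℂ) ≠ 0 := by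
    have := hv m hm0
    simp [Real.pi_ne_zero, Complex.I_ne_zero, this]
  have key : ∫ p, (2 * Real.pi * Complex.I * (pairing m v : ℝ) : ℂ) * ((f p : ℂ) *
      (((f (reparamFlow v hf t p))⁻¹ : ℂ) * mFourier m (reparamFlow v hf t p))) = 0 := by
    refine integral_eq_zero_of_hasDerivAt_line v (F := fun p => mFourier m (reparamFlow v hf t p))
      ((mFourier m).continuous.comp hc) ?_ fun p => ?_
    · exact continuous_const.mul ((Complex.continuous_ofReal.comp f.continuous).mul (hg.comp hc))
    · simp only [reparamFlow_along]
      have h1 := hasDerivAt_mFourier_reparamFlow (v := v) hf m p (t + travelTime v f p 0)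
      have h2 := (hasDerivAt_travelTime v f p 0).const_add t
      have h3 := h1.scomp 0 h2
      rw [travelTime_zero, add_zero, zero_smul, proj_zero, add_zero] at h3
      refine h3.congr_deriv ?_
      rw [Complex.real_smul]
      ring
  rw [integral_const_mul] at key
  rw [(mul_eq_zero.1 key).resolve_left hz, mul_zero]

theorem flowInvariant_invMeasure (hf : ∀ p, 0 < f p)
    (hv : ∀ m : Fin d → ℤ, m ≠ 0 → pairing m v ≠ 0) :
    FlowInvariant (reparamFlow v hf) (invMeasure (fun p => (f p)⁻¹)) := fun t =>
  ⟨((reparamFlow v hf).continuous_toFun t).measurable, map_reparamFlow_invMeasure hf hv t⟩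

/-- Unique ergodicity: for an invariant measure, the derivative at `t = 0` of the constant function
`t ↦ ∫ e_m ∘ Φ_t` is a nonzero multiple of the mean of `φ e_m`. -/
theorem isUniqueInvariantMeasure_invMeasure (hf : ∀ p, 0 < f p)
    (hv : ∀ m : Fin d → ℤ, m ≠ 0 → pairing m v ≠ 0) :
    IsUniqueInvariantMeasure (reparamFlow v hf) (invMeasure (fun p => (f p)⁻¹)) := by
  refine ⟨isProbabilityMeasure_invMeasure hf, flowInvariant_invMeasure hf hv, ?_⟩
  intro ν hν hinv
  refine eq_invMeasure_of_integral_eq_zero hf fun m hm0 => ?_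
  have hfc := continuous_ofReal_inv hf
  let G : C(Torus d, ℂ) := ⟨fun p => 2 * Real.pi * Complex.I * (pairing m v : ℝ) *
    (((f p)⁻¹ : ℂ) * mFourier m p), continuous_const.mul (hfc.mul (mFourier m).continuous)⟩
  have hc : ∀ t, Continuous (reparamFlow v hf t) := fun t => (reparamFlow v hf).continuous_toFun t
  have h3 := hasDerivAt_integral_of_dominated_loc_of_deriv_le (μ := ν)
    (F := fun t p => mFourier m (reparamFlow v hf t p))
    (F' := fun t p => G (reparamFlow v hf t p))
    (x₀ := (0 : ℝ)) (s := Set.univ) (bound := fun _ => ‖G‖) univ_mem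
    (Eventually.of_forall fun t => ((mFourier m).continuous.comp (hc t)).aestronglyMeasurable)
    (((mFourier m).comp ⟨_, hc 0⟩).integrable_of_compactSpace _)
    (G.continuous.comp (hc 0)).aestronglyMeasurable
    (ae_of_all _ fun p r _ => G.norm_coe_le_norm _) (integrable_const _)
    (ae_of_all _ fun p r _ => hasDerivAt_mFourier_reparamFlow hf m p r)
  have h4 := h3.2
  have h5 : ∀ t, ∫ p, mFourier m (reparamFlow v hf t p) ∂ν = ∫ p, mFourier m p ∂ν := by
    intro t
    have := integral_map (μ := ν) (hc t).measurable.aemeasurable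
      (f := mFourier m) (mFourier m).continuous.aestronglyMeasurable
    rw [← this, (hinv t).map_eq]
  simp only [h5] at h4
  have h6 := h4.unique (hasDerivAt_const _ _)
  have h7 : ∫ p, G p ∂ν = 0 := by
    rw [← h6]
    simp [Flow.map_zero_apply]
  have hz : (2 * Real.pi * Complex.I * (pairing m v : ℝ) : ℂ) ≠ 0 := by
    have := hv m hm0
    simp [Real.pi_ne_zero, Complex.I_ne_zero, this]
  simp only [G, ContinuousMap.coe_mk] at h7
  rw [integral_const_mul] at h7
  exact (mul_eq_zero.1 h7).resolve_left hz

end Torus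

/-! ### A mixing criterion -/

/-- The vectors on which a bounded family of linear forms tends to zero form a closed subspace. -/
theorem exists_isClosed_submodule_tendsto_zero {E : Type*} [SeminormedAddCommGroup E]
    [NormedSpace ℂ E] (D : ℝ → E →ₗ[ℂ] ℂ) (K : ℝ) (hD : ∀ t g, ‖D t g‖ ≤ K * ‖g‖) :
    ∃ S : Submodule ℂ E, IsClosed (S : Set E) ∧
      ∀ g, g ∈ S ↔ Tendsto (fun t => D t g) atTop (𝓝 0) := by
  let S : Submodule ℂ E :=
    { carrier := {g | Tendsto (fun t => D t g) atTop (𝓝 0)}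
      add_mem' := by
        intro a b ha hb
        simpa using Tendsto.add ha hb
      zero_mem' := by simp
      smul_mem' := by
        intro c a ha
        simpa using Tendsto.const_mul c ha }
  refine ⟨S, ?_, fun g => Iff.rfl⟩
  rw [← isSeqClosed_iff_isClosed]
  intro u g hu hg
  change Tendsto (fun t => D t g) atTop (𝓝 0)
  rw [Metric.tendsto_nhds]
  intro ε hε
  have h1 : Tendsto (fun n => K * ‖g - u n‖) atTop (𝓝 0) := by
    have h2 : Tendsto (fun n => ‖g - u n‖) atTop (𝓝 0) := by
      simpa using ((tendsto_const_nhds (x := g)).sub hg).norm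
    simpa using h2.const_mul K
  obtain ⟨n, hn⟩ := (h1.eventually_lt_const (half_pos hε)).exists
  have h3 : Tendsto (fun t => D t (u n)) atTop (𝓝 0) := hu n
  filter_upwards [(Metric.tendsto_nhds.1 h3) (ε / 2) (half_pos hε)] with t ht
  rw [dist_zero_right] at ht ⊢
  have e : D t g = D t (g - u n) + D t (u n) := by rw [map_sub]; ring
  rw [e]
  have := norm_add_le (D t (g - u n)) (D t (u n))
  have := hD t (g - u n)
  linarith

namespace Torus

open UnitAddTorus (mFourier)

variable {d : ℕ} {v : Fin d → ℝ} {f : C(Torus d, ℝ)}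

theorem eq_top_of_mul_mFourier_mem (hf : ∀ p, 0 < f p) {S : Submodule ℂ C(Torus d, ℂ)}
    (hS : IsClosed (S : Set C(Torus d, ℂ)))
    (h : ∀ m, (⟨_, continuous_ofReal_inv hf⟩ : C(Torus d, ℂ)) * mFourier m ∈ S) : S = ⊤ := by
  set φ : C(Torus d, ℂ) := ⟨_, continuous_ofReal_inv hf⟩
  have h1 : S.comap (LinearMap.mulLeft ℂ φ) = ⊤ := by
    refine eq_top_of_mFourier_mem ?_ h
    exact hS.preimage (continuous_const.mul continuous_id)
  rw [eq_top_iff]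
  intro g _
  have h2 : (⟨fun p => (f p : ℂ), Complex.continuous_ofReal.comp f.continuous⟩ : C(Torus d, ℂ)) * g
      ∈ S.comap (LinearMap.mulLeft ℂ φ) := by
    rw [h1]
    trivial
  have h3 : φ * ((⟨fun p => (f p : ℂ), Complex.continuous_ofReal.comp f.continuous⟩ :
      C(Torus d, ℂ)) * g) = g := by
    ext p
    have : (f p : ℂ) ≠ 0 := Complex.ofReal_ne_zero.2 (hf p).ne'
    simp [φ, this]
  rw [← h3]
  exact h2

/-- The functions `φ e_m`, `m ≠ 0`, span with the constants a dense subspace. The missing function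
`φ` is recovered from `1 - φ * (f - ∫ f) = (∫ f) * φ`, where `φ = 1 / f`. -/
theorem eq_top_of_one_mem_of_mul_mFourier_mem (hf : ∀ p, 0 < f p)
    {S : Submodule ℂ C(Torus d, ℂ)} (hS : IsClosed (S : Set C(Torus d, ℂ))) (h1 : 1 ∈ S)
    (h : ∀ m, m ≠ 0 → (⟨_, continuous_ofReal_inv hf⟩ : C(Torus d, ℂ)) * mFourier m ∈ S) :
    S = ⊤ := by
  refine eq_top_of_mul_mFourier_mem hf hS fun m => ?_
  by_cases hm : m = 0
  swap
  · exact h m hm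
  subst hm
  rw [UnitAddTorus.mFourier_zero, mul_one]
  set φ : C(Torus d, ℂ) := ⟨_, continuous_ofReal_inv hf⟩
  -- The functions `g` with `φ * (g - ∫ g) ∈ S` form a closed subspace containing all characters.
  let Q : C(Torus d, ℂ) →ₗ[ℂ] C(Torus d, ℂ) :=
    { toFun := fun g => φ * (g - (∫ p, g p) • (1 : C(Torus d, ℂ)))
      map_add' := by
        intro g g'
        have : ∫ p, (g p + g' p) = (∫ p, g p) + ∫ p, g' p :=
          integral_add (g.integrable_of_compactSpace volume)
            (g'.integrable_of_compactSpace volume)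
        ext q
        simp only [ContinuousMap.mul_apply, ContinuousMap.sub_apply, ContinuousMap.add_apply,
          ContinuousMap.smul_apply, smul_eq_mul, ContinuousMap.one_apply, this]
        ring
      map_smul' := by
        intro c g
        have : ∫ p, (c • g) p = c * ∫ p, g p := integral_const_mul _ _
        rw [this, RingHom.id_apply, mul_smul, ← smul_sub, mul_smul_comm] }
  have hQ : Continuous Q := by
    change Continuous fun g : C(Torus d, ℂ) => φ * (g - (∫ p, g p) • (1 : C(Torus d, ℂ)))
    exact continuous_const.mul
      (continuous_id.sub ((continuous_integral volume).smul continuous_const))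
  have hT : S.comap Q = ⊤ := by
    refine eq_top_of_mFourier_mem (hS.preimage hQ) fun m => ?_
    change φ * (mFourier m - (∫ p, mFourier m p) • (1 : C(Torus d, ℂ))) ∈ S
    by_cases hm : m = 0
    · subst hm
      have : ∫ p : Torus d, mFourier 0 p = 1 := by simp [UnitAddTorus.mFourier_zero]
      rw [this, UnitAddTorus.mFourier_zero, one_smul, sub_self, mul_zero]
      exact S.zero_mem
    · have e : (0 : ℂ) • (1 : C(Torus d, ℂ)) = 0 := by
        ext
        simp
      rw [integral_mFourier hm, e, sub_zero]
      exact h m hm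
  let F : C(Torus d, ℂ) := ⟨fun p => (f p : ℂ), Complex.continuous_ofReal.comp f.continuous⟩
  have h2 : F ∈ S.comap Q := by
    rw [hT]
    trivial
  have h3 : φ * (F - (∫ p, F p) • (1 : C(Torus d, ℂ))) ∈ S := h2
  have h4 : φ * F = 1 := by
    ext p
    have : (f p : ℂ) ≠ 0 := Complex.ofReal_ne_zero.2 (hf p).ne'
    simp [φ, F, this]
  rw [mul_sub, h4, mul_smul_comm, mul_one] at h3
  have h5 : (∫ p, F p) • φ ∈ S := by
    have := S.sub_mem h1 h3
    rwa [sub_sub_cancel] at this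
  have h6 : ∫ p, F p ≠ 0 := by
    have : ∫ p, F p = ((∫ p, f p : ℝ) : ℂ) := integral_complex_ofReal
    rw [this]
    exact Complex.ofReal_ne_zero.2 (integral_pos hf).ne'
  exact (Submodule.smul_mem_iff S h6).1 h5

/-- Correlations of continuous functions for the time-`t` map, minus the product of the means. -/
noncomputable def correlation (Φ : Flow ℝ (Torus d)) (ν : Measure (Torus d)) [IsFiniteMeasure ν]
    (t : ℝ) : C(Torus d, ℂ) →ₗ[ℂ] C(Torus d, ℂ) →ₗ[ℂ] ℂ :=
  LinearMap.mk₂ ℂ (fun g h => ∫ p, g (Φ t p) * h p ∂ν - (∫ p, g p ∂ν) * ∫ p, h p ∂ν)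
    (fun g g' h => by
      have e1 := integral_add (μ := ν)
        ((g.comp ⟨Φ t, Φ.continuous_toFun t⟩ * h).integrable_of_compactSpace ν)
        ((g'.comp ⟨Φ t, Φ.continuous_toFun t⟩ * h).integrable_of_compactSpace ν)
      have e2 := integral_add (g.integrable_of_compactSpace ν) (g'.integrable_of_compactSpace ν)
      simp only [ContinuousMap.mul_apply, ContinuousMap.comp_apply, ContinuousMap.coe_mk,
        ContinuousMap.add_apply, add_mul] at *
      rw [e1, e2]
      ring)
    (fun c g h => by
      simp only [ContinuousMap.smul_apply, smul_eq_mul, mul_assoc, integral_const_mul]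
      ring)
    (fun g h h' => by
      have e1 := integral_add (μ := ν)
        ((g.comp ⟨Φ t, Φ.continuous_toFun t⟩ * h).integrable_of_compactSpace ν)
        ((g.comp ⟨Φ t, Φ.continuous_toFun t⟩ * h').integrable_of_compactSpace ν)
      have e2 := integral_add (h.integrable_of_compactSpace ν) (h'.integrable_of_compactSpace ν)
      simp only [ContinuousMap.mul_apply, ContinuousMap.comp_apply, ContinuousMap.coe_mk,
        ContinuousMap.add_apply, mul_add] at *
      rw [e1, e2]
      ring)
    (fun c g h => by
      simp only [ContinuousMap.smul_apply, smul_eq_mul, mul_left_comm _ c, integral_const_mul]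
      ring)

theorem correlation_apply (Φ : Flow ℝ (Torus d)) (ν : Measure (Torus d)) [IsFiniteMeasure ν]
    (t : ℝ) (g h : C(Torus d, ℂ)) : correlation Φ ν t g h =
      ∫ p, g (Φ t p) * h p ∂ν - (∫ p, g p ∂ν) * ∫ p, h p ∂ν := rfl

theorem norm_correlation_le (Φ : Flow ℝ (Torus d)) (ν : Measure (Torus d))
    [IsProbabilityMeasure ν] (t : ℝ) (g h : C(Torus d, ℂ)) :
    ‖correlation Φ ν t g h‖ ≤ 2 * ‖g‖ * ‖h‖ := by
  have e1 : ‖∫ p, g (Φ t p) * h p ∂ν‖ ≤ ‖g‖ * ‖h‖ := by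
    refine (norm_integral_le_of_norm_le_const (C := ‖g‖ * ‖h‖) (ae_of_all _ fun p => ?_)).trans ?_
    · rw [norm_mul]
      exact mul_le_mul (g.norm_coe_le_norm _) (h.norm_coe_le_norm _) (norm_nonneg _) (norm_nonneg _)
    · simp
  have e2 : ∀ g : C(Torus d, ℂ), ‖∫ p, g p ∂ν‖ ≤ ‖g‖ := fun g =>
    (norm_integral_le_of_norm_le_const (ae_of_all _ fun p => g.norm_coe_le_norm p)).trans (by simp)
  have e3 : ‖(∫ p, g p ∂ν) * ∫ p, h p ∂ν‖ ≤ ‖g‖ * ‖h‖ := by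
    rw [norm_mul]
    exact mul_le_mul (e2 g) (e2 h) (norm_nonneg _) (norm_nonneg _)
  rw [correlation_apply]
  refine (norm_sub_le _ _).trans ?_
  linarith

/-- Mixing follows from the decay of correlations of continuous functions, by approximation of
indicator functions in `L¹`. -/
theorem isMixingFlow_of_correlation_tendsto {Φ : Flow ℝ (Torus d)} {ν : Measure (Torus d)}
    [IsProbabilityMeasure ν] (hinv : FlowInvariant Φ ν)
    (h : ∀ g h : C(Torus d, ℂ), Tendsto (fun t => correlation Φ ν t g h) atTop (𝓝 0)) :
    IsMixingFlow Φ ν := by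
  classical
  refine ⟨hinv, fun A B hA hB => ?_⟩
  set a : Torus d → ℂ := A.indicator fun _ => 1 with ha
  set b : Torus d → ℂ := B.indicator fun _ => 1 with hb
  have hai : Integrable a ν := (integrable_const 1).indicator hA
  have hbi : Integrable b ν := (integrable_const 1).indicator hB
  have hb1 : ∀ p, ‖b p‖ ≤ 1 := fun p => by
    rw [hb, Set.indicator_apply]
    split_ifs <;> simp
  have ha1 : ∀ p, ‖a p‖ ≤ 1 := fun p => by
    rw [ha, Set.indicator_apply]
    split_ifs <;> simp
  have hΦm : ∀ t, Measurable (Φ t) := fun t => (Φ.continuous_toFun t).measurable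
  have hset : ∀ t, Φ t '' A ∩ B = Φ t '' (A ∩ Φ t ⁻¹' B) := fun t =>
    (Set.image_inter_preimage _ _ _).symm
  have hmeas : ∀ t, ((ν (Φ t '' A ∩ B)).toReal : ℂ) = ∫ p, b (Φ t p) * a p ∂ν := by
    intro t
    have e1 : ν (Φ t '' A ∩ B) = ν (A ∩ Φ t ⁻¹' B) := by
      have hm : MeasurableSet (Φ t '' A ∩ B) := by
        rw [Flow.image_eq_preimage_symm]
        exact (hΦm _ hA).inter hB
      rw [← (hinv t).measure_preimage hm.nullMeasurableSet, hset,
        Set.preimage_image_eq (f := Φ t) _ (Φ.toHomeomorph t).injective]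
    have e2 : (fun p => b (Φ t p) * a p) = (A ∩ Φ t ⁻¹' B).indicator fun _ => (1 : ℂ) := by
      ext p
      simp only [ha, hb, Set.indicator_apply, Set.mem_inter_iff, Set.mem_preimage]
      by_cases h1 : p ∈ A <;> by_cases h2 : Φ t p ∈ B <;> simp [h1, h2]
    rw [e1, e2, integral_indicator_const _ (hA.inter (hΦm t hB))]
    simp [Measure.real]
  have hlimA : ∫ p, a p ∂ν = ((ν A).toReal : ℂ) := by
    rw [ha, integral_indicator_const _ hA]
    simp [Measure.real]
  have hlimB : ∫ p, b p ∂ν = ((ν B).toReal : ℂ) := by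
    rw [hb, integral_indicator_const _ hB]
    simp [Measure.real]
  have key : Tendsto (fun t => ∫ p, b (Φ t p) * a p ∂ν) atTop
      (𝓝 ((∫ p, b p ∂ν) * ∫ p, a p ∂ν)) := by
    rw [Metric.tendsto_nhds]
    intro ε hε
    obtain ⟨g, hg, hgi⟩ := hbi.exists_boundedContinuous_integral_sub_le (ε := ε / 5) (by positivity)
    have hδ : 0 < ε / 5 / (‖g‖ + 1) := by positivity
    obtain ⟨k, hk, hki⟩ := hai.exists_boundedContinuous_integral_sub_le hδ
    have h0 := h g.toContinuousMap k.toContinuousMap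
    have hgk : ‖g‖ * (ε / 5 / (‖g‖ + 1)) ≤ ε / 5 := by
      rw [mul_div_assoc', div_le_iff₀ (by positivity)]
      nlinarith [norm_nonneg g]
    filter_upwards [(Metric.tendsto_nhds.1 h0) (ε / 5) (by positivity)] with t ht
    rw [dist_zero_right, correlation_apply] at ht
    change ‖∫ p, g (Φ t p) * k p ∂ν - (∫ p, g p ∂ν) * ∫ p, k p ∂ν‖ < _ at ht
    rw [dist_eq_norm]
    have i1 : Integrable (fun p => b (Φ t p)) ν := (hinv t).integrable_comp_of_integrable hbi
    have i2 : Integrable (fun p => g (Φ t p)) ν := (hinv t).integrable_comp_of_integrable hgi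
    have j1 : Integrable (fun p => b (Φ t p) * a p) ν :=
      i1.mul_bdd (c := 1) hai.aestronglyMeasurable (ae_of_all _ ha1)
    have j2 : Integrable (fun p => g (Φ t p) * k p) ν :=
      i2.mul_bdd (c := ‖k‖) hki.aestronglyMeasurable (ae_of_all _ k.norm_coe_le_norm)
    have n1 : ‖∫ p, b (Φ t p) * a p ∂ν - ∫ p, g (Φ t p) * k p ∂ν‖ ≤ 2 * (ε / 5) := by
      rw [← integral_sub j1 j2]
      have i3 : Integrable (fun p => ‖b (Φ t p) - g (Φ t p)‖) ν := (i1.sub i2).norm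
      have i4 : Integrable (fun p => ‖g‖ * ‖a p - k p‖) ν := (hai.sub hki).norm.const_mul _
      calc ‖∫ p, (b (Φ t p) * a p - g (Φ t p) * k p) ∂ν‖
          ≤ ∫ p, ‖b (Φ t p) * a p - g (Φ t p) * k p‖ ∂ν := norm_integral_le_integral_norm _
        _ ≤ ∫ p, (‖b (Φ t p) - g (Φ t p)‖ + ‖g‖ * ‖a p - k p‖) ∂ν := by
          refine integral_mono (j1.sub j2).norm (i3.add i4) fun p => ?_
          simp only
          have e : b (Φ t p) * a p - g (Φ t p) * k p =
            (b (Φ t p) - g (Φ t p)) * a p + g (Φ t p) * (a p - k p) := by ring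
          rw [e]
          refine (norm_add_le _ _).trans (add_le_add ?_ ?_)
          · rw [norm_mul]
            exact mul_le_of_le_one_right (norm_nonneg _) (ha1 p)
          · rw [norm_mul]
            exact mul_le_mul_of_nonneg_right (g.norm_coe_le_norm _) (norm_nonneg _)
        _ = ∫ p, ‖b p - g p‖ ∂ν + ‖g‖ * ∫ p, ‖a p - k p‖ ∂ν := by
          rw [integral_add i3 i4, integral_const_mul]
          congr 1
          have := integral_map (μ := ν) (hΦm t).aemeasurable (f := fun p => ‖b p - g p‖) (by
            rw [(hinv t).map_eq]
            exact (hbi.sub hgi).norm.aestronglyMeasurable)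
          rw [← this, (hinv t).map_eq]
        _ ≤ ε / 5 + ‖g‖ * (ε / 5 / (‖g‖ + 1)) :=
          add_le_add hg (mul_le_mul_of_nonneg_left hk (norm_nonneg _))
        _ ≤ _ := by linarith
    have n2 : ‖∫ p, b p ∂ν - ∫ p, g p ∂ν‖ ≤ ε / 5 := by
      rw [← integral_sub hbi hgi]
      exact (norm_integral_le_integral_norm _).trans hg
    have n3 : ‖∫ p, a p ∂ν - ∫ p, k p ∂ν‖ ≤ ε / 5 / (‖g‖ + 1) := by
      rw [← integral_sub hai hki]
      exact (norm_integral_le_integral_norm _).trans hk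
    have n4 : ‖∫ p, g p ∂ν‖ ≤ ‖g‖ :=
      (norm_integral_le_of_norm_le_const (ae_of_all _ g.norm_coe_le_norm)).trans (by simp)
    have n5 : ‖∫ p, a p ∂ν‖ ≤ 1 :=
      (norm_integral_le_of_norm_le_const (ae_of_all _ ha1)).trans (by simp)
    have n6 : ‖(∫ p, b p ∂ν) * ∫ p, a p ∂ν - (∫ p, g p ∂ν) * ∫ p, k p ∂ν‖ ≤ 2 * (ε / 5) := by
      have e : (∫ p, b p ∂ν) * ∫ p, a p ∂ν - (∫ p, g p ∂ν) * ∫ p, k p ∂ν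
        = (∫ p, b p ∂ν - ∫ p, g p ∂ν) * ∫ p, a p ∂ν
          + (∫ p, g p ∂ν) * (∫ p, a p ∂ν - ∫ p, k p ∂ν) := by ring
      rw [e]
      refine (norm_add_le _ _).trans ?_
      rw [norm_mul, norm_mul]
      have m1 := mul_le_mul n2 n5 (norm_nonneg _) (by positivity)
      have m2 := mul_le_mul n4 n3 (norm_nonneg _) (norm_nonneg g)
      linarith
    have e : ∫ p, b (Φ t p) * a p ∂ν - (∫ p, b p ∂ν) * ∫ p, a p ∂ν
        = (∫ p, b (Φ t p) * a p ∂ν - ∫ p, g (Φ t p) * k p ∂ν)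
          + (∫ p, g (Φ t p) * k p ∂ν - (∫ p, g p ∂ν) * ∫ p, k p ∂ν)
          - ((∫ p, b p ∂ν) * ∫ p, a p ∂ν - (∫ p, g p ∂ν) * ∫ p, k p ∂ν) := by ring
    rw [e]
    refine (norm_sub_le _ _).trans_lt ?_
    have := norm_add_le (∫ p, b (Φ t p) * a p ∂ν - ∫ p, g (Φ t p) * k p ∂ν)
      (∫ p, g (Φ t p) * k p ∂ν - (∫ p, g p ∂ν) * ∫ p, k p ∂ν)
    linarith
  have hre := (Complex.continuous_re.tendsto _).comp key
  rw [← ENNReal.tendsto_toReal_iff (fun t => measure_ne_top _ _)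
    (ENNReal.mul_ne_top (measure_ne_top _ _) (measure_ne_top _ _)), ENNReal.toReal_mul]
  refine (hre.congr fun t => ?_).trans (le_of_eq ?_)
  · rw [Function.comp_apply, ← hmeas, Complex.ofReal_re]
  · rw [hlimA, hlimB, ← Complex.ofReal_mul, Complex.ofReal_re, mul_comm]

/-- Mixing of the reparametrized flow follows from the decay of correlations between the functions
`φ e_m`, `m ≠ 0`, which are derivatives along the flow, and the functions `φ e_l`. -/
theorem isMixingFlow_reparamFlow (hf : ∀ p, 0 < f p)
    (hv : ∀ m : Fin d → ℤ, m ≠ 0 → pairing m v ≠ 0)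
    (h : ∀ m l : Fin d → ℤ, m ≠ 0 → Tendsto (fun t => ∫ p, ((f (reparamFlow v hf t p))⁻¹ : ℂ) *
      mFourier m (reparamFlow v hf t p) * mFourier l p) atTop (𝓝 0)) :
    IsMixingFlow (reparamFlow v hf) (invMeasure (fun p => (f p)⁻¹)) := by
  have hprob := isProbabilityMeasure_invMeasure hf
  have hinv := flowInvariant_invMeasure (v := v) hf hv
  set ν := invMeasure (fun p => (f p)⁻¹) with hν
  set Φ := reparamFlow v hf with hΦ
  set φ : C(Torus d, ℂ) := ⟨_, continuous_ofReal_inv hf⟩ with hφ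
  have hmean : ∀ m : Fin d → ℤ, m ≠ 0 → ∫ p, (φ * mFourier m) p ∂ν = 0 := by
    intro m hm
    rw [integral_invMeasure hf]
    have : ∀ p, (f p : ℂ) * (φ * mFourier m) p = mFourier m p := by
      intro p
      have : (f p : ℂ) ≠ 0 := Complex.ofReal_ne_zero.2 (hf p).ne'
      simp [φ, this]
    simp only [this, integral_mFourier hm, mul_zero]
  have hbase : ∀ m l : Fin d → ℤ, m ≠ 0 →
      Tendsto (fun t => correlation Φ ν t (φ * mFourier m) (φ * mFourier l)) atTop (𝓝 0) := by
    intro m l hm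
    have h1 := (h m l hm).const_mul (((∫ x, f x : ℝ)⁻¹ : ℝ) : ℂ)
    rw [mul_zero] at h1
    refine h1.congr fun t => ?_
    rw [correlation_apply, hmean m hm, zero_mul, sub_zero, integral_invMeasure hf]
    push_cast
    congr 2
    ext p
    have : (f p : ℂ) ≠ 0 := Complex.ofReal_ne_zero.2 (hf p).ne'
    change (f (Φ t p) : ℂ)⁻¹ * mFourier m (Φ t p) * mFourier l p =
      f p * (((f (Φ t p) : ℂ)⁻¹ * mFourier m (Φ t p)) * ((f p : ℂ)⁻¹ * mFourier l p))
    field_simp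
  have hleft : ∀ (l : Fin d → ℤ) (g : C(Torus d, ℂ)),
      Tendsto (fun t => correlation Φ ν t g (φ * mFourier l)) atTop (𝓝 0) := by
    intro l g
    obtain ⟨S, hS, hmem⟩ := exists_isClosed_submodule_tendsto_zero
      (fun t => (correlation Φ ν t).flip (φ * mFourier l)) (2 * ‖φ * mFourier l‖) (fun t g => by
        refine (norm_correlation_le Φ ν t g _).trans (le_of_eq ?_)
        ring)
    have hT : S = ⊤ := by
      refine eq_top_of_one_mem_of_mul_mFourier_mem hf hS ?_ fun m hm => ?_
      · rw [hmem]
        refine tendsto_const_nhds.congr fun t => ?_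
        rw [LinearMap.flip_apply, correlation_apply]
        simp
      · rw [hmem]
        exact hbase m l hm
    have : g ∈ S := by
      rw [hT]
      trivial
    exact (hmem g).1 this
  refine isMixingFlow_of_correlation_tendsto hinv fun g k => ?_
  obtain ⟨S, hS, hmem⟩ := exists_isClosed_submodule_tendsto_zero
    (fun t => correlation Φ ν t g) (2 * ‖g‖) (fun t k => norm_correlation_le Φ ν t g k)
  have hT : S = ⊤ := by
    refine eq_top_of_mul_mFourier_mem hf hS fun l => ?_
    rw [hmem]
    exact hleft l g
  have : k ∈ S := by
    rw [hT]
    trivial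
  exact (hmem k).1 this

end Torus

/-! ### A Liouville vector with alternating resonances -/

/-- A sequence of integers, each dividing the next, which grows super-exponentially and dominates
a given sequence of constants, also with the index shifted by one. -/
structure IsFrequencySeq (M : ℕ → ℝ) (Q : ℕ → ℕ) : Prop where
  dvd : ∀ i, Q i ∣ Q (i + 1)
  /-- The exponent `5` exceeds the `4` in the time scales `exp ((Q i) ^ 4)` of the mixing
  estimates. -/
  exp_le : ∀ i, Real.exp ((Q i : ℝ) ^ 5) ≤ Q (i + 1)
  const_le : ∀ i, M i ≤ Q i
  const_succ_le : ∀ i, M (i + 1) ≤ Q i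
  large : 1000 ≤ Q 0

theorem exists_isFrequencySeq (M : ℕ → ℝ) : ∃ Q, IsFrequencySeq M Q := by
  let Q : ℕ → ℕ := fun n => Nat.rec (1000 + ⌈|M 0|⌉₊ + ⌈|M 1|⌉₊)
    (fun i q => q * (4 ^ (q ^ 5) + ⌈|M (i + 1)|⌉₊ + ⌈|M (i + 2)|⌉₊)) n
  have h0 : Q 0 = 1000 + ⌈|M 0|⌉₊ + ⌈|M 1|⌉₊ := rfl
  have hs : ∀ i, Q (i + 1) = Q i * (4 ^ (Q i ^ 5) + ⌈|M (i + 1)|⌉₊ + ⌈|M (i + 2)|⌉₊) :=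
    fun i => rfl
  have hceil : ∀ x : ℝ, x ≤ ⌈|x|⌉₊ := fun x => (le_abs_self x).trans (Nat.le_ceil _)
  have hpos : ∀ i, 1 ≤ Q i := by
    intro i
    induction i with
    | zero => rw [h0]; omega
    | succ i ih =>
      rw [hs]
      have : 1 ≤ 4 ^ (Q i ^ 5) := Nat.one_le_pow _ _ (by norm_num)
      nlinarith [Nat.zero_le ⌈|M (i + 1)|⌉₊, Nat.zero_le ⌈|M (i + 2)|⌉₊]
  have hge : ∀ i, 4 ^ (Q i ^ 5) + ⌈|M (i + 1)|⌉₊ + ⌈|M (i + 2)|⌉₊ ≤ Q (i + 1) := by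
    intro i
    rw [hs]
    exact Nat.le_mul_of_pos_left _ (hpos i)
  have hge' : ∀ i, (4 : ℝ) ^ (Q i ^ 5) + ⌈|M (i + 1)|⌉₊ + ⌈|M (i + 2)|⌉₊ ≤ Q (i + 1) :=
    fun i => by exact_mod_cast hge i
  have h4 : ∀ i, (0 : ℝ) ≤ (4 : ℝ) ^ (Q i ^ 5) := fun i => by positivity
  have hc : ∀ x : ℝ, (0 : ℝ) ≤ ⌈|x|⌉₊ := fun x => Nat.cast_nonneg _
  refine ⟨Q, fun i => ⟨_, hs i⟩, fun i => ?_, fun i => ?_, fun i => ?_, by rw [h0]; omega⟩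
  · have hexp : ∀ q : ℕ, Real.exp ((q : ℝ) ^ 5) ≤ (4 : ℝ) ^ (q ^ 5) := by
      intro q
      rw [show ((q : ℝ) ^ 5) = ((q ^ 5 : ℕ) : ℝ) * 1 by push_cast; ring, Real.exp_nat_mul]
      exact pow_le_pow_left₀ (Real.exp_pos _).le
        (Real.exp_one_lt_d9.le.trans (by norm_num)) _
    have := hexp (Q i)
    linarith [hge' i, hc (M (i + 1)), hc (M (i + 2))]
  · cases i with
    | zero =>
      rw [h0]
      push_cast
      linarith [hceil (M 0), hc (M 1)]
    | succ i => linarith [hge' i, hceil (M (i + 1)), hc (M (i + 2)), h4 i]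
  · cases i with
    | zero =>
      rw [h0]
      push_cast
      linarith [hceil (M 1), hc (M 0)]
    | succ i => linarith [hge' i, hceil (M (i + 2)), hc (M (i + 1)), h4 i]

namespace IsFrequencySeq

variable {M : ℕ → ℝ} {Q : ℕ → ℕ} (hQ : IsFrequencySeq M Q)
include hQ

theorem pow_lt_succ (i : ℕ) : (Q i : ℝ) ^ 5 + 1 ≤ Q (i + 1) :=
  (Real.add_one_le_exp _).trans (hQ.exp_le i)

theorem lt_succ (i : ℕ) : Q i < Q (i + 1) := by
  have h := hQ.pow_lt_succ i
  rcases Nat.eq_zero_or_pos (Q i) with h0 | h0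
  · rw [h0] at h ⊢
    have : (0 : ℝ) < Q (i + 1) := by
      push_cast at h
      linarith
    exact_mod_cast this
  · have h1 : Q i ≤ Q i ^ 5 := Nat.le_self_pow (by norm_num) _
    have h2 : Q i ^ 5 + 1 ≤ Q (i + 1) := by exact_mod_cast h
    omega

theorem strictMono : StrictMono Q := strictMono_nat_of_lt_succ hQ.lt_succ

theorem le_self (i : ℕ) : 1000 ≤ Q i := hQ.large.trans (hQ.strictMono.monotone (Nat.zero_le i))

theorem le_cast (i : ℕ) : (1000 : ℝ) ≤ Q i := by exact_mod_cast hQ.le_self i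

theorem cast_pos (i : ℕ) : (0 : ℝ) < Q i := by linarith [hQ.le_cast i]

theorem two_mul_le_succ (i : ℕ) : 2 * (Q i : ℝ) ≤ Q (i + 1) := by
  have h1 := hQ.le_cast i
  have h2 := hQ.pow_lt_succ i
  have h3 : (1000 : ℝ) ^ 4 ≤ (Q i : ℝ) ^ 4 := by gcongr
  nlinarith

theorem two_pow_mul_le (n k : ℕ) : (2 : ℝ) ^ k * Q n ≤ Q (k + n) := by
  induction k with
  | zero => simp
  | succ k ih =>
    have := hQ.two_mul_le_succ (k + n)
    rw [show k + 1 + n = k + n + 1 by ring, pow_succ]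
    linarith

theorem one_div_le (n k : ℕ) : 1 / (Q (k + n) : ℝ) ≤ 1 / (Q n : ℝ) * (1 / 2) ^ k := by
  rw [one_div_pow, one_div_mul_one_div]
  have := hQ.cast_pos n
  refine one_div_le_one_div_of_le (by positivity) ?_
  rw [mul_comm]
  exact hQ.two_pow_mul_le n k

theorem dvd_of_le {i j : ℕ} (h : i ≤ j) : Q i ∣ Q j := Nat.le_induction dvd_rfl
  (fun n _ ih => ih.trans (hQ.dvd n)) j h

end IsFrequencySeq

/-- The tail, from the index `n` on, of the series of the `1 / Q i` with `i ≡ b` modulo `2`. -/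
noncomputable def parityTail (Q : ℕ → ℕ) (b n : ℕ) : ℝ :=
  ∑' k : ℕ, if (k + n) % 2 = b then 1 / (Q (k + n) : ℝ) else 0

/-- The vector `(α, α', 1)`, where `α` and `α'` are the sums of the `1 / Q i` over the even and the
odd indices `i`. -/
noncomputable def liouvilleVec (Q : ℕ → ℕ) : Fin 3 → ℝ :=
  ![parityTail Q 0 0, parityTail Q 1 0, 1]

/-- The numerator, over the denominator `Q n`, of the partial sum up to the index `n` of the series
of the `1 / Q i` with `i ≡ b` modulo `2`. -/
def parityNum (Q : ℕ → ℕ) (b n : ℕ) : ℕ :=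
  ∑ j ∈ Finset.range (n + 1), if j % 2 = b then Q n / Q j else 0

/-- The resonant frequencies: `(Q i, 0, -P i)` for even `i` and `(0, Q i, -P i)` for odd `i`,
where `P i / Q i` is a partial sum of the series of `α`, respectively `α'`. -/
def resonance (Q : ℕ → ℕ) (i : ℕ) : Fin 3 → ℤ :=
  if i % 2 = 0 then ![(Q i : ℤ), 0, -(parityNum Q 0 i : ℤ)]
  else ![0, (Q i : ℤ), -(parityNum Q 1 i : ℤ)]

namespace IsFrequencySeq

open Torus (pairing)

variable {M : ℕ → ℝ} {Q : ℕ → ℕ} (hQ : IsFrequencySeq M Q)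
include hQ

theorem summable_parity (b n : ℕ) :
    Summable fun k : ℕ => if (k + n) % 2 = b then 1 / (Q (k + n) : ℝ) else 0 := by
  refine Summable.of_nonneg_of_le (fun k => ?_) (fun k => ?_)
    ((summable_geometric_two).mul_left (1 / (Q n : ℝ)))
  · split_ifs <;> positivity
  · split_ifs
    · exact hQ.one_div_le n k
    · positivity

omit hQ in
theorem parityTail_nonneg (b n : ℕ) : 0 ≤ parityTail Q b n :=
  tsum_nonneg fun k => by split_ifs <;> positivity

theorem parityTail_le (b n : ℕ) : parityTail Q b n ≤ 2 / Q n := by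
  have h := (hQ.summable_parity b n).tsum_le_tsum (fun k => ?_)
    ((summable_geometric_two).mul_left (1 / (Q n : ℝ)))
  · rw [tsum_mul_left, tsum_geometric_two] at h
    refine h.trans (le_of_eq ?_)
    ring
  · split_ifs
    · exact hQ.one_div_le n k
    · positivity

theorem parityTail_eq (b n : ℕ) :
    parityTail Q b n = (if n % 2 = b then 1 / (Q n : ℝ) else 0) + parityTail Q b (n + 1) := by
  rw [parityTail, (hQ.summable_parity b n).tsum_eq_zero_add, zero_add, parityTail]
  simp only [add_assoc, add_comm 1 n]

theorem parityTail_anti (b : ℕ) : Antitone (parityTail Q b) := by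
  refine antitone_nat_of_succ_le fun n => ?_
  rw [hQ.parityTail_eq b n]
  refine le_add_of_nonneg_left ?_
  split_ifs <;> positivity

theorem mul_parityTail_zero (b n : ℕ) :
    (Q n : ℝ) * parityTail Q b 0 = parityNum Q b n + Q n * parityTail Q b (n + 1) := by
  have h := (hQ.summable_parity b 0).sum_add_tsum_nat_add (n + 1)
  simp only [add_zero] at h
  rw [parityTail, parityTail, parityNum]
  simp only [add_zero]
  rw [← h, mul_add, Finset.mul_sum]
  congr 1
  push_cast
  refine Finset.sum_congr rfl fun j hj => ?_
  split_ifs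
  · have h1 : Q j ∣ Q n := hQ.dvd_of_le (by simpa [Nat.lt_succ_iff] using hj)
    have h2 := (hQ.cast_pos j).ne'
    rw [Nat.cast_div h1 h2]
    ring
  · simp

omit hQ in
theorem pairing_even {i : ℕ} (hi : i % 2 = 0) (w : Fin 3 → ℝ) :
    pairing (resonance Q i) w = Q i * w 0 - parityNum Q 0 i * w 2 := by
  simp [pairing, resonance, hi, Fin.sum_univ_three]
  ring

omit hQ in
theorem pairing_odd {i : ℕ} (hi : i % 2 = 1) (w : Fin 3 → ℝ) :
    pairing (resonance Q i) w = Q i * w 1 - parityNum Q 1 i * w 2 := by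
  simp [pairing, resonance, hi, Fin.sum_univ_three]
  ring

theorem pairing_resonance (i : ℕ) :
    pairing (resonance Q i) (liouvilleVec Q) = Q i * parityTail Q (i % 2) (i + 1) := by
  rcases Nat.mod_two_eq_zero_or_one i with hi | hi
  · rw [pairing_even hi, hi]
    have := hQ.mul_parityTail_zero 0 i
    simp only [liouvilleVec, Matrix.cons_val_zero, Matrix.cons_val]
    linarith
  · rw [pairing_odd hi, hi]
    have := hQ.mul_parityTail_zero 1 i
    simp only [liouvilleVec, Matrix.cons_val_one, Matrix.cons_val]
    linarith

theorem parityTail_succ (i : ℕ) :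
    parityTail Q (i % 2) (i + 1) = 1 / Q (i + 2) + parityTail Q (i % 2) (i + 3) := by
  rw [hQ.parityTail_eq _ (i + 1), hQ.parityTail_eq _ (i + 2), if_neg (by omega), if_pos (by omega),
    zero_add]

theorem le_pairing_resonance (i : ℕ) :
    (Q i : ℝ) / Q (i + 2) ≤ pairing (resonance Q i) (liouvilleVec Q) := by
  rw [hQ.pairing_resonance, hQ.parityTail_succ, div_eq_mul_one_div]
  exact mul_le_mul_of_nonneg_left (le_add_of_nonneg_right (parityTail_nonneg _ _))
    (Nat.cast_nonneg _)

theorem pairing_resonance_pos (i : ℕ) : 0 < pairing (resonance Q i) (liouvilleVec Q) :=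
  (div_pos (hQ.cast_pos i) (hQ.cast_pos (i + 2))).trans_le (hQ.le_pairing_resonance i)

theorem pairing_resonance_le (i : ℕ) :
    pairing (resonance Q i) (liouvilleVec Q) ≤ 2 * Q i / Q (i + 2) := by
  rw [hQ.pairing_resonance, hQ.parityTail_eq _ (i + 1), if_neg (by omega), zero_add]
  have := mul_le_mul_of_nonneg_left (hQ.parityTail_le (i % 2) (i + 2)) (hQ.cast_pos i).le
  refine this.trans (le_of_eq ?_)
  ring

theorem resonance_ne_zero (i : ℕ) : resonance Q i ≠ 0 := by
  intro h
  have := hQ.pairing_resonance_pos i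
  rw [h] at this
  simp [pairing] at this

/-- The multiple `Q n • v` is close to the integer lattice. -/
theorem exists_int_near (n : ℕ) : ∃ z : Fin 3 → ℤ, ∃ w : Fin 3 → ℝ,
    (Q n : ℝ) • liouvilleVec Q = (fun i => (z i : ℝ)) + w ∧ ‖w‖ ≤ 2 * Q n / Q (n + 1) := by
  have hb : ∀ b, (Q n : ℝ) * parityTail Q b (n + 1) ≤ 2 * Q n / Q (n + 1) := by
    intro b
    have := mul_le_mul_of_nonneg_left (hQ.parityTail_le b (n + 1)) (hQ.cast_pos n).le
    refine this.trans (le_of_eq ?_)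
    ring
  have hb0 : ∀ b, 0 ≤ (Q n : ℝ) * parityTail Q b (n + 1) := fun b =>
    mul_nonneg (Nat.cast_nonneg _) (parityTail_nonneg _ _)
  refine ⟨![parityNum Q 0 n, parityNum Q 1 n, Q n], ![Q n * parityTail Q 0 (n + 1),
    Q n * parityTail Q 1 (n + 1), 0], ?_, ?_⟩
  · ext i
    fin_cases i
    · simpa [liouvilleVec] using hQ.mul_parityTail_zero 0 n
    · simpa [liouvilleVec] using hQ.mul_parityTail_zero 1 n
    · simp [liouvilleVec]
  · rw [pi_norm_le_iff_of_nonneg ((hb0 0).trans (hb 0))]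
    intro i
    fin_cases i
    · simpa [abs_of_nonneg (parityTail_nonneg _ _)] using hb 0
    · simpa [abs_of_nonneg (parityTail_nonneg _ _)] using hb 1
    · simpa using (hb0 0).trans (hb 0)

/-- The coordinates of the vector are rationally independent. -/
theorem pairing_liouvilleVec_ne_zero {m : Fin 3 → ℤ} (hm : m ≠ 0) :
    pairing m (liouvilleVec Q) ≠ 0 := by
  intro h
  have hexp : (m 0 : ℝ) * parityTail Q 0 0 + m 1 * parityTail Q 1 0 + m 2 = 0 := by
    simpa [pairing, Fin.sum_univ_three, liouvilleVec] using h
  set K : ℝ := |(m 0 : ℝ)| + |(m 1 : ℝ)| with hK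
  obtain ⟨N, hN⟩ := exists_nat_gt (2 * K)
  -- Multiplying by `Q n` splits the relation into an integer and a small part, both zero.
  have htail : ∀ n, N ≤ n →
      (m 0 : ℝ) * parityTail Q 0 (n + 1) + m 1 * parityTail Q 1 (n + 1) = 0 := by
    intro n hn
    have e0 := hQ.mul_parityTail_zero 0 n
    have e1 := hQ.mul_parityTail_zero 1 n
    have hq := hQ.cast_pos n
    have hq1 := hQ.cast_pos (n + 1)
    set t0 := parityTail Q 0 (n + 1)
    set t1 := parityTail Q 1 (n + 1)
    set z : ℤ := m 0 * parityNum Q 0 n + m 1 * parityNum Q 1 n + m 2 * Q n with hz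
    have e2 : (z : ℝ) = -(Q n * (m 0 * t0 + m 1 * t1)) := by
      rw [hz]
      push_cast
      linear_combination (Q n : ℝ) * hexp - (m 0 : ℝ) * e0 - (m 1 : ℝ) * e1
    have ht0 : |t0| ≤ 2 / Q (n + 1) := by
      rw [abs_of_nonneg (parityTail_nonneg _ _)]
      exact hQ.parityTail_le 0 (n + 1)
    have ht1 : |t1| ≤ 2 / Q (n + 1) := by
      rw [abs_of_nonneg (parityTail_nonneg _ _)]
      exact hQ.parityTail_le 1 (n + 1)
    have e3 : |(m 0 : ℝ) * t0 + m 1 * t1| ≤ K * (2 / Q (n + 1)) := by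
      refine (abs_add_le _ _).trans ?_
      rw [abs_mul, abs_mul, hK, add_mul]
      gcongr
    have e4 : |(z : ℝ)| < 1 := by
      rw [e2, abs_neg, abs_mul, abs_of_pos hq]
      have h1 : (Q n : ℝ) * |(m 0 : ℝ) * t0 + m 1 * t1| ≤ Q n * (K * (2 / Q (n + 1))) := by gcongr
      refine h1.trans_lt ?_
      rw [show (Q n : ℝ) * (K * (2 / Q (n + 1))) = (2 * K * Q n) / Q (n + 1) by ring,
        div_lt_one hq1]
      have h2 : (n : ℝ) ≤ Q n := by exact_mod_cast hQ.strictMono.le_apply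
      have h3 : (N : ℝ) ≤ n := by exact_mod_cast hn
      have h4 := hQ.pow_lt_succ n
      have h5 : (1000 : ℝ) ≤ Q n := hQ.le_cast n
      have h6 : (Q n : ℝ) ^ 2 ≤ (Q n : ℝ) ^ 5 := pow_le_pow_right₀ (by linarith) (by norm_num)
      nlinarith
    have e5 : z = 0 := by
      have : |z| < 1 := by exact_mod_cast e4
      exact Int.abs_lt_one_iff.1 this
    rw [e5, Int.cast_zero, zero_eq_neg] at e2
    exact (mul_eq_zero.1 e2).resolve_left hq.ne'
  have hstep : ∀ n, N + 1 ≤ n → (m 0 : ℝ) * (if n % 2 = 0 then 1 / (Q n : ℝ) else 0) +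
      m 1 * (if n % 2 = 1 then 1 / (Q n : ℝ) else 0) = 0 := by
    intro n hn
    have h1 := htail n (by omega)
    have h2 := htail (n - 1) (by omega)
    rw [show n - 1 + 1 = n by omega, hQ.parityTail_eq 0 n, hQ.parityTail_eq 1 n] at h2
    linear_combination h2 - h1
  have hinv : ∀ n, 1 / (Q n : ℝ) ≠ 0 := fun n => (one_div_pos.2 (hQ.cast_pos n)).ne'
  have h0 : m 0 = 0 := by
    have := hstep (2 * (N + 1)) (by omega)
    rw [if_pos (by omega), if_neg (by omega), mul_zero, add_zero] at this
    exact_mod_cast (mul_eq_zero.1 this).resolve_right (hinv _)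
  have h1 : m 1 = 0 := by
    have := hstep (2 * (N + 1) + 1) (by omega)
    rw [if_neg (by omega), if_pos (by omega), mul_zero, zero_add] at this
    exact_mod_cast (mul_eq_zero.1 this).resolve_right (hinv _)
  have h2 : m 2 = 0 := by
    rw [h0, h1] at hexp
    simpa using hexp
  apply hm
  ext i
  fin_cases i
  · exact h0
  · exact h1
  · exact h2

/-- Two different even resonances are linearly independent. -/
theorem resonance_det_ne_zero {i j : ℕ} (hi : i % 2 = 0) (hj : j % 2 = 0) (hij : i < j) :
    (Q i : ℝ) * parityNum Q 0 j - Q j * parityNum Q 0 i ≠ 0 := by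
  have ei := hQ.mul_parityTail_zero 0 i
  have ej := hQ.mul_parityTail_zero 0 j
  have e : (Q i : ℝ) * parityNum Q 0 j - Q j * parityNum Q 0 i =
      Q i * Q j * (parityTail Q 0 (i + 1) - parityTail Q 0 (j + 1)) := by
    linear_combination (Q j : ℝ) * ei - (Q i : ℝ) * ej
  have h1 := hQ.parityTail_succ i
  rw [hi] at h1
  have h2 : parityTail Q 0 (j + 1) ≤ parityTail Q 0 (i + 3) := hQ.parityTail_anti 0 (by omega)
  have h3 := one_div_pos.2 (hQ.cast_pos (i + 2))
  have h4 := hQ.cast_pos i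
  have h5 := hQ.cast_pos j
  rw [e]
  have : 0 < parityTail Q 0 (i + 1) - parityTail Q 0 (j + 1) := by linarith
  positivity

end IsFrequencySeq

/-! ### Periodic profiles with a plateau -/

theorem Function.Periodic.deriv_periodic {g : ℝ → ℝ} {c : ℝ} (hg : Function.Periodic g c) :
    Function.Periodic (deriv g) c := fun x => by
  rw [← deriv_comp_add_const]
  congr 1
  exact funext hg

theorem Function.Periodic.iteratedDeriv_periodic {g : ℝ → ℝ} {c : ℝ} (hg : Function.Periodic g c)
    (k : ℕ) : Function.Periodic (iteratedDeriv k g) c := fun x => by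
  have h := congrFun (iteratedDeriv_comp_add_const k g c) x
  rw [← h]
  congr 1
  exact funext hg

theorem Function.Periodic.exists_abs_le {g : ℝ → ℝ} (hg : Function.Periodic g 1)
    (hc : Continuous g) : ∃ C, ∀ x, |g x| ≤ C := by
  obtain ⟨C, hC⟩ := (hg.isBounded_of_continuous one_ne_zero hc).exists_norm_le
  exact ⟨C, fun x => hC _ ⟨x, rfl⟩⟩

theorem expNegInvGlue_deriv_pos {x : ℝ} (hx : 0 < x) : 0 < deriv expNegInvGlue x := by
  have h1 : expNegInvGlue =ᶠ[𝓝 x] fun y => Real.exp (-y⁻¹) := by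
    filter_upwards [eventually_gt_nhds hx] with y hy
    rw [expNegInvGlue, if_neg (not_le.2 hy)]
  have h2 : HasDerivAt (fun y : ℝ => Real.exp (-y⁻¹)) (Real.exp (-x⁻¹) * (-(-(x ^ 2)⁻¹))) x :=
    (hasDerivAt_inv hx.ne').neg.exp
  rw [h1.deriv_eq, h2.deriv]
  have : 0 < Real.exp (-x⁻¹) := Real.exp_pos _
  simp only [neg_neg]
  positivity

theorem expNegInvGlue_deriv_neg {x : ℝ} (hx : x < 0) : deriv expNegInvGlue x = 0 := by
  have h1 : expNegInvGlue =ᶠ[𝓝 x] fun _ => 0 := by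
    filter_upwards [eventually_lt_nhds hx] with y hy
    exact expNegInvGlue.zero_of_nonpos hy.le
  rw [h1.deriv_eq, deriv_const]

/-- For `c ≥ 0`, a smooth odd function vanishing exactly on `[-c, c]`. -/
noncomputable def flatOdd (c u : ℝ) : ℝ := expNegInvGlue (u - c) - expNegInvGlue (-u - c)

theorem contDiff_flatOdd (c : ℝ) : ContDiff ℝ ∞ (flatOdd c) := by
  have h : ContDiff ℝ ∞ expNegInvGlue := expNegInvGlue.contDiff
  exact (h.comp (contDiff_id.sub contDiff_const)).sub
    (h.comp (contDiff_id.neg.sub contDiff_const))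

theorem deriv_flatOdd_ne_zero {c u : ℝ} (hc : 0 < c) (hu : c < |u|) : deriv (flatOdd c) u ≠ 0 := by
  have hd : ∀ x, HasDerivAt expNegInvGlue (deriv expNegInvGlue x) x := fun x =>
    ((expNegInvGlue.contDiff (n := ⊤)).differentiable (by simp) x).hasDerivAt
  have h1 : HasDerivAt (flatOdd c) (deriv expNegInvGlue (u - c) * 1
      - deriv expNegInvGlue (-u - c) * (-1)) u :=
    ((hd _).comp u ((hasDerivAt_id u).sub_const c)).sub
      ((hd _).comp u ((hasDerivAt_id u).neg.sub_const c))
  rw [h1.deriv]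
  rcases lt_abs.1 hu with h | h
  · have := expNegInvGlue_deriv_pos (x := u - c) (by linarith)
    rw [expNegInvGlue_deriv_neg (x := -u - c) (by linarith)]
    linarith
  · have := expNegInvGlue_deriv_pos (x := -u - c) (by linarith)
    rw [expNegInvGlue_deriv_neg (x := u - c) (by linarith)]
    linarith

/-- A smooth odd `1`-periodic function that vanishes where `|sin (2 π x)| ≤ c`. -/
noncomputable def flatSine (c x : ℝ) : ℝ := flatOdd c (Real.sin (2 * Real.pi * x))

theorem contDiff_flatSine (c : ℝ) : ContDiff ℝ ∞ (flatSine c) :=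
  (contDiff_flatOdd c).comp (Real.contDiff_sin.comp (contDiff_const.mul contDiff_id))

theorem flatSine_periodic (c : ℝ) : Function.Periodic (flatSine c) 1 := fun x => by
  rw [flatSine, mul_add, mul_one, Real.sin_add_two_pi, flatSine]

theorem flatSine_neg (c x : ℝ) : flatSine c (-x) = -flatSine c x := by
  rw [flatSine, flatSine, mul_neg, Real.sin_neg, flatOdd, flatOdd]
  simp

theorem flatSine_eq_zero {c x : ℝ} (hx : |x| ≤ c / 7) : flatSine c x = 0 := by
  have h1 : |Real.sin (2 * Real.pi * x)| ≤ c := by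
    refine (Real.abs_sin_le_abs).trans ?_
    rw [abs_mul, abs_of_pos Real.two_pi_pos]
    have := Real.pi_lt_d2
    have h0 := abs_nonneg x
    nlinarith
  rw [abs_le] at h1
  rw [flatSine, flatOdd, expNegInvGlue.zero_of_nonpos (by linarith),
    expNegInvGlue.zero_of_nonpos (by linarith), sub_zero]

theorem deriv_flatSine_ne_zero {c x : ℝ} (hc : 0 < c) (h1 : c < |Real.sin (2 * Real.pi * x)|)
    (h2 : Real.cos (2 * Real.pi * x) ≠ 0) : deriv (flatSine c) x ≠ 0 := by
  have hd := ((contDiff_flatOdd c).differentiable (by simp)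
    (Real.sin (2 * Real.pi * x))).hasDerivAt
  have hs : HasDerivAt (fun x => Real.sin (2 * Real.pi * x))
      (Real.cos (2 * Real.pi * x) * (2 * Real.pi * 1)) x :=
    ((hasDerivAt_id x).const_mul _).sin
  have h := hd.comp x hs
  have e : flatSine c = flatOdd c ∘ fun x => Real.sin (2 * Real.pi * x) := rfl
  rw [e, h.deriv]
  have := deriv_flatOdd_ne_zero hc h1
  have := Real.pi_ne_zero
  positivity

theorem integral_flatSine (c : ℝ) : ∫ x in (0 : ℝ)..1, flatSine c x = 0 := by
  have h1 := (flatSine_periodic c).intervalIntegral_add_eq 0 (-(1 / 2))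
  have h2 : ∫ x in (-(1 / 2) : ℝ)..(1 / 2), flatSine c x =
      -∫ x in (-(1 / 2) : ℝ)..(1 / 2), flatSine c x := by
    have := intervalIntegral.integral_comp_neg (a := -(1 / 2)) (b := 1 / 2) (flatSine c)
    simp only [flatSine_neg, neg_neg, intervalIntegral.integral_neg] at this
    exact this.symm
  rw [zero_add] at h1
  rw [h1, show (-(1 / 2) + 1 : ℝ) = 1 / 2 by norm_num]
  linarith

/-- A smooth `1`-periodic function of mean zero, given with a periodic primitive and a periodic
weight which will be an approximate inverse of its derivative. -/
structure Profile where
  /-- The periodic function itself. -/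
  toFun : ℝ → ℝ
  /-- A periodic primitive. -/
  primitive : ℝ → ℝ
  /-- The approximate inverse of the derivative. -/
  weight : ℝ → ℝ
  contDiff : ContDiff ℝ ∞ toFun
  periodic : Function.Periodic toFun 1
  hasDerivAt_primitive : ∀ x, HasDerivAt primitive (toFun x) x
  primitive_periodic : Function.Periodic primitive 1
  contDiff_weight : ContDiff ℝ ∞ weight
  weight_periodic : Function.Periodic weight 1

namespace Profile

theorem contDiff_deriv (F : Profile) : ContDiff ℝ ∞ (deriv F.toFun) :=
  (contDiff_infty_iff_deriv.1 F.contDiff).2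

/-- The profile `flatSine c` with the weight `h / (h ^ 2 + κ ^ 2)`, where `h` is its derivative. -/
noncomputable def ofFlatSine (c κ : ℝ) (hκ : 0 < κ) : Profile where
  toFun := flatSine c
  primitive x := ∫ y in (0 : ℝ)..x, flatSine c y
  weight x := deriv (flatSine c) x / (deriv (flatSine c) x ^ 2 + κ ^ 2)
  contDiff := contDiff_flatSine c
  periodic := flatSine_periodic c
  hasDerivAt_primitive x :=
    ((contDiff_flatSine c).continuous.integral_hasStrictDerivAt 0 x).hasDerivAt
  primitive_periodic x := by
    have hi : ∀ a b, IntervalIntegrable (flatSine c) volume a b := fun a b =>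
      (contDiff_flatSine c).continuous.intervalIntegrable a b
    have h1 := (flatSine_periodic c).intervalIntegral_add_eq x 0
    rw [zero_add, integral_flatSine] at h1
    simp only
    rw [← intervalIntegral.integral_add_adjacent_intervals (hi 0 x) (hi x (x + 1)), h1, add_zero]
  contDiff_weight := by
    have h := (contDiff_infty_iff_deriv.1 (contDiff_flatSine c)).2
    exact h.div ((h.pow 2).add contDiff_const) fun x => by positivity
  weight_periodic x := by
    have h := (flatSine_periodic c).deriv_periodic x
    simp only [h]

/-- All the functions attached to a profile, and finitely many derivatives, are bounded. -/
theorem exists_bound (F : Profile) (n : ℕ) : ∃ M : ℝ, ∀ x, |F.primitive x| ≤ M ∧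
    |F.weight x| ≤ M ∧ |deriv F.weight x| ≤ M ∧ ∀ k ≤ n, |iteratedDeriv k F.toFun x| ≤ M := by
  obtain ⟨C1, h1⟩ := F.primitive_periodic.exists_abs_le
    (continuous_iff_continuousAt.2 fun x => (F.hasDerivAt_primitive x).continuousAt)
  obtain ⟨C2, h2⟩ := F.weight_periodic.exists_abs_le F.contDiff_weight.continuous
  obtain ⟨C3, h3⟩ := F.weight_periodic.deriv_periodic.exists_abs_le
    (contDiff_infty_iff_deriv.1 F.contDiff_weight).2.continuous
  choose C h using fun k : ℕ => (F.periodic.iteratedDeriv_periodic k).exists_abs_le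
    (F.contDiff.continuous_iteratedDeriv k (by exact_mod_cast le_top))
  have hC : ∀ k, 0 ≤ C k := fun k => (abs_nonneg _).trans (h k 0)
  have hC1 := (abs_nonneg _).trans (h1 0)
  have hC2 := (abs_nonneg _).trans (h2 0)
  have hC3 := (abs_nonneg _).trans (h3 0)
  have hS : 0 ≤ ∑ k ∈ Finset.range (n + 1), C k := Finset.sum_nonneg fun k _ => hC k
  refine ⟨C1 + C2 + C3 + ∑ k ∈ Finset.range (n + 1), C k, fun x => ⟨?_, ?_, ?_, fun k hk => ?_⟩⟩
  · linarith [h1 x]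
  · linarith [h2 x]
  · linarith [h3 x]
  · have := Finset.single_le_sum (f := C) (fun k _ => hC k)
      (Finset.mem_range.2 (Nat.lt_succ_of_le hk))
    linarith [h k x]

end Profile

theorem ae_sin_cos_ne_zero : ∀ᵐ x : ℝ, Real.sin (2 * Real.pi * x) ≠ 0 ∧
    Real.cos (2 * Real.pi * x) ≠ 0 := by
  have hc : (Set.range fun n : ℤ => (n : ℝ) / 4).Countable := Set.countable_range _
  filter_upwards [hc.ae_notMem volume] with x hx
  rw [← mul_ne_zero_iff]
  intro h
  have h2 : Real.sin (2 * (2 * Real.pi * x)) = 0 := by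
    rw [Real.sin_two_mul]
    linear_combination 2 * h
  obtain ⟨n, hn⟩ := Real.sin_eq_zero_iff.1 h2
  refine hx ⟨n, ?_⟩
  have := Real.pi_ne_zero
  simp only
  field_simp at hn
  linarith

/-- Profiles whose plateaus have lengths of order `1 / n`, and whose weights invert the derivative
up to an error that tends to zero in mean. -/
theorem exists_profiles : ∃ F : ℕ → Profile,
    (∀ (n : ℕ) (x : ℝ), |x| ≤ 1 / (7 * ((n : ℝ) + 2)) → (F n).toFun x = 0) ∧
    Tendsto (fun n => ∫ x in (0 : ℝ)..1, |1 - (F n).weight x * deriv (F n).toFun x|) atTop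
      (𝓝 0) := by
  set c : ℕ → ℝ := fun n => 1 / ((n : ℝ) + 2) with hc
  have hc0 : ∀ n, 0 < c n := fun n => by positivity
  set h : ℕ → ℝ → ℝ := fun n => deriv (flatSine (c n)) with hh
  have hcont : ∀ n, Continuous (h n) := fun n =>
    (contDiff_infty_iff_deriv.1 (contDiff_flatSine (c n))).2.continuous
  set e : ℕ → ℝ → ℝ → ℝ := fun n κ x => κ ^ 2 / (h n x ^ 2 + κ ^ 2) with he
  have he1 : ∀ n κ x, ‖e n κ x‖ ≤ 1 := by
    intro n κ x
    have : 0 ≤ e n κ x := by simp only [he]; positivity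
    rw [Real.norm_eq_abs, abs_of_nonneg this]
    exact div_le_one_of_le₀ (by nlinarith [sq_nonneg (h n x)]) (by positivity)
  -- For fixed `n`, the error tends to the measure of the set of critical points as `κ → 0`.
  set χ : ℕ → ℝ → ℝ := fun n x => if h n x = 0 then 1 else 0 with hχ
  have hχm : ∀ n, Measurable (χ n) := fun n =>
    Measurable.ite ((hcont n).measurable (measurableSet_singleton 0)) measurable_const
      measurable_const
  have hlim : ∀ n, Tendsto (fun j : ℕ => ∫ x in (0 : ℝ)..1, e n (1 / ((j : ℝ) + 1)) x) atTop
      (𝓝 (∫ x in (0 : ℝ)..1, χ n x)) := by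
    intro n
    refine intervalIntegral.tendsto_integral_filter_of_dominated_convergence (fun _ => 1)
      (Eventually.of_forall fun j => ?_) (Eventually.of_forall fun j => ae_of_all _ fun x _ =>
        he1 n _ x) intervalIntegrable_const (ae_of_all _ fun x _ => ?_)
    · refine Continuous.aestronglyMeasurable ?_
      refine continuous_const.div (((hcont n).pow 2).add continuous_const) fun x => ?_
      positivity
    · have hz := tendsto_one_div_add_atTop_nhds_zero_nat (𝕜 := ℝ)
      simp only [hχ, he]
      by_cases h0 : h n x = 0
      · rw [if_pos h0]
        refine tendsto_const_nhds.congr fun j => ?_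
        rw [h0]
        have : (0 : ℝ) < 1 / ((j : ℝ) + 1) := by positivity
        field_simp
        simp
      · rw [if_neg h0]
        have h1 := (hz.pow 2).div ((tendsto_const_nhds (x := h n x ^ 2)).add (hz.pow 2))
          (by simpa using h0)
        simp only [ne_eq, OfNat.ofNat_ne_zero, not_false_eq_true, zero_pow, add_zero,
          zero_div] at h1
        exact h1
  have hlim2 : Tendsto (fun n => ∫ x in (0 : ℝ)..1, χ n x) atTop (𝓝 0) := by
    have : Tendsto (fun n => ∫ x in (0 : ℝ)..1, χ n x) atTop (𝓝 (∫ x in (0 : ℝ)..1, (0 : ℝ))) := by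
      refine intervalIntegral.tendsto_integral_filter_of_dominated_convergence (fun _ => 1)
        (Eventually.of_forall fun n => (hχm n).aestronglyMeasurable)
        (Eventually.of_forall fun n => ae_of_all _ fun x _ => ?_) intervalIntegrable_const ?_
      · simp only [hχ]
        split_ifs <;> simp
      · filter_upwards [ae_sin_cos_ne_zero] with x hx _
        have hz : Tendsto c atTop (𝓝 0) := by
          have h1 : Tendsto (fun n : ℕ => (n : ℝ) + 2) atTop atTop :=
            tendsto_atTop_add_const_right _ _ tendsto_natCast_atTop_atTop
          exact (tendsto_const_nhds (x := (1 : ℝ))).div_atTop h1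
        refine tendsto_const_nhds.congr' ?_
        filter_upwards [hz.eventually_lt_const (abs_pos.2 hx.1)] with n hn
        simp only [hχ]
        rw [if_neg (deriv_flatSine_ne_zero (hc0 n) hn hx.2)]
    simpa using this
  have hex : ∀ n, ∃ j : ℕ, ∫ x in (0 : ℝ)..1, e n (1 / ((j : ℝ) + 1)) x ≤
      (∫ x in (0 : ℝ)..1, χ n x) + 1 / ((n : ℝ) + 1) := fun n =>
    ((hlim n).eventually_le_const (lt_add_of_pos_right _ (by positivity))).exists
  choose j hj using hex
  have hκ : ∀ n, (0 : ℝ) < 1 / ((j n : ℝ) + 1) := fun n => by positivity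
  refine ⟨fun n => Profile.ofFlatSine (c n) _ (hκ n), fun n x hx => ?_, ?_⟩
  · refine flatSine_eq_zero (hx.trans (le_of_eq ?_))
    simp only [hc]
    field_simp
  · have hup : Tendsto (fun n : ℕ => (∫ x in (0 : ℝ)..1, χ n x) + 1 / ((n : ℝ) + 1)) atTop
        (𝓝 0) := by
      simpa using hlim2.add (tendsto_one_div_add_atTop_nhds_zero_nat (𝕜 := ℝ))
    refine squeeze_zero (fun n => ?_) (fun n => ?_) hup
    · exact intervalIntegral.integral_nonneg zero_le_one fun x _ => abs_nonneg _
    · refine le_of_eq_of_le ?_ (hj n)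
      refine intervalIntegral.integral_congr fun x _ => ?_
      simp only [Profile.ofFlatSine, he]
      have hp : 0 < h n x ^ 2 + (1 / ((j n : ℝ) + 1)) ^ 2 := by
        have := hκ n
        positivity
      have e1 : 1 - deriv (flatSine (c n)) x / (deriv (flatSine (c n)) x ^ 2 +
          (1 / ((j n : ℝ) + 1)) ^ 2) * deriv (flatSine (c n)) x
          = (1 / ((j n : ℝ) + 1)) ^ 2 / (h n x ^ 2 + (1 / ((j n : ℝ) + 1)) ^ 2) := by
        change 1 - h n x / (h n x ^ 2 + (1 / ((j n : ℝ) + 1)) ^ 2) * h n x = _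
        rw [eq_div_iff hp.ne', sub_mul, div_mul_eq_mul_div, div_mul_cancel₀ _ hp.ne']
        ring
      rw [e1, abs_of_nonneg (by positivity)]

/-! ### Shear of the flow across the orbits -/

namespace Torus

open UnitAddTorus (mFourier)

variable {d : ℕ} {v w : Fin d → ℝ} {f g : C(Torus d, ℝ)}

theorem continuous_uncurry_travelTime (v : Fin d → ℝ) (f : C(Torus d, ℝ)) :
    Continuous fun x : Torus d × ℝ => travelTime v f x.1 x.2 := by
  refine intervalIntegral.continuous_parametric_intervalIntegral_of_continuous
    (f := fun (x : Torus d × ℝ) u => f (x.1 + proj (u • v))) (s := fun x => x.2)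
    ?_ continuous_snd
  exact f.continuous.comp ((continuous_fst.comp continuous_fst).add
    ((continuous_proj_smul v).comp continuous_snd))

/-- The derivative of the travel time in a transverse direction `w` is the integral along the
trajectory of the derivative of `f` in this direction. -/
theorem hasDerivAt_travelTime_line
    (hfg : ∀ p, HasDerivAt (fun r : ℝ => f (p + proj (r • w))) (g p) 0) (p : Torus d) (s : ℝ) :
    HasDerivAt (fun r : ℝ => travelTime v f (p + proj (r • w)) s) (travelTime v g p s) 0 := by
  have h := intervalIntegral.hasDerivAt_integral_of_dominated_loc_of_deriv_le (𝕜 := ℝ)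
    (μ := volume) (a := 0) (b := s)
    (F := fun r u => f (p + proj (r • w) + proj (u • v)))
    (F' := fun r u => g (p + proj (r • w) + proj (u • v))) (x₀ := (0 : ℝ)) (s := Set.univ)
    (bound := fun _ => ‖g‖) univ_mem
    (Eventually.of_forall fun r => (continuous_along v f _).aestronglyMeasurable)
    ((continuous_along v f _).intervalIntegrable _ _)
    (continuous_along v g _).aestronglyMeasurable
    (ae_of_all _ fun u _ r _ => g.norm_coe_le_norm _) intervalIntegrable_const
    (ae_of_all _ fun u _ r _ => ?_)
  · have h2 := h.2
    simp only [zero_smul, proj_zero, add_zero] at h2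
    exact h2
  · have := hasDerivAt_line_of_zero hfg (p + proj (u • v)) r
    simpa only [add_right_comm] using this

/-- The derivative of the displacement in a transverse direction, by implicit differentiation of
`travelTime v f p (displacement v f t p) = t`. -/
theorem hasDerivAt_displacement_line (hf : ∀ p, 0 < f p)
    (hfg : ∀ p, HasDerivAt (fun r : ℝ => f (p + proj (r • w))) (g p) 0) (t : ℝ) (p : Torus d) :
    HasDerivAt (fun r : ℝ => displacement v f t (p + proj (r • w)))
      (-travelTime v g p (displacement v f t p) / f (reparamFlow v hf t p)) 0 := by
  set s₀ := displacement v f t p with hs₀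
  set s : ℝ → ℝ := fun r => displacement v f t (p + proj (r • w)) with hs
  have hs0 : s 0 = s₀ := by simp only [hs, zero_smul, proj_zero, add_zero, hs₀]
  have hcs : Continuous s := (continuous_displacement hf).comp
    (continuous_const.prodMk (continuous_const.add (continuous_proj_smul w)))
  -- The mean of `f` over the piece of trajectory between `s₀` and `s r`.
  set A : ℝ → ℝ := fun r => ∫ τ in (0 : ℝ)..1,
    f (p + proj (r • w) + proj ((s₀ + τ * (s r - s₀)) • v)) with hA
  have hAc : Continuous A := by
    refine intervalIntegral.continuous_parametric_intervalIntegral_of_continuous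
      (s := fun _ => (1 : ℝ)) ?_ continuous_const
    refine f.continuous.comp ?_
    refine (continuous_const.add ((continuous_proj_smul w).comp continuous_fst)).add
      ((continuous_proj_smul v).comp ?_)
    exact continuous_const.add (continuous_snd.mul ((hcs.comp continuous_fst).sub continuous_const))
  have hA0 : A 0 = f (reparamFlow v hf t p) := by
    simp only [hA, hs0, sub_self, mul_zero, add_zero, zero_smul, proj_zero]
    simp [reparamFlow_apply, hs₀]
  have hApos : ∀ r, 0 < A r := by
    intro r
    obtain ⟨c, hc, hfc⟩ := exists_pos_forall_le hf
    have hcont : Continuous fun τ : ℝ =>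
        f (p + proj (r • w) + proj ((s₀ + τ * (s r - s₀)) • v)) := by
      refine (continuous_along v f (p + proj (r • w))).comp ?_
      fun_prop
    have := intervalIntegral.integral_mono_on (μ := volume) zero_le_one
      (intervalIntegrable_const (c := c)) (hcont.intervalIntegrable 0 1) fun τ _ => hfc _
    simp only [intervalIntegral.integral_const, sub_zero, one_smul] at this
    linarith
  have key : ∀ r, (s r - s₀) * A r =
      -(travelTime v f (p + proj (r • w)) s₀ - travelTime v f p s₀) := by
    intro r
    have h1 : travelTime v f (p + proj (r • w)) (s r) = t := travelTime_displacement hf _ _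
    have h2 : travelTime v f p s₀ = t := travelTime_displacement hf _ _
    have h3 := travelTime_sub v f (p + proj (r • w)) s₀ (s r)
    have h4 := intervalIntegral.smul_integral_comp_add_mul (a := 0) (b := 1)
      (fun u => f (p + proj (r • w) + proj (u • v))) (s r - s₀) s₀
    simp only [mul_zero, add_zero, mul_one, add_sub_cancel, smul_eq_mul] at h4
    have h5 : A r = ∫ x in (0 : ℝ)..1,
        f (p + proj (r • w) + proj ((s₀ + (s r - s₀) * x) • v)) := by
      simp only [hA, mul_comm]
    rw [h5, h4, ← h3, h1, h2]
    ring
  have hd := hasDerivAt_iff_tendsto_slope_zero.1 (hasDerivAt_travelTime_line (v := v) hfg p s₀)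
  rw [hasDerivAt_iff_tendsto_slope_zero]
  have hA' : Tendsto A (𝓝[≠] 0) (𝓝 (f (reparamFlow v hf t p))) := by
    rw [← hA0]
    exact hAc.continuousAt.tendsto.mono_left nhdsWithin_le_nhds
  refine (hd.neg.div hA' (hf _).ne').congr fun r => ?_
  have h6 : s r - s₀ = -(travelTime v f (p + proj (r • w)) s₀ - travelTime v f p s₀) / A r := by
    rw [eq_div_iff (hApos r).ne', key r]
  change _ = r⁻¹ • (s (0 + r) - s 0)
  rw [zero_add, hs0, h6]
  simp only [Pi.div_apply, zero_add, zero_smul, proj_zero, add_zero, smul_eq_mul]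
  ring

/-- A character along the flow responds to a transverse displacement by the shear: the last term
below, which is large for large times. -/
theorem hasDerivAt_mFourier_reparamFlow_line (hf : ∀ p, 0 < f p)
    (hfg : ∀ p, HasDerivAt (fun r : ℝ => f (p + proj (r • w))) (g p) 0) (m : Fin d → ℤ) (t : ℝ)
    (p : Torus d) :
    HasDerivAt (fun r : ℝ => mFourier m (reparamFlow v hf t (p + proj (r • w))))
      (2 * Real.pi * Complex.I * (pairing m w : ℝ) * mFourier m (reparamFlow v hf t p) -
        2 * Real.pi * Complex.I * (pairing m v : ℝ) * (((f (reparamFlow v hf t p))⁻¹ : ℂ) *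
          mFourier m (reparamFlow v hf t p)) *
          (travelTime v g p (displacement v f t p) : ℝ)) 0 := by
  have hd := hasDerivAt_displacement_line (v := v) hf hfg t p
  have h1 : HasDerivAt (fun r : ℝ => r * pairing m w +
      displacement v f t (p + proj (r • w)) * pairing m v)
      (1 * pairing m w + (-travelTime v g p (displacement v f t p) / f (reparamFlow v hf t p)) *
        pairing m v) 0 :=
    ((hasDerivAt_id (0 : ℝ)).mul_const _).add (hd.mul_const _)
  have h2 := ((h1.ofReal_comp.const_mul (2 * Real.pi * Complex.I)).cexp).const_mul (mFourier m p)
  have e : ∀ r : ℝ, mFourier m (reparamFlow v hf t (p + proj (r • w))) =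
      mFourier m p * Complex.exp (2 * Real.pi * Complex.I * ((r * pairing m w +
      displacement v f t (p + proj (r • w)) * pairing m v : ℝ) : ℂ)) := by
    intro r
    rw [reparamFlow_apply, add_assoc, ← proj_add, mFourier_add_proj, pairing_add, pairing_smul,
      pairing_smul]
  have e0 : mFourier m (reparamFlow v hf t p) =
      mFourier m p * Complex.exp (2 * Real.pi * Complex.I * ((0 * pairing m w +
      displacement v f t (p + proj ((0 : ℝ) • w)) * pairing m v : ℝ) : ℂ)) := by
    simpa only [zero_smul, proj_zero, add_zero] using e 0
  simp only [e]
  refine h2.congr_deriv ?_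
  rw [← mul_assoc, ← e0]
  push_cast
  ring

/-- Integration by parts in a direction `w` against the shear of the flow across the orbits. -/
theorem norm_integral_shear_le (hf : ∀ p, 0 < f p)
    (hfg : ∀ p, HasDerivAt (fun r : ℝ => f (p + proj (r • w))) (g p) 0) (m l : Fin d → ℤ) (t : ℝ)
    {B B' : Torus d → ℝ} (hB : Continuous B) (hB' : Continuous B')
    (hBB' : ∀ p, HasDerivAt (fun r : ℝ => B (p + proj (r • w))) (B' p) 0) {b : ℝ}
    (hb : ∀ p, |B p| ≤ b) (hb' : ∀ p, |B' p| ≤ b) :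
    2 * Real.pi * |pairing m v| * ‖∫ p, ((f (reparamFlow v hf t p))⁻¹ : ℂ) *
      mFourier m (reparamFlow v hf t p) * mFourier l p *
      ((B p * travelTime v g p (displacement v f t p) : ℝ) : ℂ)‖ ≤
      (2 * Real.pi * (|pairing m w| + |pairing l w|) + 1) * b := by
  have hΦ : Continuous (reparamFlow v hf t) := (reparamFlow v hf).continuous_toFun t
  have hD : Continuous fun p => travelTime v g p (displacement v f t p) :=
    (continuous_uncurry_travelTime v g).comp (continuous_id.prodMk
      ((continuous_displacement hf).comp (continuous_const.prodMk continuous_id)))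
  have hem : Continuous fun p => mFourier m (reparamFlow v hf t p) :=
    (mFourier m).continuous.comp hΦ
  have hel : Continuous (mFourier l) := (mFourier l).continuous
  have hfi : Continuous fun p => ((f (reparamFlow v hf t p))⁻¹ : ℂ) :=
    (continuous_ofReal_inv hf).comp hΦ
  have hBc : Continuous fun p => ((B p : ℝ) : ℂ) := Complex.continuous_ofReal.comp hB
  have hBc' : Continuous fun p => ((B' p : ℝ) : ℂ) := Complex.continuous_ofReal.comp hB'
  have hDc : Continuous fun p => ((travelTime v g p (displacement v f t p) : ℝ) : ℂ) :=
    Complex.continuous_ofReal.comp hD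
  set R : Torus d → ℂ := fun p =>
    2 * Real.pi * Complex.I * (pairing m w : ℝ) * mFourier m (reparamFlow v hf t p) *
      (mFourier l p * B p) + mFourier m (reparamFlow v hf t p) *
      (2 * Real.pi * Complex.I * (pairing l w : ℝ) * mFourier l p * B p + mFourier l p * B' p)
    with hR
  have hRc : Continuous R := by fun_prop
  set J : Torus d → ℂ := fun p => ((f (reparamFlow v hf t p))⁻¹ : ℂ) *
      mFourier m (reparamFlow v hf t p) * mFourier l p *
      ((B p * travelTime v g p (displacement v f t p) : ℝ) : ℂ) with hJ
  have hJc : Continuous J := by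
    simp only [hJ, Complex.ofReal_mul]
    fun_prop
  have h0 : ∫ p, (R p - 2 * Real.pi * Complex.I * (pairing m v : ℝ) * J p) = 0 := by
    refine integral_eq_zero_of_hasDerivAt_line w
      (F := fun p => mFourier m (reparamFlow v hf t p) * (mFourier l p * B p))
      (by fun_prop) (by fun_prop) fun p => ?_
    have h1 := hasDerivAt_mFourier_reparamFlow_line (v := v) hf hfg m t p
    have h2 := hasDerivAt_mFourier_line l p w 0
    have h3 := (hBB' p).ofReal_comp
    have h4 := h1.mul (h2.mul h3)
    simp only [Pi.mul_apply, zero_smul, proj_zero, add_zero] at h4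
    refine h4.congr_deriv ?_
    simp only [hR, hJ]
    push_cast
    ring
  have iR : Integrable R := (⟨R, hRc⟩ : C(Torus d, ℂ)).integrable_of_compactSpace volume
  have iJ : Integrable J := (⟨J, hJc⟩ : C(Torus d, ℂ)).integrable_of_compactSpace volume
  rw [integral_sub iR (iJ.const_mul _),
    integral_const_mul, sub_eq_zero] at h0
  have hb0 : 0 ≤ b := (abs_nonneg _).trans (hb 0)
  have h2 : ‖∫ p, R p‖ ≤ (2 * Real.pi * (|pairing m w| + |pairing l w|) + 1) * b := by
    have h3 : ∀ p, ‖R p‖ ≤ (2 * Real.pi * (|pairing m w| + |pairing l w|) + 1) * b := by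
      intro p
      have hB1 : ‖(B p : ℂ)‖ ≤ b := by simpa using hb p
      have hB2 : ‖(B' p : ℂ)‖ ≤ b := by simpa using hb' p
      have hc : ∀ x : ℝ, ‖(2 * Real.pi * Complex.I * (x : ℝ) : ℂ)‖ = 2 * Real.pi * |x| := by
        intro x
        simp [abs_of_pos Real.pi_pos]
      simp only [hR]
      refine (norm_add_le _ _).trans ?_
      have t1 : ‖2 * Real.pi * Complex.I * (pairing m w : ℝ) * mFourier m (reparamFlow v hf t p) *
          (mFourier l p * B p)‖ ≤ 2 * Real.pi * |pairing m w| * b := by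
        rw [norm_mul, norm_mul, hc, norm_mul, norm_mFourier_apply, norm_mFourier_apply, mul_one,
          one_mul]
        gcongr
      have t2 : ‖mFourier m (reparamFlow v hf t p) * (2 * Real.pi * Complex.I * (pairing l w : ℝ) *
          mFourier l p * B p + mFourier l p * B' p)‖ ≤ 2 * Real.pi * |pairing l w| * b + b := by
        rw [norm_mul, norm_mFourier_apply, one_mul]
        refine (norm_add_le _ _).trans (add_le_add ?_ ?_)
        · rw [norm_mul, norm_mul, hc, norm_mFourier_apply, mul_one]
          gcongr
        · rw [norm_mul, norm_mFourier_apply, one_mul]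
          exact hB2
      linarith
    simpa using norm_integral_le_of_norm_le_const (ae_of_all (volume : Measure (Torus d)) h3)
  rw [h0, norm_mul] at h2
  have h5 : ‖(2 * Real.pi * Complex.I * (pairing m v : ℝ) : ℂ)‖ = 2 * Real.pi * |pairing m v| := by
    simp [abs_of_pos Real.pi_pos]
  rwa [h5] at h2

/-- The correlation estimate: when the shear is close to `A * h` and `B` is an approximate
inverse of `h`, correlations are bounded by the errors in these two approximations and the inverse
of the shear. -/
theorem norm_correlation_shear_le (hf : ∀ p, 0 < f p)
    (hfg : ∀ p, HasDerivAt (fun r : ℝ => f (p + proj (r • w))) (g p) 0) {m : Fin d → ℤ}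
    (hm : pairing m v ≠ 0) (l : Fin d → ℤ) (t : ℝ)
    {B B' h : Torus d → ℝ} (hB : Continuous B) (hB' : Continuous B') (hh : Continuous h)
    (hBB' : ∀ p, HasDerivAt (fun r : ℝ => B (p + proj (r • w))) (B' p) 0) {b : ℝ}
    (hb : ∀ p, |B p| ≤ b) (hb' : ∀ p, |B' p| ≤ b) {A ρ c : ℝ} (hA : 0 < A)
    (hD : ∀ p, |travelTime v g p (displacement v f t p) - A * h p| ≤ A * ρ)
    (hc0 : 0 ≤ c) (hc : ∀ p, (f p)⁻¹ ≤ c) :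
    ‖∫ p, ((f (reparamFlow v hf t p))⁻¹ : ℂ) * mFourier m (reparamFlow v hf t p) *
      mFourier l p‖ ≤ c * (∫ p, |1 - B p * h p|) + c * (b * ρ) +
      (2 * Real.pi * (|pairing m w| + |pairing l w|) + 1) * b /
        (2 * Real.pi * |pairing m v| * A) := by
  have hΦ : Continuous (reparamFlow v hf t) := (reparamFlow v hf).continuous_toFun t
  have hDc : Continuous fun p => travelTime v g p (displacement v f t p) :=
    (continuous_uncurry_travelTime v g).comp (continuous_id.prodMk
      ((continuous_displacement hf).comp (continuous_const.prodMk continuous_id)))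
  have hem : Continuous fun p => mFourier m (reparamFlow v hf t p) :=
    (mFourier m).continuous.comp hΦ
  have hel : Continuous (mFourier l) := (mFourier l).continuous
  have hfi : Continuous fun p => ((f (reparamFlow v hf t p))⁻¹ : ℂ) :=
    (continuous_ofReal_inv hf).comp hΦ
  set D : Torus d → ℝ := fun p => travelTime v g p (displacement v f t p) with hDdef
  set ψ : Torus d → ℂ := fun p => ((f (reparamFlow v hf t p))⁻¹ : ℂ) *
    mFourier m (reparamFlow v hf t p) * mFourier l p with hψ
  have hψc : Continuous ψ := by fun_prop
  have hψn : ∀ p, ‖ψ p‖ ≤ c := by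
    intro p
    simp only [hψ]
    rw [norm_mul, norm_mul, norm_mFourier_apply, norm_mFourier_apply, mul_one, mul_one, norm_inv,
      Complex.norm_real, Real.norm_eq_abs, abs_of_pos (hf _)]
    exact hc _
  have key := norm_integral_shear_le (v := v) hf hfg m l t hB hB' hBB' hb hb'
  have hint : ∀ {G : Torus d → ℂ}, Continuous G → Integrable G :=
    fun hG => (⟨_, hG⟩ : C(Torus d, ℂ)).integrable_of_compactSpace volume
  have hintR : ∀ {G : Torus d → ℝ}, Continuous G → Integrable G :=
    fun hG => (⟨_, hG⟩ : C(Torus d, ℝ)).integrable_of_compactSpace volume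
  have c1 : Continuous fun p => ψ p * ((1 - B p * h p : ℝ) : ℂ) :=
    hψc.mul (Complex.continuous_ofReal.comp (continuous_const.sub (hB.mul hh)))
  have c2 : Continuous fun p => ψ p * ((B p * (h p - A⁻¹ * D p) : ℝ) : ℂ) :=
    hψc.mul (Complex.continuous_ofReal.comp
      (hB.mul (hh.sub (continuous_const.mul hDc))))
  have c3 : Continuous fun p => ψ p * ((B p * D p : ℝ) : ℂ) :=
    hψc.mul (Complex.continuous_ofReal.comp (hB.mul hDc))
  have e : ∫ p, ψ p = (∫ p, ψ p * ((1 - B p * h p : ℝ) : ℂ)) +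
      (∫ p, ψ p * ((B p * (h p - A⁻¹ * D p) : ℝ) : ℂ)) +
      (A : ℂ)⁻¹ * ∫ p, ψ p * ((B p * D p : ℝ) : ℂ) := by
    have i12 : Integrable fun p => ψ p * ((1 - B p * h p : ℝ) : ℂ) +
      ψ p * ((B p * (h p - A⁻¹ * D p) : ℝ) : ℂ) := (hint c1).add (hint c2)
    rw [← integral_const_mul, ← integral_add (hint c1) (hint c2),
      ← integral_add i12 ((hint c3).const_mul _)]
    congr 1
    ext p
    push_cast
    ring
  have b1 : ‖∫ p, ψ p * ((1 - B p * h p : ℝ) : ℂ)‖ ≤ c * ∫ p, |1 - B p * h p| := by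
    rw [← integral_const_mul]
    refine norm_integral_le_of_norm_le ((hintR (continuous_const.sub (hB.mul hh)).abs).const_mul c)
      (ae_of_all _ fun p => ?_)
    rw [norm_mul, Complex.norm_real, Real.norm_eq_abs]
    exact mul_le_mul_of_nonneg_right (hψn p) (abs_nonneg _)
  have b2 : ‖∫ p, ψ p * ((B p * (h p - A⁻¹ * D p) : ℝ) : ℂ)‖ ≤ c * (b * ρ) := by
    have : ∀ p, ‖ψ p * ((B p * (h p - A⁻¹ * D p) : ℝ) : ℂ)‖ ≤ c * (b * ρ) := by
      intro p
      rw [norm_mul, Complex.norm_real, Real.norm_eq_abs, abs_mul]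
      have h1 : |h p - A⁻¹ * D p| ≤ ρ := by
        have h2 : h p - A⁻¹ * D p = -(A⁻¹ * (D p - A * h p)) := by
          field_simp
          ring
        rw [h2, abs_neg, abs_mul, abs_of_pos (inv_pos.2 hA), inv_mul_le_iff₀ hA]
        exact hD p
      exact mul_le_mul (hψn p) (mul_le_mul (hb p) h1 (abs_nonneg _) ((abs_nonneg _).trans (hb p)))
        (by positivity) hc0
    simpa using norm_integral_le_of_norm_le_const (ae_of_all (volume : Measure (Torus d)) this)
  have b3 : ‖(A : ℂ)⁻¹ * ∫ p, ψ p * ((B p * D p : ℝ) : ℂ)‖ ≤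
      (2 * Real.pi * (|pairing m w| + |pairing l w|) + 1) * b /
        (2 * Real.pi * |pairing m v| * A) := by
    have hpos : 0 < 2 * Real.pi * |pairing m v| := by
      have := abs_pos.2 hm
      have := Real.pi_pos
      positivity
    rw [norm_mul, norm_inv, Complex.norm_real, Real.norm_eq_abs, abs_of_pos hA,
      le_div_iff₀ (by positivity)]
    calc A⁻¹ * ‖∫ p, ψ p * ((B p * D p : ℝ) : ℂ)‖ * (2 * Real.pi * |pairing m v| * A)
        = 2 * Real.pi * |pairing m v| * ‖∫ p, ψ p * ((B p * D p : ℝ) : ℂ)‖ := by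
          field_simp
      _ ≤ _ := key
  rw [e]
  refine (norm_add_le _ _).trans (add_le_add ((norm_add_le _ _).trans (add_le_add b1 b2)) b3)

end Torus

/-! ### Periodic functions on the circle -/

namespace Function.Periodic

variable {g G : ℝ → ℝ} (hg : Function.Periodic g 1) (hG : Function.Periodic G 1)

theorem continuous_lift (hc : Continuous g) :
    Continuous (hg.lift : UnitAddCircle → ℝ) :=
  hc.quotient_liftOn' _

theorem abs_lift_le {C : ℝ} (h : ∀ x, |g x| ≤ C) (θ : UnitAddCircle) : |hg.lift θ| ≤ C := by
  obtain ⟨x, rfl⟩ := QuotientAddGroup.mk_surjective θ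
  exact h x

theorem hasDerivAt_lift (h : ∀ x, HasDerivAt G (g x) x) (θ : UnitAddCircle) (c r : ℝ) :
    HasDerivAt (fun r : ℝ => hG.lift (θ + ((r * c : ℝ) : UnitAddCircle)))
      (hg.lift (θ + ((r * c : ℝ) : UnitAddCircle)) * c) r := by
  obtain ⟨x, rfl⟩ := QuotientAddGroup.mk_surjective θ
  have h1 : HasDerivAt (fun r : ℝ => x + r * c) c r := by
    simpa using ((hasDerivAt_id r).mul_const c).const_add x
  exact (h (x + r * c)).comp r h1

theorem abs_lift_add_sub_le (h : ∀ x, HasDerivAt G (g x) x) {C : ℝ} (hC : ∀ x, |g x| ≤ C)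
    (θ : UnitAddCircle) (r : ℝ) :
    |hG.lift (θ + (r : UnitAddCircle)) - hG.lift θ| ≤ C * |r| := by
  obtain ⟨x, rfl⟩ := QuotientAddGroup.mk_surjective θ
  have := convex_univ.norm_image_sub_le_of_norm_hasDerivWithin_le (f := G) (f' := g) (C := C)
    (fun y _ => (h y).hasDerivWithinAt) (fun y _ => hC y) (Set.mem_univ x) (Set.mem_univ (x + r))
  rw [add_sub_cancel_left] at this
  exact this

theorem integral_lift (h : ∀ x, HasDerivAt G (g x) x) (hc : Continuous g) (θ : UnitAddCircle)
    {c : ℝ} (hc0 : c ≠ 0) (s : ℝ) :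
    ∫ u in (0 : ℝ)..s, hg.lift (θ + ((u * c : ℝ) : UnitAddCircle)) =
      (hG.lift (θ + ((s * c : ℝ) : UnitAddCircle)) - hG.lift θ) / c := by
  have hcont : Continuous fun u : ℝ => hg.lift (θ + ((u * c : ℝ) : UnitAddCircle)) := by
    refine (hg.continuous_lift hc).comp (continuous_const.add ?_)
    exact (AddCircle.continuous_mk' 1).comp (continuous_id.mul continuous_const)
  have := intervalIntegral.integral_eq_sub_of_hasDerivAt
    (fun u _ => hasDerivAt_lift hg hG h θ c u)
    ((hcont.mul continuous_const).intervalIntegrable 0 s)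
  rw [intervalIntegral.integral_mul_const, zero_mul] at this
  rw [eq_div_iff hc0, this]
  simp

end Function.Periodic

/-! ### The time change -/

namespace Torus

variable {d : ℕ}

/-- The character of frequency `m`, with values in `ℝ / ℤ`. -/
def phase (m : Fin d → ℤ) : Torus d →+ UnitAddCircle where
  toFun p := ∑ k, m k • p k
  map_zero' := by simp
  map_add' p q := by simp [Finset.sum_add_distrib]

theorem continuous_phase (m : Fin d → ℤ) : Continuous (phase m) :=
  show Continuous fun p : Torus d => ∑ k, m k • p k from
    continuous_finsetSum _ fun k _ => (continuous_apply k).zsmul (m k)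

theorem phase_proj (m : Fin d → ℤ) (w : Fin d → ℝ) :
    phase m (proj w) = ((pairing m w : ℝ) : UnitAddCircle) := by
  have h : ((pairing m w : ℝ) : UnitAddCircle) =
      ∑ k, (((m k : ℝ) * w k : ℝ) : UnitAddCircle) :=
    map_sum (QuotientAddGroup.mk' (AddSubgroup.zmultiples (1 : ℝ)))
      (fun k => (m k : ℝ) * w k) Finset.univ
  have h' : ∀ k ∈ Finset.univ, m k • ((w k : ℝ) : UnitAddCircle) =
      (((m k : ℝ) * w k : ℝ) : UnitAddCircle) := fun k _ => by
    rw [← AddCircle.coe_zsmul, zsmul_eq_mul]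
  exact (Finset.sum_congr rfl h').trans h.symm

theorem phase_add_proj_smul (m : Fin d → ℤ) (p : Torus d) (w : Fin d → ℝ) (r : ℝ) :
    phase m (p + proj (r • w)) = phase m p + ((r * pairing m w : ℝ) : UnitAddCircle) := by
  rw [map_add, phase_proj, pairing_smul]

end Torus

/-- The amplitude of the `i`-th term of the time change. The exponent `3` makes it negligible at the
time `Q i`, but large enough for the shear to be large at the time `exp ((Q i) ^ 4)`. -/
noncomputable def amp (Q : ℕ → ℕ) (i : ℕ) : ℝ := Real.exp (-(Q i : ℝ) ^ 3)

/-- The constant `M n` bounds the data of the `n`-th profile, and the frequencies `Q` grow fast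
compared with `M`. The first two derivatives of all profiles are bounded, as well as the derivatives
of any fixed order of all but finitely many profiles, which gives a smooth sum. -/
structure IsAdapted (F : ℕ → Profile) (M : ℕ → ℝ) (Q : ℕ → ℕ) : Prop
    extends IsFrequencySeq M Q where
  bound : ∀ n x, |(F n).primitive x| ≤ M n ∧ |(F n).weight x| ≤ M n ∧
    |deriv (F n).weight x| ≤ M n ∧ ∀ k ≤ n + 2, |iteratedDeriv k (F n).toFun x| ≤ M n

theorem exists_isAdapted (F : ℕ → Profile) : ∃ M Q, IsAdapted F M Q := by
  choose M hM using fun n => (F n).exists_bound (n + 2)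
  obtain ⟨Q, hQ⟩ := exists_isFrequencySeq M
  exact ⟨M, Q, ⟨hQ, hM⟩⟩

namespace IsFrequencySeq

open Torus (pairing)

variable {M : ℕ → ℝ} {Q : ℕ → ℕ} (hQ : IsFrequencySeq M Q)

theorem amp_pos (Q : ℕ → ℕ) (i : ℕ) : 0 < amp Q i := Real.exp_pos _

include hQ

/-- The amplitudes decay faster than any power of the frequencies. -/
theorem amp_mul_pow_le (i k : ℕ) : amp Q i * (Q i : ℝ) ^ k ≤ (k + 1).factorial / Q i := by
  have hq := hQ.cast_pos i
  have h1 := Real.pow_div_factorial_le_exp (Q i : ℝ) hq.le (k + 1)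
  have h2 : amp Q i ≤ Real.exp (-(Q i : ℝ)) := by
    refine Real.exp_le_exp.2 (neg_le_neg ?_)
    have := hQ.le_cast i
    nlinarith [mul_pos hq hq]
  rw [Real.exp_neg] at h2
  have hfac : (0 : ℝ) < (k + 1).factorial := by positivity
  rw [div_le_iff₀ hfac] at h1
  rw [le_div_iff₀ hq]
  calc amp Q i * (Q i : ℝ) ^ k * Q i = amp Q i * (Q i : ℝ) ^ (k + 1) := by ring
    _ ≤ (Real.exp (Q i))⁻¹ * (Real.exp (Q i) * (k + 1).factorial) := by gcongr
    _ = (k + 1).factorial := by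
      rw [inv_mul_cancel_left₀ (Real.exp_pos _).ne']

theorem amp_mul_sq_le_inv_pow (i : ℕ) : amp Q i * (Q i : ℝ) ^ 2 ≤ 1 / (4 * (Q i : ℝ) ^ 2) := by
  have hq := hQ.cast_pos i
  have h1 := Real.pow_div_factorial_le_exp ((Q i : ℝ) ^ 3) (by positivity) 2
  have h2 := hQ.le_cast i
  rw [amp, Real.exp_neg, inv_mul_eq_div, div_le_div_iff₀ (Real.exp_pos _) (by positivity)]
  norm_num at h1
  have h3 : (0 : ℝ) < (Q i : ℝ) ^ 4 := by positivity
  have h4 : (8 : ℝ) ≤ (Q i : ℝ) ^ 2 := by nlinarith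
  nlinarith

theorem amp_mul_sq_succ_le (i : ℕ) :
    amp Q (i + 1) * (Q (i + 1) : ℝ) ^ 2 ≤ amp Q i * (Q i : ℝ) ^ 2 * (1 / 2) := by
  have h1 := hQ.amp_mul_sq_le_inv_pow (i + 1)
  have hq := hQ.le_cast i
  have hq1 := hQ.le_cast (i + 1)
  have h2 : 1 / (Q (i + 1) : ℝ) ≤ amp Q i := by
    rw [amp, Real.exp_neg, ← one_div]
    refine one_div_le_one_div_of_le (Real.exp_pos _) ((Real.exp_le_exp.2 ?_).trans (hQ.exp_le i))
    exact pow_le_pow_right₀ (by linarith) (by norm_num)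
  have h3 : 1 / (4 * (Q (i + 1) : ℝ) ^ 2) ≤ 1 / (Q (i + 1) : ℝ) :=
    one_div_le_one_div_of_le (by linarith) (by nlinarith)
  have h4 := amp_pos Q i
  have h5 : 2 ≤ (Q i : ℝ) ^ 2 := by nlinarith
  have h6 := mul_le_mul_of_nonneg_left h5 h4.le
  linarith

theorem amp_mul_sq_add_le (n k : ℕ) :
    amp Q (k + n) * (Q (k + n) : ℝ) ^ 2 ≤ amp Q n * (Q n : ℝ) ^ 2 * (1 / 2) ^ k := by
  induction k with
  | zero => simp
  | succ k ih =>
    have := hQ.amp_mul_sq_succ_le (k + n)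
    rw [show k + 1 + n = k + n + 1 by ring, pow_succ (1 / 2 : ℝ) k]
    linarith

omit hQ in
theorem amp_mul_sq_nonneg (Q : ℕ → ℕ) (n : ℕ) : 0 ≤ amp Q n * (Q n : ℝ) ^ 2 :=
  mul_nonneg (amp_pos Q n).le (sq_nonneg _)

theorem summable_amp_mul_sq (n : ℕ) :
    Summable fun k => amp Q (k + n) * (Q (k + n) : ℝ) ^ 2 :=
  Summable.of_nonneg_of_le (fun _ => amp_mul_sq_nonneg Q _) (hQ.amp_mul_sq_add_le n)
    (summable_geometric_two.mul_left _)

theorem tsum_amp_mul_sq_le (n : ℕ) :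
    ∑' k, amp Q (k + n) * (Q (k + n) : ℝ) ^ 2 ≤ 2 * (amp Q n * (Q n : ℝ) ^ 2) := by
  have h := (hQ.summable_amp_mul_sq n).tsum_le_tsum (hQ.amp_mul_sq_add_le n)
    (summable_geometric_two.mul_left _)
  rw [tsum_mul_left, tsum_geometric_two] at h
  linarith

theorem amp_mul_sq_le (n : ℕ) : amp Q n * (Q n : ℝ) ^ 2 ≤ 1 / 8 := by
  refine (hQ.amp_mul_sq_le_inv_pow n).trans (one_div_le_one_div_of_le (by norm_num) ?_)
  nlinarith [hQ.le_cast n]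

/-- A series whose terms are bounded by `amp i * Q i ^ 2` times a constant `A`, increased by `B`
from the index `N` on. -/
theorem abs_tsum_le {x : ℕ → ℝ} {A B : ℝ} (hA : 0 ≤ A) (hB : 0 ≤ B) (N : ℕ)
    (h : ∀ i, |x i| ≤ amp Q i * (Q i : ℝ) ^ 2 * (A + if N ≤ i then B else 0)) :
    |∑' i, x i| ≤ A / 4 + 2 * B * (amp Q N * (Q N : ℝ) ^ 2) := by
  set W : ℕ → ℝ := fun i => amp Q i * (Q i : ℝ) ^ 2 with hW
  have hs : Summable W := hQ.summable_amp_mul_sq 0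
  have hs1 : HasSum (fun i => W i * A) ((∑' i, W i) * A) := hs.hasSum.mul_right A
  have hs2 : HasSum (fun i => if N ≤ i then W i * B else 0) ((∑' k, W (k + N)) * B) := by
    rw [← hasSum_nat_add_iff' N]
    have : ∑ i ∈ Finset.range N, (if N ≤ i then W i * B else 0) = 0 :=
      Finset.sum_eq_zero fun i hi => if_neg (not_le.2 (Finset.mem_range.1 hi))
    rw [this, sub_zero]
    simp only [le_add_iff_nonneg_left, zero_le, if_true]
    exact (hQ.summable_amp_mul_sq N).hasSum.mul_right B
  have h1 := tsum_of_norm_bounded (hs1.add hs2) (f := x) fun i => by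
    refine (h i).trans (le_of_eq ?_)
    split_ifs <;> ring
  have h2 : ∑' i, W i ≤ 2 * W 0 := hQ.tsum_amp_mul_sq_le 0
  have h3 : ∑' k, W (k + N) ≤ 2 * W N := hQ.tsum_amp_mul_sq_le N
  have h4 : W 0 ≤ 1 / 8 := hQ.amp_mul_sq_le 0
  rw [Real.norm_eq_abs] at h1
  nlinarith

theorem parityNum_le (b n : ℕ) : (parityNum Q b n : ℝ) ≤ Q n := by
  have h1 := hQ.mul_parityTail_zero b n
  have h2 := hQ.parityTail_le b 0
  have h3 : (2 : ℝ) / Q 0 ≤ 1 := by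
    rw [div_le_one (hQ.cast_pos 0)]
    linarith [hQ.le_cast 0]
  have h4 := mul_nonneg (hQ.cast_pos n).le (parityTail_nonneg (Q := Q) b (n + 1))
  have h5 := mul_le_mul_of_nonneg_left (h2.trans h3) (hQ.cast_pos n).le
  linarith

theorem abs_pairing_le (i : ℕ) (w : Fin 3 → ℝ) :
    |pairing (resonance Q i) w| ≤ 2 * Q i * ‖w‖ := by
  have key : ∀ (k : Fin 3) (b : ℕ), |(Q i : ℝ) * w k - parityNum Q b i * w 2| ≤ 2 * Q i * ‖w‖ := by
    intro k b
    have h1 : |w k| ≤ ‖w‖ := norm_le_pi_norm w k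
    have h2 : |w 2| ≤ ‖w‖ := norm_le_pi_norm w 2
    have h3 := hQ.parityNum_le b i
    have h4 : (0 : ℝ) ≤ parityNum Q b i := Nat.cast_nonneg _
    refine (abs_sub _ _).trans ?_
    rw [abs_mul, abs_mul, abs_of_nonneg h4, abs_of_pos (hQ.cast_pos i)]
    have h5 := mul_le_mul h3 h2 (abs_nonneg _) (hQ.cast_pos i).le
    have h6 := mul_le_mul_of_nonneg_left h1 (hQ.cast_pos i).le
    linarith
  rcases Nat.mod_two_eq_zero_or_one i with hi | hi
  · rw [pairing_even hi]
    exact key 0 0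
  · rw [pairing_odd hi]
    exact key 1 1

end IsFrequencySeq

open Torus in
/-- A series of functions of the resonant phases. -/
noncomputable def phaseSeries (Q : ℕ → ℕ) (c : ℕ → ℝ) (φ : ℕ → UnitAddCircle → ℝ)
    (p : Torus 3) : ℝ := ∑' i, c i * φ i (phase (resonance Q i) p)

theorem continuous_phaseSeries {Q : ℕ → ℕ} {c u : ℕ → ℝ} {φ : ℕ → UnitAddCircle → ℝ}
    (hφ : ∀ i, Continuous (φ i)) (hu : Summable u) (h : ∀ i θ, |c i * φ i θ| ≤ u i) :
    Continuous (phaseSeries Q c φ) :=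
  continuous_tsum (fun i => continuous_const.mul ((hφ i).comp (Torus.continuous_phase _))) hu
    fun i _ => h i _

open Torus in
/-- A series of functions of the phases can be integrated term by term along the linear flow. -/
theorem travelTime_phaseSeries {Q : ℕ → ℕ} {c u : ℕ → ℝ} {φ : ℕ → UnitAddCircle → ℝ}
    (hφ : ∀ i, Continuous (φ i)) (hu : Summable u) (h : ∀ i θ, |c i * φ i θ| ≤ u i)
    (v : Fin 3 → ℝ) (p : Torus 3) (s : ℝ) :
    travelTime v (phaseSeries Q c φ) p s = ∑' i, c i * ∫ τ in (0 : ℝ)..s,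
      φ i (phase (resonance Q i) p + ((τ * pairing (resonance Q i) v : ℝ) : UnitAddCircle)) := by
  have hc : ∀ i, Continuous fun τ : ℝ => φ i (phase (resonance Q i) p +
      ((τ * pairing (resonance Q i) v : ℝ) : UnitAddCircle)) := fun i =>
    (hφ i).comp (continuous_const.add
      ((AddCircle.continuous_mk' 1).comp (continuous_id.mul continuous_const)))
  have h1 := intervalIntegral.hasSum_integral_of_dominated_convergence (μ := volume) (a := 0)
    (b := s) (F := fun i τ => c i * φ i (phase (resonance Q i) p +
      ((τ * pairing (resonance Q i) v : ℝ) : UnitAddCircle)))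
    (f := fun τ => phaseSeries Q c φ (p + proj (τ • v))) (fun i _ => u i)
    (fun i => (continuous_const.mul (hc i)).aestronglyMeasurable)
    (fun i => ae_of_all _ fun τ _ => h i _) (ae_of_all _ fun τ _ => hu)
    intervalIntegrable_const (ae_of_all _ fun τ _ => ?_)
  · rw [travelTime, ← h1.tsum_eq]
    simp only [intervalIntegral.integral_const_mul]
  · simp only [phaseSeries, phase_add_proj_smul]
    exact (Summable.of_norm_bounded hu fun i => h i _).hasSum

namespace IsAdapted

open Torus

variable {F : ℕ → Profile} {M : ℕ → ℝ} {Q : ℕ → ℕ} (hQ : IsAdapted F M Q)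
include hQ

theorem abs_toFun_le (i : ℕ) (x : ℝ) : |(F i).toFun x| ≤ M i := by
  simpa using (hQ.bound i x).2.2.2 0 (by omega)

theorem abs_deriv_le (i : ℕ) (x : ℝ) : |deriv (F i).toFun x| ≤ M i := by
  simpa using (hQ.bound i x).2.2.2 1 (by omega)

theorem abs_deriv_deriv_le (i : ℕ) (x : ℝ) : |deriv (deriv (F i).toFun) x| ≤ M i := by
  have := (hQ.bound i x).2.2.2 2 (by omega)
  rwa [iteratedDeriv_succ, iteratedDeriv_one] at this

theorem bound_nonneg (i : ℕ) : 0 ≤ M i := (abs_nonneg _).trans (hQ.abs_toFun_le i 0)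

theorem amp_mul_bound_le (i : ℕ) : amp Q i * (M i * Q i) ≤ amp Q i * (Q i : ℝ) ^ 2 := by
  have h1 := IsFrequencySeq.amp_pos Q i
  have h2 := hQ.const_le i
  have h3 := hQ.cast_pos i
  rw [sq]
  gcongr

theorem amp_mul_bound_le' (i : ℕ) : amp Q i * M i ≤ amp Q i * (Q i : ℝ) ^ 2 := by
  refine le_trans ?_ (hQ.amp_mul_bound_le i)
  have h1 := IsFrequencySeq.amp_pos Q i
  have h2 : 1 ≤ (Q i : ℝ) := by linarith [hQ.le_cast i]
  exact mul_le_mul_of_nonneg_left (le_mul_of_one_le_right (hQ.bound_nonneg i) h2) h1.le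

end IsAdapted

/-- The profile, as a function on the circle. -/
noncomputable def Profile.onCircle (F : Profile) : UnitAddCircle → ℝ := F.periodic.lift

/-- The derivative of the profile, as a function on the circle. -/
noncomputable def Profile.derivOnCircle (F : Profile) : UnitAddCircle → ℝ :=
  F.periodic.deriv_periodic.lift

theorem Profile.hasDerivAt_toFun (F : Profile) (x : ℝ) :
    HasDerivAt F.toFun (deriv F.toFun x) x :=
  (F.contDiff.differentiable (by simp) x).hasDerivAt

theorem Profile.hasDerivAt_deriv (F : Profile) (x : ℝ) :
    HasDerivAt (deriv F.toFun) (deriv (deriv F.toFun) x) x :=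
  (F.contDiff_deriv.differentiable (by simp) x).hasDerivAt

theorem Profile.continuous_onCircle (F : Profile) : Continuous F.onCircle :=
  F.periodic.continuous_lift F.contDiff.continuous

theorem Profile.continuous_derivOnCircle (F : Profile) : Continuous F.derivOnCircle :=
  F.periodic.deriv_periodic.continuous_lift F.contDiff_deriv.continuous

namespace IsAdapted

open Torus

variable {F : ℕ → Profile} {M : ℕ → ℝ} {Q : ℕ → ℕ} (hQ : IsAdapted F M Q)
include hQ

theorem abs_onCircle_le (i : ℕ) (θ : UnitAddCircle) : |(F i).onCircle θ| ≤ M i :=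
  (F i).periodic.abs_lift_le (hQ.abs_toFun_le i) θ

theorem abs_derivOnCircle_le (i : ℕ) (θ : UnitAddCircle) : |(F i).derivOnCircle θ| ≤ M i :=
  (F i).periodic.deriv_periodic.abs_lift_le (hQ.abs_deriv_le i) θ

theorem abs_amp_onCircle_le (i : ℕ) (θ : UnitAddCircle) :
    |amp Q i * (F i).onCircle θ| ≤ amp Q i * (Q i : ℝ) ^ 2 := by
  refine le_trans ?_ (hQ.amp_mul_bound_le' i)
  rw [abs_mul, abs_of_pos (IsFrequencySeq.amp_pos Q i)]
  exact mul_le_mul_of_nonneg_left (hQ.abs_onCircle_le i θ) (IsFrequencySeq.amp_pos Q i).le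

theorem abs_amp_derivOnCircle_le (w : Fin 3 → ℝ) (i : ℕ) (θ : UnitAddCircle) :
    |amp Q i * pairing (resonance Q i) w * (F i).derivOnCircle θ| ≤
      2 * ‖w‖ * (amp Q i * (Q i : ℝ) ^ 2) := by
  have h0 := IsFrequencySeq.amp_pos Q i
  have h1 := hQ.abs_pairing_le i w
  have h2 := hQ.abs_derivOnCircle_le i θ
  have h3 := mul_le_mul_of_nonneg_left (hQ.amp_mul_bound_le i)
    (show 0 ≤ 2 * ‖w‖ by positivity)
  refine le_trans ?_ h3
  rw [abs_mul, abs_mul, abs_of_pos h0]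
  calc amp Q i * |pairing (resonance Q i) w| * |(F i).derivOnCircle θ|
      ≤ amp Q i * (2 * Q i * ‖w‖) * M i := by gcongr
    _ = _ := by ring

/-- The time change `f = 1 + ∑ i, amp Q i * F i ⟨resonance Q i, p⟩`, which is the inverse of the
velocity of the reparametrized flow. -/
noncomputable def timeChange : C(Torus 3, ℝ) where
  toFun p := 1 + phaseSeries Q (amp Q) (fun i => (F i).onCircle) p
  continuous_toFun := continuous_const.add (continuous_phaseSeries
    (fun i => (F i).continuous_onCircle) (hQ.summable_amp_mul_sq 0) hQ.abs_amp_onCircle_le)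

/-- The derivative of the time change in the direction `w`. -/
noncomputable def timeChangeDeriv (w : Fin 3 → ℝ) : C(Torus 3, ℝ) where
  toFun := phaseSeries Q (fun i => amp Q i * pairing (resonance Q i) w)
    (fun i => (F i).derivOnCircle)
  continuous_toFun := continuous_phaseSeries
    (fun i => (F i).continuous_derivOnCircle) ((hQ.summable_amp_mul_sq 0).mul_left _)
      (hQ.abs_amp_derivOnCircle_le w)

theorem timeChange_apply (p : Torus 3) :
    hQ.timeChange p = 1 + phaseSeries Q (amp Q) (fun i => (F i).onCircle) p := rfl

theorem timeChangeDeriv_apply (w : Fin 3 → ℝ) (p : Torus 3) : hQ.timeChangeDeriv w p =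
    phaseSeries Q (fun i => amp Q i * pairing (resonance Q i) w)
      (fun i => (F i).derivOnCircle) p := rfl

theorem abs_timeChange_sub_one_le (p : Torus 3) : |hQ.timeChange p - 1| ≤ 1 / 4 := by
  rw [timeChange_apply, add_sub_cancel_left]
  have := hQ.abs_tsum_le (x := fun i => amp Q i * (F i).onCircle (phase (resonance Q i) p))
    (A := 1) (B := 0) zero_le_one le_rfl 0 fun i => by
      simpa using hQ.abs_amp_onCircle_le i _
  refine this.trans (by norm_num)

theorem three_quarters_le (p : Torus 3) : 3 / 4 ≤ hQ.timeChange p := by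
  linarith [(abs_le.1 (hQ.abs_timeChange_sub_one_le p)).1]

theorem timeChange_pos (p : Torus 3) : 0 < hQ.timeChange p := by
  linarith [hQ.three_quarters_le p]

theorem hasDerivAt_timeChange (w : Fin 3 → ℝ) (p : Torus 3) :
    HasDerivAt (fun r : ℝ => hQ.timeChange (p + proj (r • w))) (hQ.timeChangeDeriv w p) 0 := by
  have h := hasDerivAt_tsum (𝕜 := ℝ) (u := fun i => 2 * ‖w‖ * (amp Q i * (Q i : ℝ) ^ 2))
    (g := fun i r => amp Q i * (F i).onCircle (phase (resonance Q i) p +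
      ((r * pairing (resonance Q i) w : ℝ) : UnitAddCircle)))
    (g' := fun i r => amp Q i * pairing (resonance Q i) w * (F i).derivOnCircle
      (phase (resonance Q i) p + ((r * pairing (resonance Q i) w : ℝ) : UnitAddCircle)))
    (y₀ := 0)
    ((hQ.summable_amp_mul_sq 0).mul_left _) (fun i r => ?_)
    (fun i r => hQ.abs_amp_derivOnCircle_le w i _)
    (Summable.of_norm_bounded (hQ.summable_amp_mul_sq 0) fun i => hQ.abs_amp_onCircle_le i _) 0
  · simp only [zero_mul, AddCircle.coe_zero, add_zero] at h
    have h2 := h.const_add 1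
    simp only [← phase_add_proj_smul] at h2
    exact h2
  · have := (Function.Periodic.hasDerivAt_lift (F i).periodic.deriv_periodic (F i).periodic
      (F i).hasDerivAt_toFun (phase (resonance Q i) p) (pairing (resonance Q i) w) r).const_mul
        (amp Q i)
    refine this.congr_deriv ?_
    rw [Profile.derivOnCircle]
    ring

theorem abs_timeChange_sub_le (p q : Torus 3) :
    |hQ.timeChange p - hQ.timeChange q| ≤ 1 * dist p q := by
  obtain ⟨x, rfl, hx⟩ := exists_proj_eq_add p q
  rw [abs_sub_comm, one_mul]
  refine le_trans ?_ hx
  have hd : ∀ r : ℝ, HasDerivAt (fun r : ℝ => hQ.timeChange (p + proj (r • x)))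
      (hQ.timeChangeDeriv x (p + proj (r • x))) r := fun r =>
    hasDerivAt_line_of_zero (hQ.hasDerivAt_timeChange x) p r
  have hb : ∀ q, ‖hQ.timeChangeDeriv x q‖ ≤ ‖x‖ := by
    intro q
    have := hQ.abs_tsum_le (x := fun i => amp Q i * pairing (resonance Q i) x *
      (F i).derivOnCircle (phase (resonance Q i) q)) (A := 2 * ‖x‖) (B := 0) (by positivity)
      le_rfl 0 fun i => by
        have := hQ.abs_amp_derivOnCircle_le x i (phase (resonance Q i) q)
        simp only [ite_self, add_zero]
        linarith
    rw [Real.norm_eq_abs, timeChangeDeriv_apply]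
    refine this.trans ?_
    have := norm_nonneg x
    linarith
  have := convex_univ.norm_image_sub_le_of_norm_hasDerivWithin_le (𝕜 := ℝ)
    (fun r _ => (hd r).hasDerivWithinAt) (fun r _ => hb _) (Set.mem_univ 0) (Set.mem_univ 1)
  simpa [proj_zero] using this

/-- The inverse of the time change is smooth. -/
theorem isSmooth_inv_timeChange : IsSmooth fun p => (hQ.timeChange p)⁻¹ := by
  have h1 : ContDiff ℝ ∞ fun x : Fin 3 → ℝ => ∑' i, amp Q i *
      (F i).toFun (pairing (resonance Q i) x) := by
    have hlin : ∀ i, ∃ L : (Fin 3 → ℝ) →L[ℝ] ℝ, (∀ x, L x = pairing (resonance Q i) x) ∧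
        ‖L‖ ≤ 2 * Q i := by
      intro i
      refine ⟨LinearMap.mkContinuous ⟨⟨pairing (resonance Q i), pairing_add _⟩,
        fun r x => pairing_smul _ r x⟩ (2 * Q i) (fun x => hQ.abs_pairing_le i x), fun x => rfl,
        LinearMap.mkContinuous_norm_le _ (by positivity) _⟩
    choose L hL hLn using hlin
    have he : ∀ i, (fun x => amp Q i * (F i).toFun (pairing (resonance Q i) x)) =
        fun x => amp Q i • ((F i).toFun ∘ L i) x := by
      intro i
      ext x
      simp [hL]
    refine contDiff_tsum_of_eventually (N := ⊤)
      (v := fun k i => 2 ^ k * (amp Q i * (Q i : ℝ) ^ (k + 1))) (fun i => ?_) (fun k _ => ?_)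
      (fun k _ => ?_)
    · rw [he]
      exact ((F i).contDiff.comp (L i).contDiff).const_smul (amp Q i)
    · refine Summable.mul_left (a := (2 : ℝ) ^ k) (Summable.of_nonneg_of_le (fun i => ?_)
        (fun i => hQ.amp_mul_pow_le i (k + 1)) ?_)
      · exact mul_nonneg (IsFrequencySeq.amp_pos Q i).le (by positivity)
      · have hs : Summable fun i => 1 / (Q i : ℝ) :=
          Summable.of_nonneg_of_le (fun i => by positivity) (hQ.one_div_le 0)
            (summable_geometric_two.mul_left _)
        simpa [div_eq_mul_inv] using hs.mul_left ((k + 1 + 1).factorial : ℝ)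
    · rw [Nat.cofinite_eq_atTop]
      filter_upwards [eventually_ge_atTop k] with i hi x
      have hcd : ContDiff ℝ k ((F i).toFun ∘ L i) :=
        ((F i).contDiff.comp (L i).contDiff).of_le (by exact_mod_cast le_top)
      have h0 := IsFrequencySeq.amp_pos Q i
      have hsm := iteratedFDeriv_const_smul_apply' (𝕜 := ℝ) (R := ℝ) (F := ℝ) (a := amp Q i)
        (f := (F i).toFun ∘ L i) (x := x) hcd.contDiffAt
      rw [he, hsm, norm_smul, Real.norm_eq_abs,
        abs_of_pos h0, (L i).iteratedFDeriv_comp_right (F i).contDiff x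
          (by exact_mod_cast le_top)]
      have h2 := ContinuousMultilinearMap.norm_compContinuousLinearMap_le
        (iteratedFDeriv ℝ k (F i).toFun (L i x)) fun _ => L i
      rw [norm_iteratedFDeriv_eq_norm_iteratedDeriv, Finset.prod_const, Finset.card_univ,
        Fintype.card_fin, Real.norm_eq_abs] at h2
      have h3 := (hQ.bound i (L i x)).2.2.2 k (by omega)
      have h4 := hQ.const_le i
      have h5 : ‖L i‖ ^ k ≤ (2 * Q i) ^ k := pow_le_pow_left₀ (norm_nonneg _) (hLn i) k
      calc amp Q i * _ ≤ amp Q i * (Q i * (2 * Q i) ^ k) := by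
            refine mul_le_mul_of_nonneg_left (h2.trans ?_) h0.le
            exact mul_le_mul (h3.trans h4) h5 (by positivity) (Nat.cast_nonneg _)
        _ = _ := by ring
  have h2 : (fun x : Fin 3 → ℝ => (hQ.timeChange (proj x))⁻¹) = fun x =>
      (1 + ∑' i, amp Q i * (F i).toFun (pairing (resonance Q i) x))⁻¹ := by
    ext x
    rw [timeChange_apply, phaseSeries]
    simp only [phase_proj]
    rfl
  rw [IsSmooth, h2]
  refine (contDiff_const.add h1).inv fun x => ?_
  have := congrFun h2 x
  simp only [inv_inj] at this
  rw [← this]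
  exact (hQ.timeChange_pos _).ne'

end IsAdapted

/-! ### Averages along the linear flow -/

namespace Function.Periodic

variable {g G : ℝ → ℝ} (hg : Function.Periodic g 1) (hG : Function.Periodic G 1)

include hG in
theorem abs_integral_lift_le (h : ∀ x, HasDerivAt G (g x) x) (hc : Continuous g) {C : ℝ}
    (hC : ∀ x, |G x| ≤ C) (θ : UnitAddCircle) {ε : ℝ} (hε : 0 < ε) (s : ℝ) :
    |∫ u in (0 : ℝ)..s, hg.lift (θ + ((u * ε : ℝ) : UnitAddCircle))| ≤ 2 * C / ε := by
  rw [integral_lift hg hG h hc θ hε.ne', abs_div, abs_of_pos hε]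
  refine div_le_div_of_nonneg_right ((abs_sub _ _).trans ?_) hε.le
  linarith [hG.abs_lift_le hC (θ + ((s * ε : ℝ) : UnitAddCircle)), hG.abs_lift_le hC θ]

theorem abs_integral_lift_le_mul {C : ℝ} (hC : ∀ x, |g x| ≤ C) (θ : UnitAddCircle) (ε s : ℝ) :
    |∫ u in (0 : ℝ)..s, hg.lift (θ + ((u * ε : ℝ) : UnitAddCircle))| ≤ C * |s| := by
  have := intervalIntegral.norm_integral_le_of_norm_le_const (a := 0) (b := s) (C := C)
    (f := fun u : ℝ => hg.lift (θ + ((u * ε : ℝ) : UnitAddCircle)))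
    (fun u _ => hg.abs_lift_le hC _)
  rwa [sub_zero] at this

/-- Along a slow rotation of speed `ε`, the integral is close to that of the initial value. -/
theorem abs_integral_lift_sub_le (h : ∀ x, HasDerivAt G (g x) x) {C : ℝ} (hC : ∀ x, |g x| ≤ C)
    (hC0 : 0 ≤ C) (θ : UnitAddCircle) {ε : ℝ} (hε : 0 ≤ ε) (s : ℝ) :
    |(∫ u in (0 : ℝ)..s, hG.lift (θ + ((u * ε : ℝ) : UnitAddCircle))) - s * hG.lift θ| ≤
      C * ε * |s| ^ 2 := by
  have hGc : Continuous G := continuous_iff_continuousAt.2 fun x => (h x).continuousAt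
  have hcont : Continuous fun u : ℝ => hG.lift (θ + ((u * ε : ℝ) : UnitAddCircle)) :=
    (hG.continuous_lift hGc).comp (continuous_const.add
      ((AddCircle.continuous_mk' 1).comp (continuous_id.mul continuous_const)))
  have e : (∫ u in (0 : ℝ)..s, hG.lift (θ + ((u * ε : ℝ) : UnitAddCircle))) - s * hG.lift θ =
      ∫ u in (0 : ℝ)..s, (hG.lift (θ + ((u * ε : ℝ) : UnitAddCircle)) - hG.lift θ) := by
    rw [intervalIntegral.integral_sub (hcont.intervalIntegrable _ _) intervalIntegrable_const]
    simp
  rw [e]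
  have := intervalIntegral.norm_integral_le_of_norm_le_const (a := 0) (b := s) (C := C * (|s| * ε))
    (f := fun u : ℝ => hG.lift (θ + ((u * ε : ℝ) : UnitAddCircle)) - hG.lift θ) fun u hu => by
      refine (abs_lift_add_sub_le hG h hC θ (u * ε)).trans
        (mul_le_mul_of_nonneg_left ?_ hC0)
      rw [abs_mul, abs_of_nonneg hε]
      refine mul_le_mul_of_nonneg_right ?_ hε
      rcases Set.mem_uIoc.1 hu with ⟨h1, h2⟩ | ⟨h1, h2⟩
      · rw [abs_of_pos h1]
        exact h2.trans (le_abs_self s)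
      · rw [abs_of_nonpos h2, abs_of_neg (h1.trans_le h2)]
        linarith
  rw [sub_zero, Real.norm_eq_abs] at this
  refine this.trans (le_of_eq ?_)
  ring

end Function.Periodic

namespace IsFrequencySeq

open Torus (pairing)

variable {M : ℕ → ℝ} {Q : ℕ → ℕ} (hQ : IsFrequencySeq M Q)

theorem pairing_single_mod (i n : ℕ) (r : ℝ) :
    pairing (resonance Q i) (if n % 2 = 0 then ![r, 0, 0] else ![0, r, 0]) =
      if i % 2 = n % 2 then Q i * r else 0 := by
  rcases Nat.mod_two_eq_zero_or_one i with hi | hi <;>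
    rcases Nat.mod_two_eq_zero_or_one n with hn | hn
  · simp [pairing_even hi, hi, hn]
  · simp [pairing_even hi, hi, hn]
  · simp [pairing_odd hi, hi, hn]
  · simp [pairing_odd hi, hi, hn]

include hQ

theorem cast_le_cast {i n : ℕ} (h : i ≤ n) : (Q i : ℝ) ≤ Q n := by
  exact_mod_cast hQ.strictMono.monotone h

/-- Up to a time of order `Q n`, the resonances of index at most `n - 2` complete a period. -/
theorem one_div_pairing_le {i n : ℕ} (h : i + 2 ≤ n) :
    1 / pairing (resonance Q i) (liouvilleVec Q) ≤ Q n / Q i := by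
  rw [← one_div_div (Q i : ℝ)]
  refine one_div_le_one_div_of_le (div_pos (hQ.cast_pos i) (hQ.cast_pos n))
    (le_trans ?_ (hQ.le_pairing_resonance i))
  exact div_le_div_of_nonneg_left (hQ.cast_pos i).le (hQ.cast_pos _) (hQ.cast_le_cast h)

end IsFrequencySeq

/-- The direction in which the shear created by the `n`-th resonance is observed. The `n`-th
resonant phase has derivative `1` in this direction, and those of the other parity do not depend on it. -/
noncomputable def shearDir (Q : ℕ → ℕ) (n : ℕ) : Fin 3 → ℝ :=
  if n % 2 = 0 then ![1 / (Q n : ℝ), 0, 0] else ![0, 1 / (Q n : ℝ), 0]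

namespace IsAdapted

open Torus

variable {F : ℕ → Profile} {M : ℕ → ℝ} {Q : ℕ → ℕ} (hQ : IsAdapted F M Q)
include hQ

omit hQ in
theorem pairing_shearDir (i n : ℕ) :
    pairing (resonance Q i) (shearDir Q n) = if i % 2 = n % 2 then (Q i : ℝ) / Q n else 0 := by
  rw [shearDir, IsFrequencySeq.pairing_single_mod, mul_one_div]

theorem pairing_shearDir_self (n : ℕ) : pairing (resonance Q n) (shearDir Q n) = 1 := by
  rw [pairing_shearDir, if_pos rfl, div_self (hQ.cast_pos n).ne']

theorem abs_pairing_shearDir_le (m : Fin 3 → ℤ) (n : ℕ) :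
    |pairing m (shearDir Q n)| ≤ |(m 0 : ℝ)| + |(m 1 : ℝ)| := by
  have h1 : |(Q n : ℝ)⁻¹| ≤ 1 := by
    rw [abs_of_pos (inv_pos.2 (hQ.cast_pos n))]
    exact inv_le_one_of_one_le₀ (by linarith [hQ.le_cast n])
  unfold shearDir
  split_ifs
  · simp only [pairing, Fin.sum_univ_three, Matrix.cons_val_zero, Matrix.cons_val_one,
      Matrix.cons_val, mul_zero, add_zero, abs_mul, one_div]
    linarith [mul_le_of_le_one_right (abs_nonneg (m 0 : ℝ)) h1, abs_nonneg (m 1 : ℝ)]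
  · simp only [pairing, Fin.sum_univ_three, Matrix.cons_val_zero, Matrix.cons_val_one,
      Matrix.cons_val, mul_zero, add_zero, zero_add, abs_mul, one_div]
    linarith [mul_le_of_le_one_right (abs_nonneg (m 1 : ℝ)) h1, abs_nonneg (m 0 : ℝ)]

theorem travelTime_timeChange (v : Fin 3 → ℝ) (p : Torus 3) (s : ℝ) :
    travelTime v hQ.timeChange p s = s + ∑' i, amp Q i * ∫ τ in (0 : ℝ)..s,
      (F i).onCircle (phase (resonance Q i) p +
        ((τ * pairing (resonance Q i) v : ℝ) : UnitAddCircle)) := by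
  rw [← travelTime_phaseSeries (fun i => (F i).continuous_onCircle) (hQ.summable_amp_mul_sq 0)
    hQ.abs_amp_onCircle_le]
  have hc : Continuous fun u : ℝ => phaseSeries Q (amp Q) (fun i => (F i).onCircle)
      (p + proj (u • v)) := by
    have := continuous_along v hQ.timeChange p
    exact (this.sub (continuous_const (y := (1 : ℝ)))).congr fun u => by simp [timeChange_apply]
  simp only [travelTime, timeChange_apply]
  rw [intervalIntegral.integral_add intervalIntegrable_const (hc.intervalIntegrable _ _)]
  simp

/-- Up to the time scale of the `m + 1`-st resonance, the time change averages out. -/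
theorem abs_travelTime_sub_self_le (m : ℕ) (p : Torus 3) (s : ℝ) :
    |travelTime (liouvilleVec Q) hQ.timeChange p s - s| ≤
      Q (m + 1) / 2 + 2 * |s| * (amp Q m * (Q m : ℝ) ^ 2) := by
  rw [travelTime_timeChange, add_sub_cancel_left]
  have := hQ.abs_tsum_le (x := fun i => amp Q i * ∫ τ in (0 : ℝ)..s,
      (F i).onCircle (phase (resonance Q i) p +
        ((τ * pairing (resonance Q i) (liouvilleVec Q) : ℝ) : UnitAddCircle)))
    (A := 2 * Q (m + 1)) (B := |s|) (by positivity) (abs_nonneg s) m fun i => by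
      have ha := IsFrequencySeq.amp_pos Q i
      have hb := hQ.amp_mul_bound_le' i
      rw [abs_mul, abs_of_pos ha]
      split_ifs with hi
      · have h1 := (F i).periodic.abs_integral_lift_le_mul (hQ.abs_toFun_le i)
          (phase (resonance Q i) p) (pairing (resonance Q i) (liouvilleVec Q)) s
        calc amp Q i * _ ≤ amp Q i * (M i * |s|) := mul_le_mul_of_nonneg_left h1 ha.le
          _ = amp Q i * M i * |s| := by ring
          _ ≤ amp Q i * (Q i : ℝ) ^ 2 * |s| := by gcongr
          _ ≤ _ := by
            have := IsFrequencySeq.amp_mul_sq_nonneg Q i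
            refine mul_le_mul_of_nonneg_left ?_ this
            linarith [Nat.cast_nonneg (α := ℝ) (Q (m + 1))]
      · have h1 := Function.Periodic.abs_integral_lift_le (F i).periodic (F i).primitive_periodic
          (F i).hasDerivAt_primitive (F i).contDiff.continuous (fun x => (hQ.bound i x).1)
          (phase (resonance Q i) p) (hQ.pairing_resonance_pos i) s
        have h2 := hQ.one_div_pairing_le (i := i) (n := m + 1) (by omega)
        have h3 := hQ.bound_nonneg i
        have h4 := hQ.const_le i
        have hq := hQ.cast_pos i
        calc amp Q i * _ ≤ amp Q i * (2 * M i / pairing (resonance Q i) (liouvilleVec Q)) :=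
              mul_le_mul_of_nonneg_left h1 ha.le
          _ = amp Q i * (2 * M i * (1 / pairing (resonance Q i) (liouvilleVec Q))) := by ring
          _ ≤ amp Q i * (2 * M i * (Q (m + 1) / Q i)) := by gcongr
          _ ≤ amp Q i * (2 * Q i * (Q (m + 1) / Q i)) := by gcongr
          _ = amp Q i * 1 * (2 * Q (m + 1) + 0) := by field_simp; ring
          _ ≤ _ := by
            have : (1 : ℝ) ≤ (Q i : ℝ) ^ 2 := one_le_pow₀ (by linarith [hQ.le_cast i])
            gcongr
  refine this.trans (le_of_eq ?_)
  ring

/-- The derivative of the travel time in the direction `shearDir Q n` is dominated by the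
contribution of the `n`-th resonance. -/
theorem abs_travelTime_timeChangeDeriv_sub_le (n : ℕ) (p : Torus 3) (s : ℝ) :
    |travelTime (liouvilleVec Q) (hQ.timeChangeDeriv (shearDir Q n)) p s -
      amp Q n * ∫ τ in (0 : ℝ)..s, (F n).derivOnCircle (phase (resonance Q n) p +
        ((τ * pairing (resonance Q n) (liouvilleVec Q) : ℝ) : UnitAddCircle))| ≤
      1 / 2 + 2 * |s| * (amp Q (n + 1) * (Q (n + 1) : ℝ) ^ 2) := by
  set w := shearDir Q n with hw
  set J : ℕ → ℝ := fun i => ∫ τ in (0 : ℝ)..s, (F i).derivOnCircle (phase (resonance Q i) p +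
        ((τ * pairing (resonance Q i) (liouvilleVec Q) : ℝ) : UnitAddCircle)) with hJ
  have hJ1 : ∀ i, |J i| ≤ M i * |s| := fun i =>
    (F i).periodic.deriv_periodic.abs_integral_lift_le_mul (hQ.abs_deriv_le i) _ _ s
  have hJ2 : ∀ i, |J i| ≤ 2 * M i / pairing (resonance Q i) (liouvilleVec Q) := fun i =>
    Function.Periodic.abs_integral_lift_le (F i).periodic.deriv_periodic (F i).periodic
      (F i).hasDerivAt_toFun (F i).contDiff_deriv.continuous (hQ.abs_toFun_le i) _
      (hQ.pairing_resonance_pos i) s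
  have hsum : travelTime (liouvilleVec Q) (hQ.timeChangeDeriv w) p s =
      ∑' i, amp Q i * pairing (resonance Q i) w * J i :=
    travelTime_phaseSeries (fun i => (F i).continuous_derivOnCircle)
      ((hQ.summable_amp_mul_sq 0).mul_left _) (hQ.abs_amp_derivOnCircle_le w) _ p s
  have hS : Summable fun i => amp Q i * pairing (resonance Q i) w * J i := by
    refine Summable.of_norm_bounded ((hQ.summable_amp_mul_sq 0).mul_left (2 * ‖w‖ * |s|))
      fun i => ?_
    have h1 := hQ.abs_pairing_le i w
    have h2 := IsFrequencySeq.amp_pos Q i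
    rw [Real.norm_eq_abs, abs_mul, abs_mul, abs_of_pos h2, add_zero]
    calc amp Q i * |pairing (resonance Q i) w| * |J i|
        ≤ amp Q i * (2 * Q i * ‖w‖) * (M i * |s|) := by
          have := hJ1 i
          gcongr
      _ = 2 * ‖w‖ * |s| * (amp Q i * (M i * Q i)) := by ring
      _ ≤ _ := mul_le_mul_of_nonneg_left (hQ.amp_mul_bound_le i) (by positivity)
  rw [hsum, hS.tsum_eq_add_tsum_ite n, hw, hQ.pairing_shearDir_self, mul_one,
    add_sub_cancel_left, ← hw]
  have := hQ.abs_tsum_le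
    (x := fun i => if i = n then 0 else amp Q i * pairing (resonance Q i) w * J i)
    (A := 2) (B := |s|) (by positivity) (abs_nonneg s) (n + 1) fun i => by
      have ha := IsFrequencySeq.amp_pos Q i
      have h0 := IsFrequencySeq.amp_mul_sq_nonneg Q i
      have hq := hQ.cast_pos i
      have hqn := hQ.cast_pos n
      have hM := hQ.bound_nonneg i
      have hrhs : 0 ≤ amp Q i * (Q i : ℝ) ^ 2 * (2 + if n + 1 ≤ i then |s| else 0) := by
        refine mul_nonneg h0 ?_
        split_ifs
        · positivity
        · norm_num
      rcases eq_or_ne i n with hin | hin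
      · rw [if_pos hin, abs_zero]
        exact hrhs
      rw [if_neg hin, hw, pairing_shearDir]
      rcases eq_or_ne (i % 2) (n % 2) with hmod | hmod
      swap
      · rw [if_neg hmod, mul_zero, zero_mul, abs_zero]
        exact hrhs
      rw [if_pos hmod, abs_mul, abs_of_pos (by positivity)]
      split_ifs with hi
      · have h3 : 1 ≤ (Q n : ℝ) := by linarith [hQ.le_cast n]
        calc amp Q i * (Q i / Q n) * |J i| ≤ amp Q i * (Q i / 1) * (M i * |s|) := by
              have := hJ1 i
              gcongr
          _ = amp Q i * (M i * Q i) * |s| := by ring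
          _ ≤ amp Q i * (Q i : ℝ) ^ 2 * |s| :=
              mul_le_mul_of_nonneg_right (hQ.amp_mul_bound_le i) (abs_nonneg s)
          _ ≤ _ := mul_le_mul_of_nonneg_left (by linarith) h0
      · have h2 := hQ.one_div_pairing_le (i := i) (n := n) (by omega)
        have hb := hQ.amp_mul_bound_le' i
        calc amp Q i * (Q i / Q n) * |J i|
            ≤ amp Q i * (Q i / Q n) * (2 * M i / pairing (resonance Q i) (liouvilleVec Q)) :=
              mul_le_mul_of_nonneg_left (hJ2 i) (by positivity)
          _ = amp Q i * (Q i / Q n) *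
              (2 * M i * (1 / pairing (resonance Q i) (liouvilleVec Q))) := by ring
          _ ≤ amp Q i * (Q i / Q n) * (2 * M i * (Q n / Q i)) := by gcongr
          _ = amp Q i * M i * (2 + 0) := by field_simp; ring
          _ ≤ _ := mul_le_mul_of_nonneg_right hb (by norm_num)
  refine this.trans (le_of_eq ?_)
  ring

end IsAdapted

/-! ### Mixing of the reparametrized flow -/

namespace Torus

variable {d : ℕ}

theorem surjective_phase {m : Fin d → ℤ} (hm : m ≠ 0) : Function.Surjective (phase m) := by
  obtain ⟨k, hk⟩ := Function.ne_iff.1 hm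
  have hk' : (m k : ℝ) ≠ 0 := by exact_mod_cast hk
  intro θ
  obtain ⟨y, rfl⟩ := QuotientAddGroup.mk_surjective θ
  refine ⟨proj (Pi.single k (y / m k)), ?_⟩
  rw [phase_proj, pairing]
  have : ∑ i, (m i : ℝ) * (Pi.single k (y / m k) : Fin d → ℝ) i = y := by
    rw [Finset.sum_eq_single k (fun i _ hi => by simp [hi]) (by simp)]
    simp [mul_div_cancel₀ y hk']
  rw [this]

theorem measurePreserving_phase {m : Fin d → ℤ} (hm : m ≠ 0) :
    MeasurePreserving (phase m) volume volume :=
  AddMonoidHom.measurePreserving (continuous_phase m) (surjective_phase hm) (by simp)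

theorem integral_comp_phase {m : Fin d → ℤ} (hm : m ≠ 0) {g : UnitAddCircle → ℝ}
    (hg : Continuous g) : ∫ p, g (phase m p) = ∫ x in (0 : ℝ)..1, g x := by
  have h := measurePreserving_phase hm
  have h1 := integral_map (μ := volume) h.measurable.aemeasurable (f := g) hg.aestronglyMeasurable
  rw [h.map_eq] at h1
  rw [← h1, ← UnitAddCircle.intervalIntegral_preimage 0, zero_add]

end Torus

theorem tendsto_zero_of_norm_le_on_intervals {E : Type*} [SeminormedAddCommGroup E] {G : ℝ → E}
    {τ e : ℕ → ℝ} (hτ : Monotone τ) (hτ' : Tendsto τ atTop atTop) (he : Tendsto e atTop (𝓝 0))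
    (h : ∀ n t, τ n ≤ t → t ≤ τ (n + 1) → ‖G t‖ ≤ e n) : Tendsto G atTop (𝓝 0) := by
  rw [Metric.tendsto_nhds]
  intro δ hδ
  obtain ⟨J, hJ⟩ := eventually_atTop.1 (he.eventually (gt_mem_nhds hδ))
  filter_upwards [eventually_ge_atTop (τ J)] with t ht
  have hex : ∃ n, t < τ n := (hτ'.eventually (eventually_gt_atTop t)).exists
  classical
  obtain ⟨hn1, hn2⟩ := And.intro (Nat.find_spec hex) (fun k => Nat.find_min hex (m := k))
  set n := Nat.find hex with hn
  have hJn : J < n := by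
    by_contra hcon
    exact absurd (hτ (not_lt.1 hcon)) (not_le.2 (ht.trans_lt hn1))
  have h1 := hn2 (n - 1) (by omega)
  rw [dist_zero_right]
  refine (h (n - 1) t (not_lt.1 h1) ?_).trans_lt (hJ (n - 1) (by omega))
  rw [show n - 1 + 1 = n by omega]
  exact hn1.le

/-- The weight of the profile, as a function on the circle. -/
noncomputable def Profile.weightOnCircle (F : Profile) : UnitAddCircle → ℝ :=
  F.weight_periodic.lift

/-- The derivative of the weight of the profile, as a function on the circle. -/
noncomputable def Profile.derivWeightOnCircle (F : Profile) : UnitAddCircle → ℝ :=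
  F.weight_periodic.deriv_periodic.lift

theorem Profile.hasDerivAt_weight (F : Profile) (x : ℝ) :
    HasDerivAt F.weight (deriv F.weight x) x :=
  (F.contDiff_weight.differentiable (by simp) x).hasDerivAt

theorem Profile.continuous_weightOnCircle (F : Profile) : Continuous F.weightOnCircle :=
  F.weight_periodic.continuous_lift F.contDiff_weight.continuous

theorem Profile.continuous_derivWeightOnCircle (F : Profile) : Continuous F.derivWeightOnCircle :=
  F.weight_periodic.deriv_periodic.continuous_lift
    (contDiff_infty_iff_deriv.1 F.contDiff_weight).2.continuous

namespace IsAdapted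

open Torus

variable {F : ℕ → Profile} {M : ℕ → ℝ} {Q : ℕ → ℕ} (hQ : IsAdapted F M Q)
include hQ

omit hQ in
theorem hasDerivAt_weight_phase (m : Fin 3 → ℤ) {w : Fin 3 → ℝ} (hw : pairing m w = 1) (i : ℕ)
    (p : Torus 3) : HasDerivAt (fun r : ℝ => (F i).weightOnCircle (phase m (p + proj (r • w))))
      ((F i).derivWeightOnCircle (phase m p)) 0 := by
  have := Function.Periodic.hasDerivAt_lift (F i).weight_periodic.deriv_periodic
    (F i).weight_periodic (F i).hasDerivAt_weight (phase m p) 1 0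
  simp only [AddCircle.coe_zero, add_zero, mul_one] at this
  simp only [phase_add_proj_smul, hw, mul_one]
  exact this

/-- The velocity of the flow is at most `4 / 3`. -/
theorem abs_displacement_le {t : ℝ} (ht : 0 ≤ t) (p : Torus 3) :
    |displacement (liouvilleVec Q) hQ.timeChange t p| ≤ 2 * t := by
  have h := abs_le_travelTime_sub (v := liouvilleVec Q) hQ.three_quarters_le p 0
    (displacement (liouvilleVec Q) hQ.timeChange t p)
  rw [travelTime_displacement hQ.timeChange_pos, travelTime_zero, sub_zero, sub_zero,
    abs_of_nonneg ht] at h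
  linarith

/-- The error in the approximation of the shear by its main term. -/
theorem abs_shear_sub_le (m : ℕ) {t : ℝ} (ht : 0 ≤ t) (p : Torus 3) :
    |travelTime (liouvilleVec Q) (hQ.timeChangeDeriv (shearDir Q (m + 1))) p
        (displacement (liouvilleVec Q) hQ.timeChange t p) -
      t * amp Q (m + 1) * (F (m + 1)).derivOnCircle (phase (resonance Q (m + 1)) p)| ≤
    1 / 2 + 4 * t * (amp Q (m + 2) * (Q (m + 2) : ℝ) ^ 2) + amp Q (m + 1) * (M (m + 1) *
      (8 * t ^ 2 * Q (m + 1) / Q (m + 3) + Q (m + 1) / 2 + 4 * t * (amp Q m * (Q m : ℝ) ^ 2))) := by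
  set s := displacement (liouvilleVec Q) hQ.timeChange t p with hs
  set θ := phase (resonance Q (m + 1)) p with hθ
  set ε := pairing (resonance Q (m + 1)) (liouvilleVec Q) with hε
  have hst : |s| ≤ 2 * t := hQ.abs_displacement_le ht p
  have ha := IsFrequencySeq.amp_pos Q (m + 1)
  have hM := hQ.bound_nonneg (m + 1)
  have h1 := hQ.abs_travelTime_timeChangeDeriv_sub_le (m + 1) p s
  have h2 := hQ.abs_travelTime_sub_self_le m p s
  rw [hs, travelTime_displacement hQ.timeChange_pos, ← hs] at h2
  have h3 : |(∫ u in (0 : ℝ)..s, (F (m + 1)).derivOnCircle (θ + ((u * ε : ℝ) : UnitAddCircle))) -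
      s * (F (m + 1)).derivOnCircle θ| ≤ M (m + 1) * ε * |s| ^ 2 :=
    Function.Periodic.abs_integral_lift_sub_le (F (m + 1)).periodic.deriv_periodic
      (F (m + 1)).hasDerivAt_deriv (hQ.abs_deriv_deriv_le (m + 1)) hM θ
      (hQ.pairing_resonance_pos (m + 1)).le s
  have h4 : ε ≤ 2 * Q (m + 1) / Q (m + 3) := hQ.pairing_resonance_le (m + 1)
  have h5 := hQ.abs_derivOnCircle_le (m + 1) θ
  set I := ∫ u in (0 : ℝ)..s, (F (m + 1)).derivOnCircle (θ + ((u * ε : ℝ) : UnitAddCircle)) with hI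
  set h := (F (m + 1)).derivOnCircle θ with hh
  have hε0 : 0 ≤ ε := (hQ.pairing_resonance_pos (m + 1)).le
  have h6 : |I - t * h| ≤ M (m + 1) * (8 * t ^ 2 * Q (m + 1) / Q (m + 3) + Q (m + 1) / 2 +
      4 * t * (amp Q m * (Q m : ℝ) ^ 2)) := by
    have e : I - t * h = (I - s * h) - (t - s) * h := by ring
    rw [e]
    refine (abs_sub _ _).trans ?_
    rw [abs_mul (t - s)]
    have h7 : M (m + 1) * ε * |s| ^ 2 ≤ M (m + 1) * (2 * Q (m + 1) / Q (m + 3)) * (2 * t) ^ 2 := by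
      gcongr
    have h8 : |t - s| * |h| ≤ (Q (m + 1) / 2 + 2 * (2 * t) * (amp Q m * (Q m : ℝ) ^ 2)) *
        M (m + 1) := by
      refine mul_le_mul (h2.trans ?_) h5 (abs_nonneg _) ?_
      · have := IsFrequencySeq.amp_mul_sq_nonneg Q m
        gcongr
      · have := IsFrequencySeq.amp_mul_sq_nonneg Q m
        positivity
    refine (add_le_add (h3.trans h7) h8).trans (le_of_eq ?_)
    ring
  have h9 := mul_le_mul_of_nonneg_left h6 ha.le
  have h10 : |amp Q (m + 1) * (I - t * h)| ≤ _ := (abs_mul _ _).trans_le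
    ((congrArg (· * |I - t * h|) (abs_of_pos ha)).trans_le h9)
  have h11 := IsFrequencySeq.amp_mul_sq_nonneg Q (m + 2)
  have h12 : 2 * |s| * (amp Q (m + 2) * (Q (m + 2) : ℝ) ^ 2) ≤
      2 * (2 * t) * (amp Q (m + 2) * (Q (m + 2) : ℝ) ^ 2) := by gcongr
  have e : travelTime (liouvilleVec Q) (hQ.timeChangeDeriv (shearDir Q (m + 1))) p s -
      t * amp Q (m + 1) * h = (travelTime (liouvilleVec Q)
        (hQ.timeChangeDeriv (shearDir Q (m + 1))) p s - amp Q (m + 1) * I) +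
        amp Q (m + 1) * (I - t * h) := by ring
  rw [e]
  refine (abs_add_le _ _).trans ?_
  linarith

/-- On the time scale of the `m + 1`-st resonance, the shear is large. -/
theorem sq_le_mul_amp (n : ℕ) {t : ℝ} (ht : Real.exp ((Q n : ℝ) ^ 4) ≤ t) :
    (Q n : ℝ) ^ 2 ≤ t * amp Q n := by
  have hq := hQ.le_cast n
  have ha := IsFrequencySeq.amp_pos Q n
  have h1 : (Q n : ℝ) ^ 2 ≤ (Q n : ℝ) ^ 4 + -(Q n : ℝ) ^ 3 := by
    have h0 : 0 ≤ (Q n : ℝ) ^ 2 * ((Q n : ℝ) * (Q n - 1) - 1) :=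
      mul_nonneg (sq_nonneg _) (by nlinarith)
    nlinarith
  calc (Q n : ℝ) ^ 2 ≤ (Q n : ℝ) ^ 4 + -(Q n : ℝ) ^ 3 + 1 := by linarith
    _ ≤ Real.exp ((Q n : ℝ) ^ 4 + -(Q n : ℝ) ^ 3) := Real.add_one_le_exp _
    _ = Real.exp ((Q n : ℝ) ^ 4) * amp Q n := Real.exp_add _ _
    _ ≤ t * amp Q n := by gcongr

/-- The error in the shear, multiplied by the bound on the weight, is small compared with the factor
`t * amp Q (m + 1)` of the main term. -/
theorem bound_mul_error_le (m : ℕ) {t : ℝ} (ht : Real.exp ((Q (m + 1) : ℝ) ^ 4) ≤ t)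
    (ht' : t ≤ Real.exp ((Q (m + 2) : ℝ) ^ 4)) :
    M (m + 1) * (1 / 2 + 4 * t * (amp Q (m + 2) * (Q (m + 2) : ℝ) ^ 2) +
      amp Q (m + 1) * (M (m + 1) * (8 * t ^ 2 * Q (m + 1) / Q (m + 3) + Q (m + 1) / 2 +
        4 * t * (amp Q m * (Q m : ℝ) ^ 2)))) ≤ t * amp Q (m + 1) * (500 / Q m) := by
  have hq := hQ.cast_pos m
  have hq1 := hQ.cast_pos (m + 1)
  have hq2 := hQ.cast_pos (m + 2)
  have hq3 := hQ.cast_pos (m + 3)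
  have hM := hQ.bound_nonneg (m + 1)
  have hM' : M (m + 1) ≤ Q m := hQ.const_succ_le m
  have ha := IsFrequencySeq.amp_pos Q (m + 1)
  have ht0 : 0 < t := (Real.exp_pos _).trans_le ht
  have hQQ : (Q m : ℝ) ^ 5 + 1 ≤ Q (m + 1) := hQ.pow_lt_succ m
  have hle := hQ.le_cast m
  have hta := hQ.sq_le_mul_amp (m + 1) ht
  set X := t * amp Q (m + 1) with hX
  have hX0 : 0 < X := mul_pos ht0 ha
  have hQm1 : (Q m : ℝ) ≤ Q (m + 1) := hQ.cast_le_cast (by omega)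
  have hQm2 : (Q (m + 1) : ℝ) ≤ Q (m + 2) := hQ.cast_le_cast (by omega)
  -- The constant term.
  have e1 : M (m + 1) * (1 / 2) ≤ X * (1 / Q m) := by
    rw [mul_one_div, mul_one_div, div_le_div_iff₀ two_pos hq]
    nlinarith
  -- The higher resonances.
  have e2 : M (m + 1) * (4 * t * (amp Q (m + 2) * (Q (m + 2) : ℝ) ^ 2)) ≤ X * (1 / Q m) := by
    have h0 := IsFrequencySeq.amp_pos Q (m + 2)
    have h1 := hQ.amp_mul_sq_le_inv_pow (m + 2)
    have h2 : 1 ≤ amp Q (m + 1) * Q (m + 2) := by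
      calc (1 : ℝ) = amp Q (m + 1) * Real.exp ((Q (m + 1) : ℝ) ^ 3) := by
            rw [amp, ← Real.exp_add, neg_add_cancel, Real.exp_zero]
        _ ≤ amp Q (m + 1) * Real.exp ((Q (m + 1) : ℝ) ^ 5) := by
            have : (Q (m + 1) : ℝ) ^ 3 ≤ (Q (m + 1) : ℝ) ^ 5 :=
              pow_le_pow_right₀ (by linarith) (by norm_num)
            gcongr
        _ ≤ _ := mul_le_mul_of_nonneg_left (hQ.exp_le (m + 1)) ha.le
    have h3 : (Q m : ℝ) * Q m ≤ Q (m + 2) := by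
      have h4 : (Q m : ℝ) ^ 2 ≤ (Q m : ℝ) ^ 5 := pow_le_pow_right₀ (by linarith) (by norm_num)
      nlinarith
    calc M (m + 1) * (4 * t * (amp Q (m + 2) * (Q (m + 2) : ℝ) ^ 2))
        ≤ Q m * (4 * t * (1 / (4 * (Q (m + 2) : ℝ) ^ 2))) := by gcongr
      _ = t * (Q m * Q m / Q (m + 2)) * (1 / (Q (m + 2) : ℝ)) * (1 / Q m) := by
          field_simp
      _ ≤ t * 1 * amp Q (m + 1) * (1 / Q m) := by
          have h4 : (Q m : ℝ) * Q m / Q (m + 2) ≤ 1 := (div_le_one hq2).2 h3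
          have h5 : 1 / (Q (m + 2) : ℝ) ≤ amp Q (m + 1) := (div_le_iff₀ hq2).2 h2
          gcongr
      _ = X * (1 / Q m) := by rw [hX]; ring
  -- The drift of the resonant phase.
  have e3 : M (m + 1) * (amp Q (m + 1) * (M (m + 1) * (8 * t ^ 2 * Q (m + 1) / Q (m + 3)))) ≤
      X * (8 / Q m) := by
    have h1 : t * (Q (m + 2) : ℝ) ^ 2 ≤ Q (m + 3) := by
      have h2 : (Q (m + 2) : ℝ) ^ 2 ≤ Real.exp ((Q (m + 2) : ℝ) ^ 2) := by
        linarith [Real.add_one_le_exp ((Q (m + 2) : ℝ) ^ 2)]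
      calc t * (Q (m + 2) : ℝ) ^ 2 ≤
            Real.exp ((Q (m + 2) : ℝ) ^ 4) * Real.exp ((Q (m + 2) : ℝ) ^ 2) := by gcongr
        _ = Real.exp ((Q (m + 2) : ℝ) ^ 4 + (Q (m + 2) : ℝ) ^ 2) := (Real.exp_add _ _).symm
        _ ≤ Real.exp ((Q (m + 2) : ℝ) ^ 5) := by
            refine Real.exp_le_exp.2 ?_
            have h3 : (1 : ℝ) ≤ Q (m + 2) := by linarith
            have h4 : (Q (m + 2) : ℝ) ^ 2 ≤ (Q (m + 2) : ℝ) ^ 4 :=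
              pow_le_pow_right₀ h3 (by norm_num)
            have h5 : 0 ≤ (Q (m + 2) : ℝ) ^ 4 * (Q (m + 2) - 2) :=
              mul_nonneg (by positivity) (by linarith)
            nlinarith
        _ ≤ Q (m + 3) := hQ.exp_le (m + 2)
    have h2 : (Q m : ℝ) ^ 3 * Q (m + 1) ≤ (Q (m + 2) : ℝ) ^ 2 := by
      have h3 : (Q m : ℝ) ^ 3 ≤ (Q m : ℝ) ^ 5 := pow_le_pow_right₀ (by linarith) (by norm_num)
      nlinarith
    have h4 : t * ((Q m : ℝ) ^ 3 * Q (m + 1)) / Q (m + 3) ≤ 1 := by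
      rw [div_le_one hq3]
      exact (mul_le_mul_of_nonneg_left h2 ht0.le).trans h1
    calc M (m + 1) * (amp Q (m + 1) * (M (m + 1) * (8 * t ^ 2 * Q (m + 1) / Q (m + 3))))
        ≤ Q m * (amp Q (m + 1) * (Q m * (8 * t ^ 2 * Q (m + 1) / Q (m + 3)))) := by gcongr
      _ = X * (8 / Q m) * (t * ((Q m : ℝ) ^ 3 * Q (m + 1)) / Q (m + 3)) := by
          rw [hX]; field_simp
      _ ≤ X * (8 / Q m) * 1 := by gcongr
      _ = _ := mul_one _
  -- The lower resonances, which have completed a period.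
  have e4 : M (m + 1) * (amp Q (m + 1) * (M (m + 1) * (Q (m + 1) / 2))) ≤ X * (1 / Q m) := by
    have h1 : (Q (m + 1) : ℝ) ^ 4 ≤ t := by linarith [Real.add_one_le_exp ((Q (m + 1) : ℝ) ^ 4)]
    have h2 : (Q m : ℝ) ^ 3 * Q (m + 1) ≤ t := by
      have h3 : (Q m : ℝ) ^ 3 ≤ (Q (m + 1) : ℝ) ^ 3 := by gcongr
      nlinarith
    calc M (m + 1) * (amp Q (m + 1) * (M (m + 1) * (Q (m + 1) / 2)))
        ≤ Q m * (amp Q (m + 1) * (Q m * (Q (m + 1) / 1))) := by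
          gcongr
          norm_num
      _ = (Q m : ℝ) ^ 3 * Q (m + 1) * amp Q (m + 1) * (1 / Q m) := by field_simp
      _ ≤ t * amp Q (m + 1) * (1 / Q m) := by gcongr
  -- The resonance of index `m`, whose amplitude is small.
  have e5 : M (m + 1) * (amp Q (m + 1) * (M (m + 1) * (4 * t * (amp Q m * (Q m : ℝ) ^ 2)))) ≤
      X * (480 / Q m) := by
    have h1 := hQ.amp_mul_pow_le m 4
    norm_num [Nat.factorial] at h1
    have h0 := IsFrequencySeq.amp_pos Q m
    calc M (m + 1) * (amp Q (m + 1) * (M (m + 1) * (4 * t * (amp Q m * (Q m : ℝ) ^ 2))))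
        ≤ Q m * (amp Q (m + 1) * (Q m * (4 * t * (amp Q m * (Q m : ℝ) ^ 2)))) := by gcongr
      _ = X * 4 * (amp Q m * (Q m : ℝ) ^ 4) := by rw [hX]; ring
      _ ≤ X * 4 * (120 / Q m) := by gcongr
      _ = _ := by ring
  have e6 : X * (500 / Q m) = X * (1 / Q m) + X * (1 / Q m) + X * (8 / Q m) + X * (1 / Q m) +
      X * (480 / Q m) + X * (9 / Q m) := by ring
  have e7 : 0 ≤ X * (9 / Q m) := by positivity
  rw [e6]
  linarith

/-- The decay of correlations on the time scale of the `j + 1`-st resonance. -/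
theorem norm_correlation_le (j : ℕ) {m : Fin 3 → ℤ} (hm : m ≠ 0) (l : Fin 3 → ℤ) {t : ℝ}
    (ht : Real.exp ((Q (j + 1) : ℝ) ^ 4) ≤ t) (ht' : t ≤ Real.exp ((Q (j + 2) : ℝ) ^ 4)) :
    ‖∫ p, ((hQ.timeChange (reparamFlow (liouvilleVec Q) hQ.timeChange_pos t p))⁻¹ : ℂ) *
      UnitAddTorus.mFourier m (reparamFlow (liouvilleVec Q) hQ.timeChange_pos t p) *
        UnitAddTorus.mFourier l p‖ ≤
      4 / 3 * (∫ x in (0 : ℝ)..1, |1 - (F (j + 1)).weight x * deriv (F (j + 1)).toFun x|) +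
      4 / 3 * (500 / Q j) + (2 * Real.pi * ((|(m 0 : ℝ)| + |(m 1 : ℝ)|) +
        (|(l 0 : ℝ)| + |(l 1 : ℝ)|)) + 1) / (2 * Real.pi * |pairing m (liouvilleVec Q)|) *
          (1 / Q j) := by
  set n := j + 1 with hn
  have ht0 : 0 < t := (Real.exp_pos _).trans_le ht
  have ha := IsFrequencySeq.amp_pos Q n
  have hX0 : 0 < t * amp Q n := mul_pos ht0 ha
  have hq := hQ.cast_pos j
  have hMQ : M n ≤ Q j := hQ.const_succ_le j
  have hM := hQ.bound_nonneg n
  have hX : (Q n : ℝ) ^ 2 ≤ t * amp Q n := hQ.sq_le_mul_amp n ht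
  have hQjn : (Q j : ℝ) ≤ Q n := hQ.cast_le_cast (by omega)
  have hpair := hQ.pairing_liouvilleVec_ne_zero hm
  set R := (1 / 2 + 4 * t * (amp Q (j + 2) * (Q (j + 2) : ℝ) ^ 2) +
      amp Q (j + 1) * (M (j + 1) * (8 * t ^ 2 * Q (j + 1) / Q (j + 3) + Q (j + 1) / 2 +
        4 * t * (amp Q j * (Q j : ℝ) ^ 2)))) with hR
  have hphase : Continuous (phase (resonance Q n)) := continuous_phase _
  have key := norm_correlation_shear_le (v := liouvilleVec Q) (f := hQ.timeChange)
    (g := hQ.timeChangeDeriv (shearDir Q n)) hQ.timeChange_pos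
    (hQ.hasDerivAt_timeChange (shearDir Q n)) hpair l t
    (B := fun p => (F n).weightOnCircle (phase (resonance Q n) p))
    (B' := fun p => (F n).derivWeightOnCircle (phase (resonance Q n) p))
    (h := fun p => (F n).derivOnCircle (phase (resonance Q n) p))
    ((F n).continuous_weightOnCircle.comp hphase)
    ((F n).continuous_derivWeightOnCircle.comp hphase)
    ((F n).continuous_derivOnCircle.comp hphase)
    (hasDerivAt_weight_phase (resonance Q n) (hQ.pairing_shearDir_self n) n) (b := M n)
    (fun p => (F n).weight_periodic.abs_lift_le (fun x => (hQ.bound n x).2.1) _)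
    (fun p => (F n).weight_periodic.deriv_periodic.abs_lift_le
      (fun x => (hQ.bound n x).2.2.1) _) hX0 (ρ := R / (t * amp Q n)) (c := 4 / 3)
    (fun p => by
      rw [mul_div_cancel₀ R hX0.ne']
      exact hQ.abs_shear_sub_le j ht0.le p)
    (by norm_num)
    (fun p => by
      rw [inv_le_comm₀ (hQ.timeChange_pos p) (by norm_num)]
      have := hQ.three_quarters_le p
      linarith)
  refine key.trans (add_le_add (add_le_add (le_of_eq ?_) ?_) ?_)
  · congr 1
    exact integral_comp_phase (hQ.resonance_ne_zero n)
      (g := fun θ => |1 - (F n).weightOnCircle θ * (F n).derivOnCircle θ|)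
      (continuous_const.sub ((F n).continuous_weightOnCircle.mul
        (F n).continuous_derivOnCircle)).abs
  · refine mul_le_mul_of_nonneg_left ?_ (by norm_num)
    rw [mul_div_assoc', div_le_iff₀ hX0, mul_comm (500 / (Q j : ℝ))]
    exact hQ.bound_mul_error_le j ht ht'
  · have h1 := hQ.abs_pairing_shearDir_le m n
    have h2 := hQ.abs_pairing_shearDir_le l n
    have hpos : 0 < |pairing m (liouvilleVec Q)| := abs_pos.2 hpair
    have h3 : M n / (t * amp Q n) ≤ 1 / Q j := by
      rw [div_le_div_iff₀ hX0 hq]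
      nlinarith
    have h4 : 0 ≤ M n / (t * amp Q n) := by positivity
    have hpi := Real.pi_pos
    calc _ = (2 * Real.pi * (|pairing m (shearDir Q n)| + |pairing l (shearDir Q n)|) + 1) /
          (2 * Real.pi * |pairing m (liouvilleVec Q)|) * (M n / (t * amp Q n)) := by
            field_simp
      _ ≤ _ := by gcongr

/-- The flow is mixing when the weights invert the derivatives of the profiles in the limit. -/
theorem isMixingFlow_reparamFlow (hF : Tendsto (fun n => ∫ x in (0 : ℝ)..1,
      |1 - (F n).weight x * deriv (F n).toFun x|) atTop (𝓝 0)) :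
    IsMixingFlow (reparamFlow (liouvilleVec Q) hQ.timeChange_pos)
      (invMeasure fun p => (hQ.timeChange p)⁻¹) := by
  refine Torus.isMixingFlow_reparamFlow hQ.timeChange_pos
    (fun m hm => hQ.pairing_liouvilleVec_ne_zero hm) fun m l hm => ?_
  have hQt : Tendsto (fun j => (Q j : ℝ)) atTop atTop :=
    tendsto_natCast_atTop_atTop.comp hQ.strictMono.tendsto_atTop
  have hc : ∀ c : ℝ, Tendsto (fun j => c / (Q j : ℝ)) atTop (𝓝 0) := fun c =>
    tendsto_const_nhds.div_atTop hQt
  refine tendsto_zero_of_norm_le_on_intervals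
    (τ := fun j => Real.exp ((Q (j + 1) : ℝ) ^ 4)) ?_ ?_ ?_
    (fun j t h1 h2 => hQ.norm_correlation_le j hm l h1 h2)
  · intro i j hij
    have := hQ.cast_le_cast (show i + 1 ≤ j + 1 by omega)
    dsimp only
    gcongr
  · refine Real.tendsto_exp_atTop.comp ((tendsto_pow_atTop (by norm_num)).comp ?_)
    exact hQt.comp (tendsto_add_atTop_nat 1)
  · have h1 := ((hF.comp (tendsto_add_atTop_nat 1)).const_mul (4 / 3)).add
      ((hc 500).const_mul (4 / 3)) |>.add ((hc 1).const_mul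
        ((2 * Real.pi * ((|(m 0 : ℝ)| + |(m 1 : ℝ)|) + (|(l 0 : ℝ)| + |(l 1 : ℝ)|)) + 1) /
          (2 * Real.pi * |pairing m (liouvilleVec Q)|)))
    simpa using h1

end IsAdapted

/-! ### A Borel–Cantelli lemma for pairwise independent events -/

/-- The second Borel–Cantelli lemma for pairwise independent events, by Chebyshev's inequality. -/
theorem ae_frequently_mem_of_pairwise_indepFun {Ω β : Type*} [MeasurableSpace Ω]
    [MeasurableSpace β] {μ : Measure Ω} [IsProbabilityMeasure μ] {Y : ℕ → Ω → β}
    (hY : ∀ i, Measurable (Y i))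
    (hind : Pairwise fun i j => ProbabilityTheory.IndepFun (Y i) (Y j) μ) {B : ℕ → Set β}
    (hB : ∀ i, MeasurableSet (B i)) (hsum : ¬ Summable fun i => μ.real (Y i ⁻¹' B i)) :
    ∀ᵐ y ∂μ, ∃ᶠ i in atTop, Y i y ∈ B i := by
  set X : ℕ → Ω → ℝ := fun i y => (B i).indicator 1 (Y i y) with hX
  have hXm : ∀ i, Measurable (X i) := fun i =>
    (measurable_one.indicator (hB i)).comp (hY i)
  have hX01 : ∀ i y, 0 ≤ X i y ∧ X i y ≤ 1 := by
    intro i y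
    by_cases h : Y i y ∈ B i <;> simp [hX, h]
  have hL2 : ∀ i, MemLp (X i) 2 μ := fun i =>
    MemLp.of_bound (hXm i).aestronglyMeasurable 1 (ae_of_all _ fun y => by
      rw [Real.norm_eq_abs, abs_of_nonneg (hX01 i y).1]
      exact (hX01 i y).2)
  have hXind : ∀ i j, i ≠ j → ProbabilityTheory.IndepFun (X i) (X j) μ := fun i j hij =>
    (hind hij).comp (measurable_one.indicator (hB i)) (measurable_one.indicator (hB j))
  have hEX : ∀ i, ∫ y, X i y ∂μ = μ.real (Y i ⁻¹' B i) := by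
    intro i
    have : X i = (Y i ⁻¹' B i).indicator 1 := by
      ext y
      by_cases h : Y i y ∈ B i <;> simp [hX, h]
    rw [this, integral_indicator_one (hY i (hB i))]
  have hvar : ∀ i, ProbabilityTheory.variance (X i) μ ≤ μ.real (Y i ⁻¹' B i) := by
    intro i
    refine (ProbabilityTheory.variance_le_expectation_sq (hXm i).aestronglyMeasurable).trans ?_
    rw [← hEX i]
    refine integral_mono (hL2 i).integrable_sq ((hL2 i).integrable (by norm_num)) fun y => ?_
    have := hX01 i y
    simp only [Pi.pow_apply]
    nlinarith
  have hdiv := (not_summable_iff_tendsto_nat_atTop_of_nonneg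
    (fun i => measureReal_nonneg)).1 hsum
  -- The points that are in none of the events of index at least `K` form a null set.
  have hnull : ∀ K, μ {y | ∀ i, K ≤ i → Y i y ∉ B i} = 0 := by
    intro K
    set e : ℕ → ℝ := fun N => ∑ i ∈ Finset.Ico K N, μ.real (Y i ⁻¹' B i) with he
    have hdiv' : Tendsto e atTop atTop := by
      have h1 := tendsto_atTop_add_const_right atTop
        (-∑ i ∈ Finset.range K, μ.real (Y i ⁻¹' B i)) hdiv
      refine h1.congr' ?_
      filter_upwards [eventually_ge_atTop K] with N hN
      rw [he, ← sub_eq_add_neg, ← Finset.sum_Ico_eq_sub _ hN]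
    have hbound : ∀ᶠ N in atTop, μ {y | ∀ i, K ≤ i → Y i y ∉ B i} ≤ ENNReal.ofReal (1 / e N) := by
      filter_upwards [hdiv'.eventually_gt_atTop 0] with N hN
      set S : Ω → ℝ := ∑ i ∈ Finset.Ico K N, X i with hS
      have hSL2 : MemLp S 2 μ := memLp_finsetSum' _ fun i _ => hL2 i
      have hES : ∫ y, S y ∂μ = e N := by
        simp only [hS, Finset.sum_apply]
        rw [integral_finsetSum _ fun i _ => (hL2 i).integrable (by norm_num)]
        exact Finset.sum_congr rfl fun i _ => hEX i
      have hVS : ProbabilityTheory.variance S μ ≤ e N := by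
        rw [hS, ProbabilityTheory.IndepFun.variance_sum (fun i _ => hL2 i)
          fun i _ j _ hij => hXind i j hij]
        exact Finset.sum_le_sum fun i _ => hvar i
      have h1 := ProbabilityTheory.meas_ge_le_variance_div_sq hSL2 hN
      refine (measure_mono fun y hy => ?_).trans (h1.trans (ENNReal.ofReal_le_ofReal ?_))
      · have hSy : S y = 0 := by
          rw [hS, Finset.sum_apply]
          refine Finset.sum_eq_zero fun i hi => ?_
          simp [hX, hy i (Finset.mem_Ico.1 hi).1]
        change e N ≤ |S y - ∫ x, S x ∂μ|
        rw [hSy, hES, zero_sub, abs_neg]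
        exact le_abs_self _
      · rw [div_le_div_iff₀ (by positivity) hN]
        nlinarith
    have hlim : Tendsto (fun N => ENNReal.ofReal (1 / e N)) atTop (𝓝 0) := by
      have := ENNReal.tendsto_ofReal (tendsto_const_nhds.div_atTop hdiv' (a := (1 : ℝ)))
      rwa [ENNReal.ofReal_zero] at this
    exact le_antisymm (ge_of_tendsto hlim hbound) zero_le
  rw [ae_iff]
  refine measure_mono_null (fun y hy => ?_) (measure_iUnion_null hnull)
  rw [Set.mem_ofPred_eq, not_frequently, eventually_atTop] at hy
  exact Set.mem_iUnion.2 hy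

/-! ### Super-recurrence -/

theorem UnitAddCircle.coe_intCast (z : ℤ) : ((z : ℝ) : UnitAddCircle) = 0 := by
  have := AddCircle.coe_zsmul (p := (1 : ℝ)) (n := z) (x := 1)
  rw [AddCircle.coe_period] at this
  simp at this ⊢

theorem UnitAddCircle.exists_coe_eq_abs_le {θ : UnitAddCircle} {r : ℝ} (h : ‖θ‖ ≤ r) :
    ∃ y : ℝ, (y : UnitAddCircle) = θ ∧ |y| ≤ r := by
  obtain ⟨y, rfl⟩ := QuotientAddGroup.mk_surjective θ
  refine ⟨y - round y, ?_, ?_⟩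
  · rw [AddCircle.coe_sub, UnitAddCircle.coe_intCast, sub_zero]
  · rw [← UnitAddCircle.norm_eq]
    exact h

theorem Torus.proj_intCast {d : ℕ} (z : Fin d → ℤ) : Torus.proj (fun i => (z i : ℝ)) = 0 := by
  ext i
  exact UnitAddCircle.coe_intCast (z i)

theorem Flow.toHomeomorph_one_pow {α : Type*} [TopologicalSpace α] (Φ : Flow ℝ α) (k : ℕ) (x : α) :
    ((Φ.toHomeomorph 1) ^ k) x = Φ k x := by
  induction k generalizing x with
  | zero => simp
  | succ k ih =>
    rw [pow_succ, Homeomorph.mul_apply, ih, Flow.toHomeomorph_apply, ← Flow.map_add]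
    push_cast
    rfl

theorem Flow.toHomeomorph_one_zpow {α : Type*} [TopologicalSpace α] (Φ : Flow ℝ α) (k : ℤ) (x : α) :
    ((Φ.toHomeomorph 1) ^ k) x = Φ k x := by
  obtain ⟨n, rfl | rfl⟩ := k.eq_nat_or_neg
  · rw [zpow_natCast, toHomeomorph_one_pow]
    simp
  · rw [zpow_neg, zpow_natCast]
    have h : Φ n (Φ ((-(n : ℤ) : ℤ) : ℝ) x) = x := by
      rw [← Flow.map_add]
      simp
    have h2 : ((Φ.toHomeomorph 1) ^ n)⁻¹ (((Φ.toHomeomorph 1) ^ n)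
        (Φ ((-(n : ℤ) : ℤ) : ℝ) x)) = Φ ((-(n : ℤ) : ℤ) : ℝ) x :=
      ((Φ.toHomeomorph 1) ^ n).symm_apply_apply _
    rwa [toHomeomorph_one_pow, h] at h2

namespace IsFrequencySeq

open Torus

variable {M : ℕ → ℝ} {Q : ℕ → ℕ} (hQ : IsFrequencySeq M Q)
include hQ

theorem norm_liouvilleVec_le : ‖liouvilleVec Q‖ ≤ 1 := by
  have h : ∀ b, |parityTail Q b 0| ≤ 1 := by
    intro b
    rw [abs_of_nonneg (parityTail_nonneg _ _)]
    refine (hQ.parityTail_le b 0).trans ((div_le_one (hQ.cast_pos 0)).2 ?_)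
    linarith [hQ.le_cast 0]
  rw [pi_norm_le_iff_of_nonneg zero_le_one]
  intro i
  fin_cases i
  · simpa [liouvilleVec] using h 0
  · simpa [liouvilleVec] using h 1
  · simp [liouvilleVec]

/-- Two different even resonant phases are independent. -/
theorem indepFun_phase {i j : ℕ} (hi : i % 2 = 0) (hj : j % 2 = 0) (hij : i < j) :
    ProbabilityTheory.IndepFun (phase (resonance Q i)) (phase (resonance Q j))
      (volume : Measure (Torus 3)) := by
  have hdet := hQ.resonance_det_ne_zero hi hj hij
  set P : ℕ → ℝ := fun k => parityNum Q 0 k with hP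
  set D : ℝ := Q i * P j - Q j * P i with hD
  have hsurj : Function.Surjective
      ((phase (resonance Q i)).prod (phase (resonance Q j)) :
        Torus 3 →+ UnitAddCircle × UnitAddCircle) := by
    rintro ⟨θ, η⟩
    obtain ⟨a, rfl⟩ := QuotientAddGroup.mk_surjective θ
    obtain ⟨b, rfl⟩ := QuotientAddGroup.mk_surjective η
    refine ⟨proj ![(P j * a - P i * b) / D, 0, (Q j * a - Q i * b) / D], Prod.ext ?_ ?_⟩
    · change phase (resonance Q i) _ = _
      rw [phase_proj, pairing_even hi]
      simp only [Matrix.cons_val_zero, Matrix.cons_val]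
      have : (Q i : ℝ) * ((P j * a - P i * b) / D) - parityNum Q 0 i *
          ((Q j * a - Q i * b) / D) = a := by
        change (Q i : ℝ) * ((P j * a - P i * b) / D) - P i * ((Q j * a - Q i * b) / D) = a
        field_simp
        rw [hD]
        ring
      rw [this]
    · change phase (resonance Q j) _ = _
      rw [phase_proj, pairing_even hj]
      simp only [Matrix.cons_val_zero, Matrix.cons_val]
      have : (Q j : ℝ) * ((P j * a - P i * b) / D) - parityNum Q 0 j *
          ((Q j * a - Q i * b) / D) = b := by
        change (Q j : ℝ) * ((P j * a - P i * b) / D) - P j * ((Q j * a - Q i * b) / D) = b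
        field_simp
        rw [hD]
        ring
      rw [this]
  have hci := continuous_phase (resonance Q i)
  have hcj := continuous_phase (resonance Q j)
  have hmp : MeasurePreserving ((phase (resonance Q i)).prod (phase (resonance Q j)))
      (volume : Measure (Torus 3))
      ((volume : Measure UnitAddCircle).prod (volume : Measure UnitAddCircle)) :=
    AddMonoidHom.measurePreserving (hci.prodMk hcj) hsurj (by simp)
  rw [ProbabilityTheory.indepFun_iff_map_prod_eq_prod_map_map hci.measurable.aemeasurable
    hcj.measurable.aemeasurable, (measurePreserving_phase (hQ.resonance_ne_zero i)).map_eq,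
    (measurePreserving_phase (hQ.resonance_ne_zero j)).map_eq]
  exact hmp.map_eq

end IsFrequencySeq

namespace IsAdapted

open Torus

variable {F : ℕ → Profile} {M : ℕ → ℝ} {Q : ℕ → ℕ} (hQ : IsAdapted F M Q)
include hQ

/-- On the plateau of the `j`-th resonance, the trajectory takes a time very close to `Q (j + 1)`
to cover the distance `Q (j + 1)`. -/
theorem abs_travelTime_sub_le_of_plateau
    (hF : ∀ (n : ℕ) (x : ℝ), |x| ≤ 1 / (7 * ((n : ℝ) + 2)) → (F n).toFun x = 0) (j : ℕ)
    {p : Torus 3} (hp : ‖phase (resonance Q j) p‖ ≤ 1 / (14 * ((j : ℝ) + 2))) :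
    |travelTime (liouvilleVec Q) hQ.timeChange p (Q (j + 1)) - Q (j + 1)| ≤
      (Q (j + 1) : ℝ) ^ 2 / Q (j + 2) +
        2 * Q (j + 1) * (amp Q (j + 1) * (Q (j + 1) : ℝ) ^ 2) := by
  obtain ⟨z, w, hzw, hw⟩ := hQ.exists_int_near (j + 1)
  have hqn := hQ.cast_pos (j + 1)
  have hqn2 := hQ.cast_pos (j + 2)
  rw [travelTime_timeChange, add_sub_cancel_left]
  have := hQ.abs_tsum_le (x := fun i => amp Q i * ∫ τ in (0 : ℝ)..Q (j + 1),
      (F i).onCircle (phase (resonance Q i) p +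
        ((τ * pairing (resonance Q i) (liouvilleVec Q) : ℝ) : UnitAddCircle)))
    (A := 4 * (Q (j + 1) : ℝ) ^ 2 / Q (j + 2)) (B := Q (j + 1)) (by positivity) hqn.le (j + 1)
    fun i => by
      have ha := IsFrequencySeq.amp_pos Q i
      have hb := hQ.amp_mul_bound_le' i
      have h0 := IsFrequencySeq.amp_mul_sq_nonneg Q i
      have hM := hQ.bound_nonneg i
      have hA : 0 ≤ 4 * (Q (j + 1) : ℝ) ^ 2 / Q (j + 2) := by positivity
      rw [abs_mul, abs_of_pos ha]
      rcases lt_trichotomy i j with hi | rfl | hi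
      · rw [if_neg (by omega), add_zero]
        set ε := pairing (resonance Q i) (liouvilleVec Q) with hε
        have hε0 : 0 < ε := hQ.pairing_resonance_pos i
        have hint := Function.Periodic.integral_lift (F i).periodic (F i).primitive_periodic
          (F i).hasDerivAt_primitive (F i).contDiff.continuous (phase (resonance Q i) p)
          hε0.ne' (Q (j + 1))
        -- The phase is almost periodic of period `Q (j + 1)`.
        have hper : (((Q (j + 1) : ℝ) * ε : ℝ) : UnitAddCircle) =
            ((pairing (resonance Q i) w : ℝ) : UnitAddCircle) := by
          rw [hε, ← pairing_smul, hzw, pairing_add, AddCircle.coe_add]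
          have : pairing (resonance Q i) (fun k => (z k : ℝ)) =
              ((∑ k, resonance Q i k * z k : ℤ) : ℝ) := by
            simp [pairing]
          rw [this, UnitAddCircle.coe_intCast, zero_add]
        have h1 := Function.Periodic.abs_lift_add_sub_le (F i).primitive_periodic
          (F i).hasDerivAt_primitive (hQ.abs_toFun_le i) (phase (resonance Q i) p)
          (pairing (resonance Q i) w)
        have h2 := hQ.abs_pairing_le i w
        have h3 := hQ.one_div_pairing_le (i := i) (n := j + 1) (by omega)
        have hq := hQ.cast_pos i
        rw [hper] at hint
        have h4 : |∫ τ in (0 : ℝ)..Q (j + 1), (F i).onCircle (phase (resonance Q i) p +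
            ((τ * ε : ℝ) : UnitAddCircle))| ≤ M i * (4 * (Q (j + 1) : ℝ) ^ 2 / Q (j + 2)) := by
          rw [Profile.onCircle, hint, abs_div, abs_of_pos hε0, div_eq_mul_one_div]
          calc _ ≤ M i * |pairing (resonance Q i) w| * (Q (j + 1) / Q i) := by gcongr
            _ ≤ M i * (2 * Q i * (2 * Q (j + 1) / Q (j + 2))) * (Q (j + 1) / Q i) := by
              gcongr
              exact h2.trans (by gcongr)
            _ = _ := by field_simp; ring
        calc amp Q i * _ ≤ amp Q i * (M i * (4 * (Q (j + 1) : ℝ) ^ 2 / Q (j + 2))) := by gcongr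
          _ = amp Q i * M i * (4 * (Q (j + 1) : ℝ) ^ 2 / Q (j + 2)) := by ring
          _ ≤ _ := by gcongr
      · rw [if_neg (by omega), add_zero]
        obtain ⟨y, hy, hy2⟩ := UnitAddCircle.exists_coe_eq_abs_le hp
        -- The phase does not leave the plateau during the time `Q (i + 1)`.
        have hzero : ∫ τ in (0 : ℝ)..Q (i + 1), (F i).onCircle (phase (resonance Q i) p +
            ((τ * pairing (resonance Q i) (liouvilleVec Q) : ℝ) : UnitAddCircle)) = 0 := by
          rw [← hy]
          refine intervalIntegral.integral_zero_ae (ae_of_all _ fun τ hτ => ?_)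
          rw [Set.uIoc_of_le hqn.le] at hτ
          refine hF i (y + τ * pairing (resonance Q i) (liouvilleVec Q)) ?_
          have h1 := hQ.pairing_resonance_le i
          have h2 := hQ.pairing_resonance_pos i
          have hq := hQ.cast_pos i
          have hle := hQ.le_cast i
          have hi2 : (i : ℝ) + 2 ≤ 2 * Q i := by
            have : (i : ℝ) ≤ Q i := by exact_mod_cast hQ.strictMono.le_apply
            linarith
          have h3 : τ * pairing (resonance Q i) (liouvilleVec Q) ≤ 1 / (14 * ((i : ℝ) + 2)) := by
            calc _ ≤ (Q (i + 1) : ℝ) * (2 * Q i / Q (i + 2)) :=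
                  mul_le_mul hτ.2 h1 h2.le hqn.le
              _ = 2 * (Q i * Q (i + 1)) / Q (i + 2) := by ring
              _ ≤ _ := by
                rw [div_le_div_iff₀ hqn2 (by positivity)]
                have h4 : (Q (i + 1) : ℝ) ^ 5 ≤ Q (i + 2) := by linarith [hQ.pow_lt_succ (i + 1)]
                have h5 : (Q i : ℝ) ≤ Q (i + 1) := hQ.cast_le_cast (by omega)
                have h6 : 56 * (Q (i + 1) : ℝ) ^ 3 ≤ (Q (i + 1) : ℝ) ^ 5 := by
                  have : 56 ≤ (Q (i + 1) : ℝ) ^ 2 := by nlinarith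
                  calc 56 * (Q (i + 1) : ℝ) ^ 3 ≤ (Q (i + 1) : ℝ) ^ 2 * (Q (i + 1) : ℝ) ^ 3 := by
                        gcongr
                    _ = _ := by ring
                calc 2 * ((Q i : ℝ) * Q (i + 1)) * (14 * ((i : ℝ) + 2))
                    ≤ 2 * ((Q (i + 1) : ℝ) * Q (i + 1)) * (14 * (2 * Q (i + 1))) := by
                      gcongr
                      linarith
                  _ = 56 * (Q (i + 1) : ℝ) ^ 3 := by ring
                  _ ≤ _ := by linarith
          have h7 : |τ * pairing (resonance Q i) (liouvilleVec Q)| ≤ 1 / (14 * ((i : ℝ) + 2)) := by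
            rwa [abs_of_nonneg (mul_nonneg hτ.1.le h2.le)]
          have h8 : (1 : ℝ) / (14 * ((i : ℝ) + 2)) + 1 / (14 * ((i : ℝ) + 2)) =
              1 / (7 * ((i : ℝ) + 2)) := by field_simp; norm_num
          exact (abs_add_le _ _).trans (by linarith)
        rw [hzero, abs_zero, mul_zero]
        exact mul_nonneg h0 hA
      · rw [if_pos (by omega)]
        have h1 := (F i).periodic.abs_integral_lift_le_mul (hQ.abs_toFun_le i)
          (phase (resonance Q i) p) (pairing (resonance Q i) (liouvilleVec Q)) (Q (j + 1))
        rw [abs_of_pos hqn] at h1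
        calc amp Q i * _ ≤ amp Q i * (M i * Q (j + 1)) := mul_le_mul_of_nonneg_left h1 ha.le
          _ = amp Q i * M i * Q (j + 1) := by ring
          _ ≤ amp Q i * (Q i : ℝ) ^ 2 * Q (j + 1) := by gcongr
          _ ≤ _ := mul_le_mul_of_nonneg_left (by linarith) h0
  refine this.trans (le_of_eq ?_)
  ring

omit hQ in
theorem polynomial_mul_exp_le {q : ℝ} (hq : 1000 ≤ q) :
    6 * q ^ 3 * Real.exp (-q ^ 3) ≤ Real.exp (-q ^ 2) := by
  have h1 : q ^ 3 / 2 ≤ q ^ 3 - q ^ 2 := by nlinarith [sq_nonneg q]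
  have h0 : 0 < q ^ 3 := by positivity
  have h2 := Real.quadratic_le_exp_of_nonneg (x := q ^ 3 - q ^ 2) (by linarith)
  have h3 : (48 : ℝ) ≤ q ^ 3 := by nlinarith [sq_nonneg q]
  have h4 : 6 * q ^ 3 ≤ Real.exp (q ^ 3 - q ^ 2) := by nlinarith
  calc 6 * q ^ 3 * Real.exp (-q ^ 3) ≤ Real.exp (q ^ 3 - q ^ 2) * Real.exp (-q ^ 3) := by gcongr
    _ = Real.exp (-q ^ 2) := by rw [← Real.exp_add]; ring_nf

/-- Points on the plateau of the `j`-th resonance return at time `Q (j + 1)`. -/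
theorem dist_reparamFlow_le_of_plateau
    (hF : ∀ (n : ℕ) (x : ℝ), |x| ≤ 1 / (7 * ((n : ℝ) + 2)) → (F n).toFun x = 0) (j : ℕ)
    {p : Torus 3} (hp : ‖phase (resonance Q j) p‖ ≤ 1 / (14 * ((j : ℝ) + 2))) :
    dist (reparamFlow (liouvilleVec Q) hQ.timeChange_pos (Q (j + 1)) p) p ≤
      Real.exp (-(Q (j + 1) : ℝ) ^ 2) := by
  obtain ⟨z, w, hzw, hw⟩ := hQ.exists_int_near (j + 1)
  have h1 := hQ.abs_travelTime_sub_le_of_plateau hF j hp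
  set q : ℝ := (Q (j + 1) : ℝ) with hq
  set σ := displacement (liouvilleVec Q) hQ.timeChange q p with hσ
  have hq1 : 1000 ≤ q := hQ.le_cast (j + 1)
  have hq0 : 0 < q := by linarith
  have h2 := abs_le_travelTime_sub (v := liouvilleVec Q) hQ.three_quarters_le p q σ
  rw [hσ, travelTime_displacement hQ.timeChange_pos, ← hσ, abs_sub_comm q] at h2
  have h3 := hQ.norm_liouvilleVec_le
  have h4 : 1 / (Q (j + 2) : ℝ) ≤ Real.exp (-q ^ 3) := by
    rw [Real.exp_neg, ← one_div]
    refine one_div_le_one_div_of_le (Real.exp_pos _)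
      ((Real.exp_le_exp.2 ?_).trans (hQ.exp_le (j + 1)))
    exact pow_le_pow_right₀ (by linarith) (by norm_num)
  have h5 : reparamFlow (liouvilleVec Q) hQ.timeChange_pos q p =
      p + proj (w + (σ - q) • liouvilleVec Q) := by
    rw [reparamFlow_apply, ← hσ]
    congr 1
    have : σ • liouvilleVec Q = (fun i => (z i : ℝ)) + (w + (σ - q) • liouvilleVec Q) := by
      rw [← add_assoc, ← hzw, ← add_smul, add_sub_cancel]
    rw [this, proj_add, proj_intCast, zero_add]
  rw [h5]
  refine (dist_add_proj_le _ _).trans ((norm_add_le _ _).trans ?_)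
  rw [norm_smul, Real.norm_eq_abs]
  have h6 : |σ - q| * ‖liouvilleVec Q‖ ≤ |σ - q| := mul_le_of_le_one_right (abs_nonneg _) h3
  have ha : amp Q (j + 1) = Real.exp (-q ^ 3) := rfl
  rw [ha, div_eq_mul_one_div] at h1
  rw [div_eq_mul_one_div] at hw
  have h7 : 2 * q * (1 / (Q (j + 2) : ℝ)) ≤ 2 * q * Real.exp (-q ^ 3) := by gcongr
  have h8 : q ^ 2 * (1 / (Q (j + 2) : ℝ)) ≤ q ^ 2 * Real.exp (-q ^ 3) := by gcongr
  have h9 := polynomial_mul_exp_le hq1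
  have hE := Real.exp_pos (-q ^ 3)
  have h10 : (2 * q + 4 / 3 * (q ^ 2 + 2 * q ^ 3)) * Real.exp (-q ^ 3) ≤
      6 * q ^ 3 * Real.exp (-q ^ 3) := by
    refine mul_le_mul_of_nonneg_right ?_ hE.le
    nlinarith [sq_nonneg q, mul_pos hq0 hq0]
  have hw' : ‖w‖ ≤ 2 * q * (1 / (Q (j + 2) : ℝ)) := hw
  nlinarith

/-- Almost every point is super-recurrent, as its resonant phases of even index visit the plateaus
infinitely often. -/
theorem ae_isSuperRecurrent
    (hF : ∀ (n : ℕ) (x : ℝ), |x| ≤ 1 / (7 * ((n : ℝ) + 2)) → (F n).toFun x = 0) :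
    ∀ᵐ p : Torus 3, IsSuperRecurrent
      ((reparamFlow (liouvilleVec Q) hQ.timeChange_pos).toHomeomorph 1) p := by
  set B : ℕ → Set UnitAddCircle := fun i =>
    Metric.closedBall 0 (1 / (14 * (((2 * i : ℕ) : ℝ) + 2))) with hB
  have hvol : ∀ i, (volume : Measure (Torus 3)).real (phase (resonance Q (2 * i)) ⁻¹' B i) =
      1 / 14 * (1 / ((i + 1 : ℕ) : ℝ)) := by
    intro i
    rw [(measurePreserving_phase (hQ.resonance_ne_zero (2 * i))).measureReal_preimage
      Metric.isClosed_closedBall.measurableSet.nullMeasurableSet, Measure.real,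
      AddCircle.volume_closedBall, min_eq_right, ENNReal.toReal_ofReal (by positivity)]
    · push_cast
      field_simp
    · rw [mul_one_div, div_le_one (by positivity)]
      push_cast
      linarith [Nat.cast_nonneg (α := ℝ) i]
  have hae := ae_frequently_mem_of_pairwise_indepFun (μ := (volume : Measure (Torus 3)))
    (Y := fun i => phase (resonance Q (2 * i))) (fun i => (continuous_phase _).measurable)
    (fun i j hij => by
      rcases lt_or_gt_of_ne hij with h | h
      · exact hQ.indepFun_phase (by omega) (by omega) (by omega)
      · exact (hQ.indepFun_phase (by omega) (by omega) (by omega)).symm)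
    (B := B) (fun i => Metric.isClosed_closedBall.measurableSet) (by
      simp only [hvol]
      rw [summable_mul_left_iff (by norm_num),
        summable_nat_add_iff (f := fun i : ℕ => 1 / (i : ℝ)) 1]
      exact Real.not_summable_one_div_natCast)
  filter_upwards [hae] with p hp
  obtain ⟨κ, hκ, hκp⟩ := extraction_of_frequently_atTop hp
  refine ⟨2, one_lt_two, fun n => Q (2 * κ n + 1), fun a b hab => hQ.strictMono ?_, fun n => ?_⟩
  · have := hκ hab
    omega
  · rw [Flow.toHomeomorph_one_pow, Real.rpow_two]
    exact hQ.dist_reparamFlow_le_of_plateau hF (2 * κ n) (mem_closedBall_zero_iff.1 (hκp n))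

end IsAdapted

theorem mainTheorem1 :
    ∃ (α α' : ℝ) (φ : Torus 3 → ℝ) (Φ : Flow ℝ (Torus 3)),
      Torus.IsSmooth φ ∧ (∀ x, 0 < φ x) ∧
      Torus.IsReparametrizedFlow ![α, α', 1] φ Φ ∧
      IsUniqueInvariantMeasure Φ (Torus.invMeasure φ) ∧
      IsMixingFlow Φ (Torus.invMeasure φ) ∧
      (∀ᵐ x : Torus 3, IsSuperRecurrent (Φ.toHomeomorph 1) x) ∧
      ∀ V : C(Torus 3, ℝ), (∃ C r : ℝ≥0, 0 < r ∧ HolderWith C r V) →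
        ∀ᵐ x : Torus 3, HasPurelyContinuousSpectrum (schrodinger (Φ.toHomeomorph 1) V x) := by
  obtain ⟨F, hplateau, hmean⟩ := exists_profiles
  obtain ⟨M, Q, hQ⟩ := exists_isAdapted F
  have hrec := hQ.ae_isSuperRecurrent hplateau
  refine ⟨parityTail Q 0 0, parityTail Q 1 0, fun p => (hQ.timeChange p)⁻¹,
    Torus.reparamFlow (liouvilleVec Q) hQ.timeChange_pos, hQ.isSmooth_inv_timeChange,
    fun p => inv_pos.2 (hQ.timeChange_pos p),
    Torus.isReparametrizedFlow_reparamFlow hQ.timeChange_pos,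
    Torus.isUniqueInvariantMeasure_invMeasure hQ.timeChange_pos
      (fun m hm => hQ.pairing_liouvilleVec_ne_zero hm),
    hQ.isMixingFlow_reparamFlow hmean, hrec, ?_⟩
  rintro V ⟨c, r, hr, hV⟩
  obtain ⟨B, hB, hdist⟩ := Torus.exists_dist_reparamFlow_le (v := liouvilleVec Q)
    hQ.timeChange_pos hQ.abs_timeChange_sub_le
  filter_upwards [hrec] with x hx
  refine hasPurelyContinuousSpectrum_of_isSuperRecurrent _ hB (fun n y z => ?_) V hr hV hx
  rw [Flow.toHomeomorph_one_zpow, Flow.toHomeomorph_one_zpow]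
  exact hdist n y z
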